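/- **Setting.** For finite sets of labels with $k+2l\ge 3$, let $\overline{\mathcal M}^\tau_{k,l}$ be the moduli space of stable real genus $0$ curves $(\Sigma,(x_i)_{i\le k},(z_i^+,z_i^-)_{i\le l},\sigma)$: $\Sigma$ is a tree of Riemann spheres, $\sigma$ an anti-holomorphic involution with separating (equivalently, non-empty) fixed locus, the $x_i$ are fixed by $\sigma$ and $\sigma(z_i^+)=z_i^-$. It is a compact smooth manifold of dimension $k+2l-3$, embedded by the cross-ratios of its marked points; if $k=0$, its boundary consists of the curves with no $\sigma$-invariant component, and otherwise it has no boundary. The open codimension $1$ strata off the boundary consist of the curves with exactly two components, both real, with a prescribed distribution of the marked points; $S_i$ is the one where $z_i^\pm$ are the only marked points on one of the components, and $\overline S_i$ is its closure. Strata of codimension at least $2$ consist of curves with at least two nodes. Let $\mathfrak f^{\mathbb R}_{k,l;i}:\overline{\mathcal M}^\tau_{k,l}\to\overline{\mathcal M}^\tau_{k-1,l}$ be the morphism forgetting $x_i$, and $\overline{\mathcal M}^{\tau;\bigstar}_{k,l;i}$ the set of curves for which $x_i$ and $z_1^+$ lie on the same component; on this set, the vertical tangent line of $\mathfrak f^{\mathbb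 R}_{k,l;i}$ is oriented by $\mathfrak o_i^{\mathbb R}$: the point $x_i$ moves counterclockwise on the fixed circle of its component, viewed as the boundary of the disk containing $z_1^+$. For a codimension $1$ stratum $S$, let $k_1,l_1$ be the numbers of real points and of conjugate pairs on the component containing $z_1^\pm$ and $k_2,l_2$ those on the other one, so that $\overline S\approx\overline{\mathcal M}^\tau_{k_1+1,l_1}\times\overline{\mathcal M}^\tau_{k_2+1,l_2}$, the additional real points being the node. If $S\ne S_1$, let $\mathfrak f_{S;1}:\overline S\to\overline{\mathcal M}^\tau_{k_1,l_1}\times\overline{\mathcal M}^\tau_{k_2+1,l_2}$ be the morphism forgetting the node $\mathrm{nd}$ on the first component, with its vertical tangent line oriented by the counterclockwise rotation $\mathfrak o^{\mathbb R}_{\mathrm{nd}}$ of the node. **Regularity.** A bordered hypersurface $\Upsilon\subset\overline{\mathcal M}^\tau_{k,l}$ is *regular* if * $\overline\Upsilon-\Upsilon$ lies in the strata of codimension at least $2$; * for every $i\le k$: $\Upsilon-\partial\Upsilon\subset\overline{\mathcal M}^{\tau;\bigstar}_{k,l;i}$, $\mathfrak f^{\mathbb R}_{k,l;i}(\overline\Upsilon-\Upsilon)$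 lies in the strata of codimension at least $2$, and $\mathfrak f^{\mathbb R}_{k,l;i}(\partial\Upsilon)$ lies in the union of the boundary and these strata; * for every codimension $1$ stratum $S$ off the boundary: $\Upsilon$ and $\partial\Upsilon$ are transverse to $\overline S$; $\Upsilon\cap\overline S=\Upsilon_1\times\overline{\mathcal M}^\tau_{k_2+1,l_2}$ for some $\Upsilon_1\subset\overline{\mathcal M}^{\tau;\bigstar}_{k_1+1,l_1;\mathrm{nd}}$; and, if $S\ne S_1$, $\mathfrak f_{S;1}((\overline\Upsilon-\Upsilon)\cap\overline S)$ lies in the strata of codimension at least $2$ and $\mathfrak f_{S;1}(\partial\Upsilon\cap\overline S)$ in the union of the boundary and these strata. For a co-orientation $\mathfrak o^c_\Upsilon$ (an orientation of the normal line bundle $\mathcal N\Upsilon$) of a regular hypersurface, $\deg^{\mathbb R}_i(\Upsilon,\mathfrak o^c_\Upsilon)$ is the signed number of points in the fiber of $\mathfrak f^{\mathbb R}_{k,l;i}|_\Upsilon$ over a regular value, the sign of a point being $+1$ if the projection of the vertical tangent line with the orientation $\mathfrak o_i^{\mathbb R}$ to $\mathcal N\Upsilon$ preserves the orientations and $-1$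 if it reverses them; $\deg_S(\Upsilon,\mathfrak o_\Upsilon^c)$ is defined in the same way with $\mathfrak f_{S;1}|_{\Upsilon\cap\overline S}$ and $\mathfrak o^{\mathbb R}_{\mathrm{nd}}$. Let $P^\pm\in\overline{\mathcal M}^\tau_{1,2}$ be the three-component curve for which $z_1^+$ and $z_2^\pm$ lie on the same component, and let $\mathfrak o^c_{P^\pm}$ be the complex orientation of $T_{P^\pm}\overline{\mathcal M}^\tau_{1,2}$, viewed as the complex line of smoothings of the node separating the component of $z_1^+$ from the real component (with the conjugate smoothing of the other node). **Lemma.** There exist a smoothly embedded closed path $\Upsilon\subset\overline{\mathcal M}^\tau_{1,2}$ (an embedded compact interval) and a co-orientation $\mathfrak o^c_\Upsilon$ of $\Upsilon$ such that $\Upsilon$ is a regular hypersurface, $\Upsilon\cap\overline S_1=\emptyset$, and $$\partial(\Upsilon,\mathfrak o^c_\Upsilon)=(P^+,\mathfrak o^c_{P^+})\sqcup(P^-,\mathfrak o^c_{P^-}),\qquad \deg^{\mathbb R}_1(\Upsilon,\mathfrak o^c_\Upsilon)=1,\qquad \deg_{S_2}(\Upsilon,\mathfrak o^c_\Upsilon)=-1,$$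 where the co-orientation of an endpoint is given by the outer normal of $\Upsilon$ followed by $\mathfrak o^c_\Upsilon$. -/

import Mathlib

open scoped ContDiff

noncomputable section

namespace RealDM

/-! ### Real stable curves of genus zero -/

/-- The Riemann sphere, with the action of `GL (Fin 2) ℂ` by Möbius transformations. -/
abbrev P1 := OnePoint ℂ

/-- Complex conjugation on the Riemann sphere. -/
def P1.conj (z : P1) : P1 := OnePoint.map (starRingEnd ℂ) z

/-- Labels of the marked points: `inl i` is the real point `x_i`,
`inr (i, true)` is `z_i⁺` and `inr (i, false)` is `z_i⁻`. -/
abbrev Mark (K L : Type) := K ⊕ (L × Bool)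

/-- The exchange of the two points in each conjugate pair. -/
def Mark.conj {K L : Type} : Mark K L → Mark K L
  | Sum.inl i => Sum.inl i
  | Sum.inr (i, b) => Sum.inr (i, !b)

/-- A connected nodal curve of arithmetic genus zero (a tree of Riemann spheres) with an
anti-holomorphic involution whose fixed locus is non-empty.

The components are indexed by `Fin n`, the nodes are the edges of the tree `graph`.
For `v ≠ w`, the point `dir v w` of the component `v` is the node of `v` through which one leaves
`v` on the way to the component `w`; the values `dir v v` play no role.
The involution sends the point `z` of the component `v` to the point `sig v z` of the
component `inv v`.  Its fixed locus contains either a point of an invariant component or a node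
whose two branches are exchanged.  (On a tree of spheres, the fixed locus of an anti-holomorphic
involution is separating if and only if it is not empty.) -/
structure RealTree where
  n : ℕ
  graph : SimpleGraph (Fin n)
  isTree : graph.IsTree
  dir : Fin n → Fin n → P1
  dir_branch : ∀ v u w, graph.Adj u w → u ≠ v → w ≠ v → dir v u = dir v w
  dir_inj : ∀ v u w, graph.Adj v u → graph.Adj v w → dir v u = dir v w → u = w
  inv : Fin n → Fin n
  sig : Fin n → P1 → P1
  inv_inv : ∀ v, inv (inv v) = v
  inv_adj : ∀ v w, graph.Adj v w → graph.Adj (inv v) (inv w)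
  sig_antiholomorphic : ∀ v, ∃ g : GL (Fin 2) ℂ, ∀ z, sig v z = g • P1.conj z
  sig_sig : ∀ v z, sig (inv v) (sig v z) = z
  sig_dir : ∀ v w, graph.Adj v w → sig v (dir v w) = dir (inv v) (inv w)
  fixed : (∃ v z, inv v = v ∧ sig v z = z) ∨ ∃ v w, graph.Adj v w ∧ inv v = w

/-- Marked points on a tree of spheres, distinct from each other and from the nodes, real or
in conjugate pairs, making every component stable. -/
structure Marking (T : RealTree) (K L : Type) where
  comp : Mark K L → Fin T.n
  pos : Mark K L → P1
  pos_inj : ∀ i j, comp i = comp j → pos i = pos j → i = j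
  pos_ne_node : ∀ i w, T.graph.Adj (comp i) w → pos i ≠ T.dir (comp i) w
  stable : ∀ v, 3 ≤ Set.ncard
    ({z | ∃ w, T.graph.Adj v w ∧ T.dir v w = z} ∪ {z | ∃ i, comp i = v ∧ pos i = z})
  comp_conj : ∀ i, comp (Mark.conj i) = T.inv (comp i)
  pos_conj : ∀ i, pos (Mark.conj i) = T.sig (comp i) (pos i)

/-- A stable real curve of genus zero. -/
abbrev Curve (K L : Type) := Σ T : RealTree, Marking T K L

/-- Isomorphisms of marked real curves. -/
def Iso {K L : Type} (C D : Curve K L) : Prop :=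
  ∃ (f : Fin C.1.n ≃ Fin D.1.n) (g : Fin C.1.n → GL (Fin 2) ℂ),
    (∀ v w, C.1.graph.Adj v w ↔ D.1.graph.Adj (f v) (f w)) ∧
    (∀ v w, C.1.graph.Adj v w → D.1.dir (f v) (f w) = g v • C.1.dir v w) ∧
    (∀ v, D.1.inv (f v) = f (C.1.inv v)) ∧
    (∀ v z, D.1.sig (f v) (g v • z) = g (C.1.inv v) • C.1.sig v z) ∧
    (∀ i, D.2.comp i = f (C.2.comp i)) ∧
    (∀ i, D.2.pos i = g (C.2.comp i) • C.2.pos i)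

theorem Iso.refl {K L : Type} (C : Curve K L) : Iso C C :=
  ⟨Equiv.refl _, fun _ => 1, by simp⟩

theorem Iso.symm {K L : Type} {C D : Curve K L} (h : Iso C D) : Iso D C := by
  obtain ⟨f, g, h1, h2, h3, h4, h5, h6⟩ := h
  refine ⟨f.symm, fun v => (g (f.symm v))⁻¹, ?_, ?_, ?_, ?_, ?_, ?_⟩
  · intro v w
    rw [h1]
    simp
  · intro v w hvw
    have := h2 (f.symm v) (f.symm w) (by rw [h1]; simpa using hvw)
    simp only [Equiv.apply_symm_apply] at this
    rw [this, inv_smul_smul]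
  · intro v
    rw [Equiv.eq_symm_apply, ← h3, Equiv.apply_symm_apply]
  · intro v z
    have h := h4 (f.symm v) ((g (f.symm v))⁻¹ • z)
    have e : f.symm (D.1.inv v) = C.1.inv (f.symm v) := by
      rw [Equiv.symm_apply_eq, ← h3, Equiv.apply_symm_apply]
    rw [smul_inv_smul, Equiv.apply_symm_apply] at h
    simp only [h, e, inv_smul_smul]
  · intro i
    rw [h5, Equiv.symm_apply_apply]
  · intro i
    simp only [h5, h6, Equiv.symm_apply_apply, inv_smul_smul]

theorem Iso.trans {K L : Type} {C D F : Curve K L} (h : Iso C D) (h' : Iso D F) : Iso C F := by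
  obtain ⟨f, g, h1, h2, h3, h4, h5, h6⟩ := h
  obtain ⟨f', g', h1', h2', h3', h4', h5', h6'⟩ := h'
  refine ⟨f.trans f', fun v => g' (f v) * g v, ?_, ?_, ?_, ?_, ?_, ?_⟩
  · intro v w
    rw [h1, h1']
    rfl
  · intro v w hvw
    simp only [Equiv.trans_apply]
    rw [h2' _ _ ((h1 v w).1 hvw), h2 v w hvw, mul_smul]
  · intro v
    simp only [Equiv.trans_apply]
    rw [h3', h3]
  · intro v z
    simp only [Equiv.trans_apply]
    rw [mul_smul, h4', h4, h3, mul_smul]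
  · intro i
    rw [h5', h5, Equiv.trans_apply]
  · intro i
    rw [h6', h6, h5, mul_smul]

instance isoSetoid (K L : Type) : Setoid (Curve K L) :=
  ⟨Iso, Iso.refl, Iso.symm, Iso.trans⟩

/-- The moduli space of stable real genus zero curves with real marked points indexed by `K` and
conjugate pairs of marked points indexed by `L`. -/
def Moduli (K L : Type) : Type := Quotient (isoSetoid K L)

/-- The isomorphism class of a marked curve. -/
def Moduli.mk {K L : Type} (T : RealTree) (μ : Marking T K L) : Moduli K L :=
  Quotient.mk (isoSetoid K L) ⟨T, μ⟩

/-! ### The topology and the smooth structure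

The cross-ratios of the marked points embed the moduli space into a product of Riemann spheres
as a compact smooth submanifold (with boundary if `K` is empty).  We compose with the embedding
of the Riemann sphere as the unit sphere in `ℂ × ℝ`, so that the moduli space is identified with
a submanifold of a finite-dimensional real vector space. -/

/-- The position of the marked point `i` as seen from the component `v`: the marked point itself
if it lies on `v`, the node of `v` leading to it otherwise. -/
def Marking.seen {T : RealTree} {K L : Type} (μ : Marking T K L) (v : Fin T.n) (i : Mark K L) :
    P1 :=
  if μ.comp i = v then μ.pos i else T.dir v (μ.comp i)

/-- `c` is the coordinate of the fourth marked point on the component which separates the first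
three of them, in the affine coordinate in which those three are `0`, `1` and `∞`. -/
def Marking.IsCrossRatio {T : RealTree} {K L : Type} (μ : Marking T K L)
    (q : Fin 4 ↪ Mark K L) (c : P1) : Prop :=
  ∃ (v : Fin T.n) (g : GL (Fin 2) ℂ),
    g • μ.seen v (q 0) = ((0 : ℂ) : P1) ∧ g • μ.seen v (q 1) = ((1 : ℂ) : P1) ∧
    g • μ.seen v (q 2) = OnePoint.infty ∧ g • μ.seen v (q 3) = c

/-- The cross-ratio of four distinct marked points, as a function on the moduli space. -/
def Moduli.crossRatio {K L : Type} (m : Moduli K L) (q : Fin 4 ↪ Mark K L) : P1 :=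
  Classical.epsilon fun c =>
    ∃ (T : RealTree) (μ : Marking T K L), Moduli.mk T μ = m ∧ μ.IsCrossRatio q c

/-- The identification of the Riemann sphere with the unit sphere in `ℂ × ℝ`. -/
def sphere : P1 → ℂ × ℝ
  | none => (0, 1)
  | some z => (((2 / (‖z‖ ^ 2 + 1) : ℝ) : ℂ) * z, (‖z‖ ^ 2 - 1) / (‖z‖ ^ 2 + 1))

/-- The ambient vector space. -/
abbrev Ambient (K L : Type) := (Fin 4 ↪ Mark K L) → ℂ × ℝ

/-- The embedding of the moduli space. -/
def emb {K L : Type} (m : Moduli K L) : Ambient K L := fun q => sphere (m.crossRatio q)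

instance (K L : Type) : TopologicalSpace (Moduli K L) :=
  TopologicalSpace.induced emb inferInstance

/-- The tangent space at `p` of a submanifold `A` of the moduli space (possibly with boundary),
as a subspace of the ambient vector space. -/
def tangentSpace {K L : Type} (A : Set (Moduli K L)) (p : Moduli K L) :
    Submodule ℝ (Ambient K L) :=
  Submodule.span ℝ (tangentConeAt ℝ (emb '' A) (emb p))

/-- The set of points of the closure of `A` which do not lie in `A`. -/
def ends {K L : Type} (A : Set (Moduli K L)) : Set (Moduli K L) :=
  {m | emb m ∈ closure (emb '' A) \ emb '' A}

/-! ### Strata -/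

/-- `m` has a representative with exactly `k` nodes. -/
def HasNodes {K L : Type} (m : Moduli K L) (k : ℕ) : Prop :=
  ∃ (T : RealTree) (μ : Marking T K L), Moduli.mk T μ = m ∧ T.n = k + 1

/-- The union of the strata of codimension at least two. -/
def codimTwo (K L : Type) : Set (Moduli K L) := {m | ∃ k, 2 ≤ k ∧ HasNodes m k}

/-- The boundary of the moduli space: curves with no component preserved by the involution. -/
def boundary (K L : Type) : Set (Moduli K L) :=
  {m | ∃ (T : RealTree) (μ : Marking T K L), Moduli.mk T μ = m ∧ ∀ v, T.inv v ≠ v}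

/-- The open codimension one stratum of curves with two real components, one of them carrying
the real points in `A` and the conjugate pairs in `B`, the other one carrying the rest. -/
def stratum {K L : Type} (A : Set K) (B : Set L) : Set (Moduli K L) :=
  {m | ∃ (T : RealTree) (μ : Marking T K L), Moduli.mk T μ = m ∧ T.n = 2 ∧
    (∀ v, T.inv v = v) ∧ ∃ v, (∀ i, μ.comp (Sum.inl i) = v ↔ i ∈ A) ∧
      ∀ j b, μ.comp (Sum.inr (j, b)) = v ↔ j ∈ B}

/-- `A`, `B` describe a codimension one stratum; the first component, carrying `A` and `B`, is the
one with the conjugate pair `o`. -/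
def IsStratumType {K L : Type} (o : L) (A : Set K) (B : Set L) : Prop :=
  o ∈ B ∧ 2 ≤ A.ncard + 2 * B.ncard ∧ 2 ≤ Aᶜ.ncard + 2 * Bᶜ.ncard

/-- The curves on which the real point `i` and `z_o⁺` lie on the same component. -/
def star {K L : Type} (o : L) (i : K) : Set (Moduli K L) :=
  {m | ∃ (T : RealTree) (μ : Marking T K L), Moduli.mk T μ = m ∧
    μ.comp (Sum.inl i) = μ.comp (Sum.inr (o, true))}

/-! ### Forgetful and gluing morphisms -/

/-- The inclusion of the marked points other than the real point `i`. -/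
def Mark.lift {K L : Type} (i : K) : Mark {j : K // j ≠ i} L ↪ Mark K L :=
  Function.Embedding.sumMap (Function.Embedding.subtype _) (Function.Embedding.refl _)

/-- `m'` is the image of `m` under the morphism forgetting the real point `i`: dropping this point
and contracting the components that become unstable does not change the cross-ratios of the
other marked points, which determine the resulting stable curve. -/
def IsForget {K L : Type} (i : K) (m : Moduli K L) (m' : Moduli {j : K // j ≠ i} L) : Prop :=
  ∀ q, m'.crossRatio q = m.crossRatio (q.trans (Mark.lift i))

/-- The curve `(T, μ)` is obtained from `(T₁, μ₁)` and `(T₂, μ₂)` by identifying the real points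
labelled `none` into a node. -/
def IsGluing {K L : Type} {A : Set K} {B : Set L} {T₁ T₂ T : RealTree}
    (μ₁ : Marking T₁ (Option A) B) (μ₂ : Marking T₂ (Option ↥(Aᶜ)) ↥(Bᶜ)) (μ : Marking T K L) :
    Prop :=
  ∃ e : Fin T₁.n ⊕ Fin T₂.n ≃ Fin T.n,
    (∀ v w, T.graph.Adj (e (Sum.inl v)) (e (Sum.inl w)) ↔ T₁.graph.Adj v w) ∧
    (∀ v w, T.graph.Adj (e (Sum.inr v)) (e (Sum.inr w)) ↔ T₂.graph.Adj v w) ∧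
    (∀ v w, T.graph.Adj (e (Sum.inl v)) (e (Sum.inr w)) ↔
      v = μ₁.comp (Sum.inl none) ∧ w = μ₂.comp (Sum.inl none)) ∧
    (∀ v w, T₁.graph.Adj v w → T.dir (e (Sum.inl v)) (e (Sum.inl w)) = T₁.dir v w) ∧
    (∀ v w, T₂.graph.Adj v w → T.dir (e (Sum.inr v)) (e (Sum.inr w)) = T₂.dir v w) ∧
    T.dir (e (Sum.inl (μ₁.comp (Sum.inl none)))) (e (Sum.inr (μ₂.comp (Sum.inl none)))) =
      μ₁.pos (Sum.inl none) ∧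
    T.dir (e (Sum.inr (μ₂.comp (Sum.inl none)))) (e (Sum.inl (μ₁.comp (Sum.inl none)))) =
      μ₂.pos (Sum.inl none) ∧
    (∀ v, T.inv (e (Sum.inl v)) = e (Sum.inl (T₁.inv v))) ∧
    (∀ v, T.inv (e (Sum.inr v)) = e (Sum.inr (T₂.inv v))) ∧
    (∀ v, T.sig (e (Sum.inl v)) = T₁.sig v) ∧
    (∀ v, T.sig (e (Sum.inr v)) = T₂.sig v) ∧
    (∀ i : A, μ.comp (Sum.inl i) = e (Sum.inl (μ₁.comp (Sum.inl (some i)))) ∧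
      μ.pos (Sum.inl i) = μ₁.pos (Sum.inl (some i))) ∧
    (∀ (j : B) (b : Bool), μ.comp (Sum.inr (j, b)) = e (Sum.inl (μ₁.comp (Sum.inr (j, b)))) ∧
      μ.pos (Sum.inr (j, b)) = μ₁.pos (Sum.inr (j, b))) ∧
    (∀ i : ↥(Aᶜ), μ.comp (Sum.inl i) = e (Sum.inr (μ₂.comp (Sum.inl (some i)))) ∧
      μ.pos (Sum.inl i) = μ₂.pos (Sum.inl (some i))) ∧
    (∀ (j : ↥(Bᶜ)) (b : Bool), μ.comp (Sum.inr (j, b)) = e (Sum.inr (μ₂.comp (Sum.inr (j, b)))) ∧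
      μ.pos (Sum.inr (j, b)) = μ₂.pos (Sum.inr (j, b)))

/-- `m` corresponds to `(m₁, m₂)` under the identification of the closed stratum of type `(A, B)`
with a product of two moduli spaces; the label `none` stands for the node. -/
def Glue {K L : Type} (A : Set K) (B : Set L) (m₁ : Moduli (Option A) B)
    (m₂ : Moduli (Option ↥(Aᶜ)) ↥(Bᶜ)) (m : Moduli K L) : Prop :=
  ∃ (T₁ : RealTree) (μ₁ : Marking T₁ (Option A) B)
    (T₂ : RealTree) (μ₂ : Marking T₂ (Option ↥(Aᶜ)) ↥(Bᶜ)) (T : RealTree) (μ : Marking T K L),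
    Moduli.mk T₁ μ₁ = m₁ ∧ Moduli.mk T₂ μ₂ = m₂ ∧ Moduli.mk T μ = m ∧ IsGluing μ₁ μ₂ μ

/-- The target of the morphism on the closed stratum of type `(A, B)` which forgets the node as a
marked point of the first component. -/
abbrev StratumTarget {K L : Type} (A : Set K) (B : Set L) :=
  Moduli {j : Option A // j ≠ none} B × Moduli (Option ↥(Aᶜ)) ↥(Bᶜ)

/-- `y` is the image of `m` under this morphism. -/
def IsForgetNode {K L : Type} (A : Set K) (B : Set L) (m : Moduli K L) (y : StratumTarget A B) :
    Prop :=
  ∃ m₁, Glue A B m₁ y.2 m ∧ IsForget none m₁ y.1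

/-- The union of the strata of codimension at least two in the target. -/
def targetCodimTwo {K L : Type} (A : Set K) (B : Set L) : Set (StratumTarget A B) :=
  {y | ∃ k l, 2 ≤ k + l ∧ HasNodes y.1 k ∧ HasNodes y.2 l}

/-- The boundary of the target. -/
def targetBoundary {K L : Type} (A : Set K) (B : Set L) : Set (StratumTarget A B) :=
  {y | y.1 ∈ boundary _ _ ∨ y.2 ∈ boundary _ _}

/-! ### Regular hypersurfaces

Here `Y` is a bordered hypersurface and `bd` is its boundary. -/

/-- Regularity with respect to the morphism forgetting the real point `i`. -/
def RegularForget {K L : Type} (o : L) (i : K) (Y bd : Set (Moduli K L)) : Prop :=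
  Y \ bd ⊆ star o i ∧
  (∀ u ∈ ends Y, ∃ m', IsForget i u m' ∧ m' ∈ codimTwo _ _) ∧
  ∀ u ∈ bd, ∃ m', IsForget i u m' ∧ m' ∈ boundary _ _ ∪ codimTwo _ _

/-- Regularity with respect to the codimension one stratum of type `(A, B)`.
The last two conditions make no sense, and are not imposed, for the stratum whose first component
carries only the conjugate pair `o`. -/
def RegularStratum {K L : Type} (o : L) (A : Set K) (B : Set L) (Y bd : Set (Moduli K L)) :
    Prop :=
  (∀ u ∈ Y ∩ closure (stratum A B),
    tangentSpace Y u ⊔ tangentSpace (closure (stratum A B)) u = tangentSpace Set.univ u) ∧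
  (∀ u ∈ bd ∩ closure (stratum A B),
    tangentSpace bd u ⊔ tangentSpace (closure (stratum A B)) u = tangentSpace Set.univ u) ∧
  (∃ Y₁ : Set (Moduli (Option A) B), (∀ h : o ∈ B, Y₁ ⊆ star ⟨o, h⟩ none) ∧
    Y ∩ closure (stratum A B) = {m | ∃ m₁ ∈ Y₁, ∃ m₂, Glue A B m₁ m₂ m}) ∧
  (¬ (A = ∅ ∧ B = {o}) →
    (∀ u ∈ ends Y ∩ closure (stratum A B),
      ∃ y, IsForgetNode A B u y ∧ y ∈ targetCodimTwo A B) ∧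
    ∀ u ∈ bd ∩ closure (stratum A B),
      ∃ y, IsForgetNode A B u y ∧ y ∈ targetBoundary A B ∪ targetCodimTwo A B)

/-- Regular hypersurfaces. -/
def Regular {K L : Type} (o : L) (Y bd : Set (Moduli K L)) : Prop :=
  ends Y ⊆ codimTwo K L ∧ (∀ i, RegularForget o i Y bd) ∧
  ∀ A B, IsStratumType o A B → RegularStratum o A B Y bd

/-! ### Co-orientations and degrees -/

/-- A co-orientation of a hypersurface `Y`, that is, an orientation of its normal line bundle,
given by a continuous section of the tangent bundle of the moduli space along `Y` which is nowhere
tangent to `Y`.  Only the sign of this section modulo the tangent bundle of `Y` is used. -/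
structure CoOrientation {K L : Type} (Y : Set (Moduli K L)) where
  normal : Moduli K L → Ambient K L
  continuousOn : ContinuousOn normal Y
  mem_tangent : ∀ p ∈ Y, normal p ∈ tangentSpace Set.univ p
  notMem_tangent : ∀ p ∈ Y, normal p ∉ tangentSpace Y p

/-- Near `θ = 0`, the curve `m θ` is a fixed curve with fixed marked points other than the real
point `i`, which moves as `exp (𝕚 θ)` along the fixed circle of its component, in the coordinate
with `z_o⁺ = 0` and `z_o⁻ = ∞`; that is, it moves in the positive direction of the circle, seen
as the boundary of the unit disk around `z_o⁺`. -/
def IsRotation {K L : Type} (o : L) (i : K) (m : ℝ → Moduli K L) : Prop :=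
  ∃ (T : RealTree) (μ : ℝ → Marking T K L) (v : Fin T.n) (g : GL (Fin 2) ℂ),
    ∀ᶠ θ in nhds (0 : ℝ), m θ = Moduli.mk T (μ θ) ∧
      (μ θ).comp = (μ 0).comp ∧
      (∀ j, j ≠ Sum.inl i → (μ θ).pos j = (μ 0).pos j) ∧
      (μ θ).comp (Sum.inl i) = v ∧ (μ θ).comp (Sum.inr (o, true)) = v ∧
      g • (μ θ).pos (Sum.inr (o, true)) = ((0 : ℂ) : P1) ∧
      g • (μ θ).pos (Sum.inr (o, false)) = OnePoint.infty ∧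
      g • (μ θ).pos (Sum.inl i) = ((Complex.exp (θ * Complex.I) : ℂ) : P1)

section Degrees

variable {K L : Type} [Fintype K] [DecidableEq K] [Fintype L] [DecidableEq L]

/-- `w` is the vertical tangent vector at `u` of the morphism forgetting the real point `i` given
by the positive rotation of this point. -/
def IsVertical (o : L) (i : K) (u : Moduli K L) (w : Ambient K L) : Prop :=
  ∃ m, IsRotation o i m ∧ m 0 = u ∧ HasDerivAt (fun θ => emb (m θ)) w 0

/-- `w` is the vertical tangent vector at `u` of the morphism on the closed stratum of type
`(A, B)` forgetting the node on the first component, given by the positive rotation of this node. -/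
def IsVerticalNode (o : L) (A : Set K) (B : Set L) (u : Moduli K L) (w : Ambient K L) : Prop :=
  ∃ (h : o ∈ B) (m₁ : ℝ → Moduli (Option A) B) (m₂ : Moduli (Option ↥(Aᶜ)) ↥(Bᶜ))
    (m : ℝ → Moduli K L),
    IsRotation ⟨o, h⟩ none m₁ ∧ (∀ᶠ θ in nhds (0 : ℝ), Glue A B (m₁ θ) m₂ (m θ)) ∧ m 0 = u ∧
    HasDerivAt (fun θ => emb (m θ)) w 0

end Degrees

/-- The sign `s = ±1` with which the vector `w` orients the normal line at `u` of the hypersurface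
`Y`, compared with the co-orientation `ν`. -/
def HasSign {K L : Type} {Y : Set (Moduli K L)} (ν : CoOrientation Y) (u : Moduli K L)
    (w : Ambient K L) (s : ℤ) : Prop :=
  ∃ a : ℝ, w - a • ν.normal u ∈ tangentSpace Y u ∧ (0 < a ∧ s = 1 ∨ a < 0 ∧ s = -1)

/-- The degree of the restriction to `Y` (a hypersurface with boundary `bd`) of a morphism with
graph `rel` to a space `Z` with boundary `bdZ`.  The one-dimensional vertical tangent spaces of the
morphism are oriented by the vectors `w` with `vert u w`; a point `u` of `Y` is a regular point of
the restriction if and only if the vertical direction is not tangent to `Y`, and its sign is then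
that of the isomorphism from the vertical line to the normal line of `Y`.  Regular values exist,
and the signed number of preimages of every regular value is `d`. -/
def HasDegree {K L Z : Type} {Y : Set (Moduli K L)} (ν : CoOrientation Y) (bd : Set (Moduli K L))
    (rel : Moduli K L → Z → Prop) (bdZ : Set Z) (vert : Moduli K L → Ambient K L → Prop)
    (d : ℤ) : Prop :=
  let RegularValue : Z → Prop := fun y =>
    y ∉ bdZ ∧ (∀ u ∈ bd ∪ ends Y, ¬ rel u y) ∧
      ∀ u ∈ Y, rel u y → ∀ w, vert u w → w ∉ tangentSpace Y u
  (∃ y, RegularValue y) ∧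
  ∀ y, RegularValue y → {u ∈ Y | rel u y}.Finite ∧
    ∃ s : Moduli K L → ℤ, (∀ u ∈ Y, rel u y → ∃ w, vert u w ∧ HasSign ν u w (s u)) ∧
      ∑ᶠ u ∈ {u ∈ Y | rel u y}, s u = d

section Paths

variable {K L : Type} [Fintype K] [DecidableEq K] [Fintype L] [DecidableEq L]

/-- The degree of `Y` with respect to the morphism forgetting the real point `i`. -/
def HasDegreeForget (o : L) (i : K) {Y : Set (Moduli K L)} (ν : CoOrientation Y)
    (bd : Set (Moduli K L)) (d : ℤ) : Prop :=
  HasDegree ν bd (IsForget i) (boundary _ _) (IsVertical o i) d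

/-- The degree of `Y` with respect to the codimension one stratum of type `(A, B)`. -/
def HasDegreeStratum (o : L) (A : Set K) (B : Set L) {Y : Set (Moduli K L)} (ν : CoOrientation Y)
    (bd : Set (Moduli K L)) (d : ℤ) : Prop :=
  HasDegree ν bd (fun u y => u ∈ closure (stratum A B) ∧ IsForgetNode A B u y)
    (targetBoundary A B) (IsVerticalNode o A B) d

variable (K L) in
/-- A smoothly embedded closed path (compact interval). -/
structure EmbeddedPath where
  path : ℝ → Moduli K L
  smooth : ContDiffOn ℝ ∞ (fun t => emb (path t)) (Set.Icc 0 1)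
  injOn : Set.InjOn (fun t => emb (path t)) (Set.Icc 0 1)
  immersion : ∀ t ∈ Set.Icc (0 : ℝ) 1,
    derivWithin (fun t => emb (path t)) (Set.Icc 0 1) t ≠ 0

/-- The image of the path. -/
def EmbeddedPath.carrier (Y : EmbeddedPath K L) : Set (Moduli K L) := Y.path '' Set.Icc 0 1

/-- The two endpoints. -/
def EmbeddedPath.bd (Y : EmbeddedPath K L) : Set (Moduli K L) := {Y.path 0, Y.path 1}

/-- `n` is the outer normal vector of the path at its endpoint `P`. -/
def EmbeddedPath.IsOuterNormal (Y : EmbeddedPath K L) (P : Moduli K L) (n : Ambient K L) : Prop :=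
  (P = Y.path 0 ∧ n = - derivWithin (fun t => emb (Y.path t)) (Set.Icc 0 1) 0) ∨
  (P = Y.path 1 ∧ n = derivWithin (fun t => emb (Y.path t)) (Set.Icc 0 1) 1)

end Paths

/-! ### The points `P⁺` and `P⁻` of the moduli space of curves with one real point and two pairs -/

/-- The three-component curve on which `z_1⁺` and `z_2⁺` (if `b = true`) or `z_1⁺` and `z_2⁻`
(if `b = false`) lie on the same component. -/
def IsP (b : Bool) (P : Moduli (Fin 1) (Fin 2)) : Prop :=
  ∃ (T : RealTree) (μ : Marking T (Fin 1) (Fin 2)), Moduli.mk T μ = P ∧ T.n = 3 ∧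
    μ.comp (Sum.inr (0, true)) = μ.comp (Sum.inr (1, b))

/-- `m` is the smooth curve with `x_1 = 1`, `z_1⁺ = 0`, `z_1⁻ = ∞`, the point of the second pair
with sign `b` at `ζ`, and the other point of this pair at the reflection of `ζ` in the unit
circle. -/
def IsSmoothing (b : Bool) (ζ : ℂ) (m : Moduli (Fin 1) (Fin 2)) : Prop :=
  ∃ (T : RealTree) (μ : Marking T (Fin 1) (Fin 2)), Moduli.mk T μ = m ∧ T.n = 1 ∧
    μ.pos (Sum.inl 0) = ((1 : ℂ) : P1) ∧
    μ.pos (Sum.inr (0, true)) = ((0 : ℂ) : P1) ∧ μ.pos (Sum.inr (0, false)) = OnePoint.infty ∧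
    μ.pos (Sum.inr (1, b)) = (ζ : P1) ∧
    μ.pos (Sum.inr (1, !b)) = (((starRingEnd ℂ ζ)⁻¹ : ℂ) : P1)

/-- `(d₁, d₂)` is a basis of the tangent space at `P` (one of `P⁺`, `P⁻`, according to `b`),
positive for its complex orientation.  A neighbourhood of `P` consists of the conjugate smoothings
of the two nodes.  In the coordinate `u` with `x_1 = 1` and the nodes at `0` and `∞` on the real
component, and the coordinate `y` with `z_1⁺ = 0`, the node at `∞` and the point of the second pair
at `1` on the component with `z_1⁺`, the smoothing `u = ζ y` with complex parameter `ζ` is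
the curve described by `IsSmoothing b ζ`; the basis is the derivative in the
directions `1` and `𝕚` of this family. -/
def IsComplexFrame (b : Bool) (P : Moduli (Fin 1) (Fin 2))
    (d₁ d₂ : Ambient (Fin 1) (Fin 2)) : Prop :=
  ∃ (δ : ℂ → Moduli (Fin 1) (Fin 2)) (D : ℂ →L[ℝ] Ambient (Fin 1) (Fin 2)),
    δ 0 = P ∧ (∀ᶠ ζ in nhdsWithin (0 : ℂ) {0}ᶜ, IsSmoothing b ζ (δ ζ)) ∧
    HasFDerivAt (fun ζ => emb (δ ζ)) D 0 ∧ LinearIndependent ℝ ![D 1, D Complex.I] ∧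
    d₁ = D 1 ∧ d₂ = D Complex.I

/-- At the endpoint `P` of `Y`, the co-orientation of `P` given by the outer normal of `P` in `Y`
followed by the co-orientation of `Y` is the complex orientation of the tangent space at `P`. -/
def BoundaryAgrees (Y : EmbeddedPath (Fin 1) (Fin 2)) (ν : CoOrientation Y.carrier)
    (b : Bool) (P : Moduli (Fin 1) (Fin 2)) : Prop :=
  ∃ n d₁ d₂, Y.IsOuterNormal P n ∧ IsComplexFrame b P d₁ d₂ ∧
    ∃ a₁ a₂ b₁ b₂ : ℝ, n = a₁ • d₁ + a₂ • d₂ ∧ ν.normal P = b₁ • d₁ + b₂ • d₂ ∧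
      0 < a₁ * b₂ - a₂ * b₁

end RealDM

end

open RealDM

/-!
A stable real curve is determined by its cross-ratios. If `z₁⁺`, `z₁⁻`, `x₁` are moved to `0`, `1`,
`∞`, the involution becomes `z ↦ 1 - conj z`, and the position `w` of `z₂⁺` is a coordinate on the
complement of the closed stratum `S₁`, which lies at `w = ∞`. The points `P⁺` and `P⁻` have
coordinates `0` and `1`, and the curves in the closure of `S₂` have `w = 1 - conj w`. The path is
the segment `0 ≤ w ≤ 1`, co-oriented by `-𝕚`; it meets `S₂` only at `w = 1/2`.

The counterclockwise rotation of `x₁` moves the coordinate with velocity `𝕚 w (w - 1)`, a positive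
multiple of `-𝕚`, and the forgetful morphism is a bijection from the interior of the path to the
interior of its target, so the degree is `1`. The rotation of the node moves the coordinate with
the opposite velocity, so the degree along `S₂` is `-1`. The smoothing with parameter `ζ` has
coordinate `ζ / (ζ - 1)` near `P⁺` and `1 / (1 - conj ζ)` near `P⁻`, so that `(-1, -𝕚)` and
`(1, -𝕚)` are positive bases there, as the outer normals `-1` and `1` require.
-/

noncomputable section

namespace RealDM

/-! ### Homogeneous coordinates on the projective line -/

section Homogeneous

variable {F : Type*} [Field F]

/-- The determinant of two vectors of the plane; it vanishes if and only if they are homogeneous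
coordinates of the same point (or one of them is zero). -/
def det2 (p q : F × F) : F := p.1 * q.2 - p.2 * q.1

/-- The cross-ratio in homogeneous coordinates: the coordinate of `d` when `a`, `b`, `c` are placed
at `0`, `1`, `∞`. -/
def cr (a b c d : F × F) : F × F := (det2 d a * det2 b c, det2 d c * det2 b a)

theorem det2_swap (p q : F × F) : det2 p q = -det2 q p := by simp only [det2]; ring

theorem det2_eq_zero_comm {p q : F × F} : det2 p q = 0 ↔ det2 q p = 0 := by
  rw [det2_swap, neg_eq_zero]

theorem fst_ne_zero_of_snd_eq_zero {a : F} (h : (a, (0 : F)) ≠ 0) : a ≠ 0 :=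
  fun ha => h (Prod.mk_eq_zero.2 ⟨ha, rfl⟩)

variable [DecidableEq F]

/-- The point of the projective line with homogeneous coordinates `p`; the junk value at `p = 0` is
`∞`. -/
def pt (p : F × F) : OnePoint F := if p.2 = 0 then OnePoint.infty else ↑(p.1 / p.2)

theorem pt_coe (z : F) : pt (z, 1) = (z : OnePoint F) := by simp [pt]

theorem pt_zero {a : F} (h : a ≠ 0) : pt (0, a) = ((0 : F) : OnePoint F) := by simp [pt, h]

theorem pt_infty (a : F) : pt (a, 0) = OnePoint.infty := by simp [pt]

theorem pt_self {a : F} (h : a ≠ 0) : pt (a, a) = ((1 : F) : OnePoint F) := by simp [pt, h]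

theorem exists_pt (z : OnePoint F) : ∃ p : F × F, p ≠ 0 ∧ pt p = z := by
  induction z using OnePoint.rec with
  | infty => exact ⟨(1, 0), by simp, pt_infty 1⟩
  | coe z => exact ⟨(z, 1), by simp, pt_coe z⟩

theorem pt_eq_iff {p q : F × F} (hp : p ≠ 0) (hq : q ≠ 0) : pt p = pt q ↔ det2 p q = 0 := by
  obtain ⟨a, b⟩ := p
  obtain ⟨c, d⟩ := q
  rcases eq_or_ne b 0 with rfl | hb <;> rcases eq_or_ne d 0 with rfl | hd
  · simp [pt, det2]
  · simp [pt, det2, hd, fst_ne_zero_of_snd_eq_zero hp]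
  · simp [pt, det2, hb, fst_ne_zero_of_snd_eq_zero hq]
  · simp only [pt, det2, hb, hd, if_false, OnePoint.coe_eq_coe, div_eq_div_iff hb hd]
    rw [sub_eq_zero, mul_comm b c]

theorem pt_smul_eq {p : F × F} {k : F} (hk : k ≠ 0) : pt (k • p) = pt p := by
  by_cases h : p.2 = 0 <;> simp [pt, h, hk, mul_div_mul_left]

theorem smul_pt (g : GL (Fin 2) F) {p : F × F} (hp : p ≠ 0) :
    g • pt p = pt (g 0 0 * p.1 + g 0 1 * p.2, g 1 0 * p.1 + g 1 1 * p.2) := by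
  obtain ⟨a, b⟩ := p
  rcases eq_or_ne b 0 with rfl | hb
  · have ha : a ≠ 0 := fst_ne_zero_of_snd_eq_zero hp
    by_cases h : g 1 0 = 0 <;> simp [pt, OnePoint.smul_infty_eq_ite, h, ha, mul_div_mul_right]
  · have den : g 1 0 * (a / b) + g 1 1 = (g 1 0 * a + g 1 1 * b) / b := by field_simp
    have num : g 0 0 * (a / b) + g 0 1 = (g 0 0 * a + g 0 1 * b) / b := by field_simp
    simp only [pt, hb, if_false, OnePoint.smul_some_eq_ite, den, num, div_eq_zero_iff, or_false,
      div_div_div_cancel_right₀ hb]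

theorem exists_gl_of_det_ne_zero {a b c d : F} (h : a * d - b * c ≠ 0) :
    ∃ g : GL (Fin 2) F, ∀ p : F × F, p ≠ 0 →
      g • pt p = pt (a * p.1 + b * p.2, c * p.1 + d * p.2) := by
  refine ⟨Matrix.GeneralLinearGroup.mkOfDetNeZero !![a, b; c, d]
    (by rwa [Matrix.det_fin_two_of]), fun p hp => ?_⟩
  rw [smul_pt _ hp]
  simp [Matrix.GeneralLinearGroup.mkOfDetNeZero]

theorem exists_gl_cr {a b c : F × F} (hab : det2 b a ≠ 0) (hbc : det2 b c ≠ 0)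
    (hac : det2 a c ≠ 0) :
    ∃ g : GL (Fin 2) F, ∀ d : F × F, d ≠ 0 → g • pt d = pt (cr a b c d) := by
  have hdet : a.2 * det2 b c * (-c.1 * det2 b a) - (-a.1 * det2 b c) * (c.2 * det2 b a) ≠ 0 := by
    have : a.2 * det2 b c * (-c.1 * det2 b a) - (-a.1 * det2 b c) * (c.2 * det2 b a) =
        det2 b c * det2 b a * det2 a c := by simp only [det2]; ring
    rw [this]
    exact mul_ne_zero (mul_ne_zero hbc hab) hac
  obtain ⟨g, hg⟩ := exists_gl_of_det_ne_zero hdet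
  refine ⟨g, fun d hd => ?_⟩
  rw [hg d hd]
  congr 1
  ext <;> simp only [cr, det2] <;> ring

theorem exists_gl_zero_one_infty {a b c : OnePoint F} (hab : a ≠ b) (hac : a ≠ c) (hbc : b ≠ c) :
    ∃ g : GL (Fin 2) F,
      g • a = ((0 : F) : OnePoint F) ∧ g • b = ((1 : F) : OnePoint F) ∧ g • c = OnePoint.infty := by
  obtain ⟨p, hp, rfl⟩ := exists_pt a
  obtain ⟨q, hq, rfl⟩ := exists_pt b
  obtain ⟨r, hr, rfl⟩ := exists_pt c
  rw [Ne, pt_eq_iff (by assumption) (by assumption)] at hab hac hbc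
  have hba : det2 q p ≠ 0 := fun h => hab (det2_eq_zero_comm.1 h)
  obtain ⟨g, hg⟩ := exists_gl_cr hba hbc hac
  refine ⟨g, ?_, ?_, ?_⟩
  · rw [hg p hp, show cr p q r p = (0, det2 p r * det2 q p) by simp [cr, det2, mul_comm]]
    exact pt_zero (mul_ne_zero hac hba)
  · rw [hg q hq, show cr p q r q = (det2 q p * det2 q r, det2 q p * det2 q r) by
      simp [cr, mul_comm]]
    exact pt_self (mul_ne_zero hba hbc)
  · rw [hg r hr, show cr p q r r = (det2 r p * det2 q r, 0) by simp [cr, det2, mul_comm]]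
    exact pt_infty _

theorem smul_eq_self_of_zero_one_infty {g : GL (Fin 2) F}
    (h0 : g • ((0 : F) : OnePoint F) = ((0 : F) : OnePoint F))
    (h1 : g • ((1 : F) : OnePoint F) = ((1 : F) : OnePoint F))
    (hinf : g • (OnePoint.infty : OnePoint F) = OnePoint.infty) (z : OnePoint F) : g • z = z := by
  have hdet := g.det_ne_zero
  rw [Matrix.det_fin_two] at hdet
  rw [OnePoint.smul_infty_eq_self_iff] at hinf
  have h11 : g 1 1 ≠ 0 := fun h => hdet (by rw [h, hinf, mul_zero, mul_zero, sub_zero])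
  rw [OnePoint.smul_some_eq_ite] at h0 h1
  simp only [hinf, mul_zero, zero_add, h11, if_false, OnePoint.coe_eq_coe, div_eq_zero_iff,
    or_false, mul_one] at h0 h1
  rw [h0, add_zero, div_eq_one_iff_eq h11] at h1
  obtain ⟨p, hp, rfl⟩ := exists_pt z
  rw [smul_pt _ hp, hinf, h0, h1, zero_mul, add_zero, zero_mul, zero_add]
  exact pt_smul_eq (p := p) h11

theorem smul_eq_smul_of_three {g h : GL (Fin 2) F} {a b c : OnePoint F} (hab : a ≠ b)
    (hac : a ≠ c) (hbc : b ≠ c) (ha : g • a = h • a) (hb : g • b = h • b) (hc : g • c = h • c)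
    (z : OnePoint F) : g • z = h • z := by
  obtain ⟨k, k0, k1, kinf⟩ := exists_gl_zero_one_infty hab hac hbc
  rw [← eq_inv_smul_iff] at k0 k1 kinf
  have fixes {u v : OnePoint F} (huv : u = k⁻¹ • v) (e : g • u = h • u) :
      (k * (h⁻¹ * g) * k⁻¹) • v = v := by
    subst huv
    rw [mul_smul, mul_smul, mul_smul, e, inv_smul_smul, smul_inv_smul]
  have := smul_eq_self_of_zero_one_infty (fixes k0 ha) (fixes k1 hb) (fixes kinf hc) (k • z)
  rwa [mul_smul, inv_smul_smul, mul_smul, smul_left_cancel_iff, mul_smul, inv_smul_eq_iff] at this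

end Homogeneous

/-! ### Anti-holomorphic automorphisms of the sphere -/

theorem P1.conj_smul (g : GL (Fin 2) ℂ) (z : P1) :
    P1.conj (g • z) = (g.map (starRingEnd ℂ)) • P1.conj z := OnePoint.map_smul _ g z

@[simp] theorem P1.conj_conj (z : P1) : P1.conj (P1.conj z) = z := by
  induction z using OnePoint.rec with
  | infty => rfl
  | coe z => simp [P1.conj]

@[simp] theorem P1.conj_infty : P1.conj OnePoint.infty = OnePoint.infty := rfl

@[simp] theorem P1.conj_coe (z : ℂ) : P1.conj (z : P1) = ((starRingEnd ℂ z : ℂ) : P1) := rfl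

theorem P1.conj_injective : Function.Injective P1.conj :=
  Function.LeftInverse.injective P1.conj_conj

theorem P1.conj_pt (p : ℂ × ℂ) :
    P1.conj (pt p) = pt (starRingEnd ℂ p.1, starRingEnd ℂ p.2) := by
  by_cases h : p.2 = 0 <;> simp [pt, h]

theorem conj_prod_ne_zero {p : ℂ × ℂ} (hp : p ≠ 0) :
    (starRingEnd ℂ p.1, starRingEnd ℂ p.2) ≠ 0 := by
  rwa [Ne, Prod.mk_eq_zero, map_eq_zero, map_eq_zero, ← Prod.mk_eq_zero]

/-- Anti-holomorphic automorphisms of the sphere. -/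
def IsAnti (s : P1 → P1) : Prop := ∃ g : GL (Fin 2) ℂ, ∀ z, s z = g • P1.conj z

theorem IsAnti.smul {s : P1 → P1} (h : IsAnti s) (g k : GL (Fin 2) ℂ) :
    IsAnti fun z => g • s (k • z) := by
  obtain ⟨a, ha⟩ := h
  exact ⟨g * a * k.map (starRingEnd ℂ), fun z => by simp only [ha, P1.conj_smul, mul_smul]⟩

theorem IsAnti.eq_of_three {s t : P1 → P1} (hs : IsAnti s) (ht : IsAnti t) {a b c : P1}
    (hab : a ≠ b) (hac : a ≠ c) (hbc : b ≠ c) (ha : s a = t a) (hb : s b = t b) (hc : s c = t c)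
    (z : P1) : s z = t z := by
  obtain ⟨g, hg⟩ := hs
  obtain ⟨h, hh⟩ := ht
  rw [hg, hh] at *
  exact smul_eq_smul_of_three (P1.conj_injective.ne hab) (P1.conj_injective.ne hac)
    (P1.conj_injective.ne hbc) ha hb hc _

theorem exists_anti_div {a : ℂ} (ha : a ≠ 0) :
    ∃ g : GL (Fin 2) ℂ, ∀ p : ℂ × ℂ, p ≠ 0 →
      g • P1.conj (pt p) = pt (a * starRingEnd ℂ p.2, starRingEnd ℂ p.1) := by
  obtain ⟨g, hg⟩ := exists_gl_of_det_ne_zero (a := 0) (b := a) (c := 1) (d := 0) (by simpa)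
  refine ⟨g, fun p hp => ?_⟩
  rw [P1.conj_pt, hg _ (conj_prod_ne_zero hp)]
  simp only [zero_mul, zero_add, one_mul, add_zero]

theorem exists_anti_one_sub :
    ∃ g : GL (Fin 2) ℂ, g • P1.conj OnePoint.infty = OnePoint.infty ∧
      ∀ z : ℂ, g • P1.conj z = ((1 - starRingEnd ℂ z : ℂ) : P1) := by
  obtain ⟨g, hg⟩ := exists_gl_of_det_ne_zero (F := ℂ) (a := -1) (b := 1) (c := 0) (d := 1) (by simp)
  refine ⟨g, ?_, fun z => ?_⟩
  · simpa [pt] using hg (1, 0) (by simp)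
  · rw [P1.conj_coe, ← pt_coe, hg _ (by simp), ← pt_coe]
    congr 2 <;> ring

/-! ### The round sphere in homogeneous coordinates -/

/-- The point of the unit sphere of `ℂ × ℝ` with homogeneous coordinates `p`: the embedding
`sphere` of the Riemann sphere, written without denominators that vanish at `∞`. -/
def roundSphere (p : ℂ × ℂ) : ℂ × ℝ :=
  (((2 / (Complex.normSq p.1 + Complex.normSq p.2) : ℝ) : ℂ) * (p.1 * starRingEnd ℂ p.2),
    (Complex.normSq p.1 - Complex.normSq p.2) / (Complex.normSq p.1 + Complex.normSq p.2))

theorem sphere_infty : sphere OnePoint.infty = (0, 1) := rfl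

theorem sphere_coe (z : ℂ) : sphere (z : P1) =
    (((2 / (‖z‖ ^ 2 + 1) : ℝ) : ℂ) * z, (‖z‖ ^ 2 - 1) / (‖z‖ ^ 2 + 1)) := rfl

theorem normSq_add_normSq_ne_zero {p : ℂ × ℂ} (hp : p ≠ 0) :
    Complex.normSq p.1 + Complex.normSq p.2 ≠ 0 := fun h => hp <| by
  obtain ⟨h1, h2⟩ :=
    (add_eq_zero_iff_of_nonneg (Complex.normSq_nonneg p.1) (Complex.normSq_nonneg p.2)).1 h
  exact Prod.ext (Complex.normSq_eq_zero.1 h1) (Complex.normSq_eq_zero.1 h2)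

theorem sphere_pt {p : ℂ × ℂ} (hp : p ≠ 0) : sphere (pt p) = roundSphere p := by
  have hs := normSq_add_normSq_ne_zero hp
  obtain ⟨a, b⟩ := p
  rcases eq_or_ne b 0 with rfl | hb
  · have : Complex.normSq a ≠ 0 := by simpa using hs
    simp [pt_infty, sphere_infty, roundSphere, this]
  · have hb' : Complex.normSq b ≠ 0 := by simpa using hb
    simp only [pt, hb, if_false, sphere_coe, roundSphere, ← Complex.normSq_eq_norm_sq,
      Complex.normSq_div]
    ext1
    · have e : a / b = a * starRingEnd ℂ b / (Complex.normSq b : ℝ) := by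
        rw [Complex.normSq_eq_conj_mul_self, mul_comm (starRingEnd ℂ b), mul_div_mul_right]
        simpa using hb
      have hs' : (Complex.normSq a + Complex.normSq b : ℂ) ≠ 0 := by exact_mod_cast hs
      have hb'' : (Complex.normSq b : ℂ) ≠ 0 := by exact_mod_cast hb'
      simp only [e]
      push_cast
      field_simp
    · simp only
      field_simp

theorem sphere_snd_eq_one_iff (z : P1) : (sphere z).2 = 1 ↔ z = OnePoint.infty := by
  induction z using OnePoint.rec with
  | infty => simp [sphere_infty]
  | coe z =>
    have : ‖z‖ ^ 2 + 1 ≠ 0 := by positivity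
    simp only [sphere_coe, OnePoint.coe_ne_infty, iff_false, div_eq_one_iff_eq this]
    intro h
    linarith

theorem stereographic_sphere (z : ℂ) :
    (sphere (z : P1)).1 / ((1 - (sphere (z : P1)).2 : ℝ) : ℂ) = z := by
  have h : ‖z‖ ^ 2 + 1 ≠ 0 := by positivity
  have h' : ((‖z‖ : ℂ) ^ 2 + 1) ≠ 0 := by exact_mod_cast h
  have e : (1 - (‖z‖ ^ 2 - 1) / (‖z‖ ^ 2 + 1) : ℝ) = 2 / (‖z‖ ^ 2 + 1) := by
    field_simp
    ring
  rw [sphere_coe]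
  simp only [e]
  push_cast
  field_simp

theorem sphere_injective : Function.Injective sphere := by
  intro z w h
  by_cases hz : z = OnePoint.infty
  · rw [hz] at h ⊢
    rw [eq_comm, ← sphere_snd_eq_one_iff, ← h, sphere_infty]
  · have hw : w ≠ OnePoint.infty := by
      rwa [Ne, ← sphere_snd_eq_one_iff, ← h, sphere_snd_eq_one_iff]
    obtain ⟨z, rfl⟩ := OnePoint.ne_infty_iff_exists.1 hz
    obtain ⟨w, rfl⟩ := OnePoint.ne_infty_iff_exists.1 hw
    rw [← stereographic_sphere z, h, stereographic_sphere]

theorem contDiffOn_roundSphere : ContDiffOn ℝ ∞ roundSphere {0}ᶜ := by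
  have hn : ContDiff ℝ ∞ Complex.normSq :=
    (funext Complex.normSq_eq_norm_sq : (Complex.normSq : ℂ → ℝ) = fun z => ‖z‖ ^ 2) ▸
      contDiff_norm_sq ℝ
  have h1 : ContDiff ℝ ∞ fun p : ℂ × ℂ => Complex.normSq p.1 := hn.comp contDiff_fst
  have h2 : ContDiff ℝ ∞ fun p : ℂ × ℂ => Complex.normSq p.2 := hn.comp contDiff_snd
  have hne (p : ℂ × ℂ) (hp : p ∈ ({0}ᶜ : Set (ℂ × ℂ))) :
      Complex.normSq p.1 + Complex.normSq p.2 ≠ 0 := normSq_add_normSq_ne_zero hp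
  refine ContDiffOn.prodMk (ContDiffOn.mul ?_ ?_) ?_
  · exact Complex.ofRealCLM.contDiff.comp_contDiffOn
      (contDiffOn_const.div (h1.add h2).contDiffOn hne)
  · exact (contDiff_fst.mul (Complex.conjCLE.contDiff.comp contDiff_snd)).contDiffOn
  · exact (h1.sub h2).contDiffOn.div (h1.add h2).contDiffOn hne

/-! ### Branches of a tree of spheres -/

theorem exists_last_exit {α : Type*} {r : α → α → Prop} {v u : α}
    (h : Relation.ReflTransGen r v u) (hu : u ≠ v) :
    ∃ w, r v w ∧ Relation.ReflTransGen (fun a b => r a b ∧ a ≠ v ∧ b ≠ v) w u := by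
  induction h with
  | refl => exact absurd rfl hu
  | @tail b c _ hbc ih =>
    rcases eq_or_ne b v with rfl | hb
    · exact ⟨c, hbc, .refl⟩
    · obtain ⟨w, hw, hwb⟩ := ih hb
      exact ⟨w, hw, hwb.tail ⟨hbc, hb, hu⟩⟩

namespace RealTree

variable {T T' : RealTree}

variable (T) in
/-- `u` and `w` are joined by a walk which avoids `v`. -/
def Avoid (v u w : Fin T.n) : Prop :=
  Relation.ReflTransGen (fun a b => T.graph.Adj a b ∧ a ≠ v ∧ b ≠ v) u w

variable (T) in
theorem reflTransGen_adj (v u : Fin T.n) : Relation.ReflTransGen T.graph.Adj v u :=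
  (SimpleGraph.reachable_iff_reflTransGen _ _).1 (T.isTree.1.preconnected v u)

theorem inv_injective : Function.Injective T.inv :=
  Function.LeftInverse.injective T.inv_inv

theorem sig_injective (v : Fin T.n) : Function.Injective (T.sig v) :=
  Function.LeftInverse.injective (T.sig_sig v)

theorem isAnti_sig (v : Fin T.n) : IsAnti (T.sig v) :=
  T.sig_antiholomorphic v

namespace Avoid

theorem map {f : Fin T.n → Fin T'.n} (hf : Function.Injective f)
    (hadj : ∀ a b, T.graph.Adj a b → T'.graph.Adj (f a) (f b)) {v u w : Fin T.n}
    (h : T.Avoid v u w) : T'.Avoid (f v) (f u) (f w) :=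
  Relation.ReflTransGen.lift f (fun a b hab => ⟨hadj a b hab.1, hf.ne hab.2.1, hf.ne hab.2.2⟩) _ _ h

theorem dir_eq {v u w : Fin T.n} (h : T.Avoid v u w) : T.dir v u = T.dir v w := by
  induction h with
  | refl => rfl
  | tail _ h ih => exact ih.trans (T.dir_branch _ _ _ h.1 h.2.1 h.2.2)

theorem of_dir_ne {v v' w u : Fin T.n} (h : T.Avoid v w u) (hd : T.dir v w ≠ T.dir v v') :
    T.Avoid v' w u := by
  induction h with
  | refl => exact .refl
  | @tail b c hb hbc ih =>
    have hb' : T.dir v w = T.dir v b := dir_eq hb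
    have hc' : T.dir v w = T.dir v c := dir_eq (hb.tail hbc)
    exact ih.tail ⟨hbc.1, fun e => hd (e ▸ hb'), fun e => hd (e ▸ hc')⟩

end Avoid

theorem exists_adj_avoid {v u : Fin T.n} (h : u ≠ v) : ∃ w, T.graph.Adj v w ∧ T.Avoid v w u :=
  exists_last_exit (T.reflTransGen_adj v u) h

theorem exists_adj_dir {v u : Fin T.n} (h : u ≠ v) :
    ∃ w, T.graph.Adj v w ∧ T.dir v u = T.dir v w := by
  obtain ⟨w, hw, ha⟩ := exists_adj_avoid h
  exact ⟨w, hw, ha.dir_eq.symm⟩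

theorem avoid_of_dir_eq {v w u : Fin T.n} (hw : T.graph.Adj v w) (hu : u ≠ v)
    (h : T.dir v u = T.dir v w) : T.Avoid v w u := by
  obtain ⟨w', hw', ha⟩ := exists_adj_avoid hu
  rwa [T.dir_inj v w w' hw hw' (h.symm.trans ha.dir_eq.symm)]

theorem dir_ne_of_adj {v u w : Fin T.n} (hu : T.graph.Adj v u) (hw : T.graph.Adj v w)
    (h : u ≠ w) : T.dir v u ≠ T.dir v w := fun e => h (T.dir_inj _ _ _ hu hw e)

theorem dir_of_dir_ne {v v' u : Fin T.n} (hv : v ≠ v') (hu : u ≠ v) (h : T.dir v u ≠ T.dir v v') :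
    u ≠ v' ∧ T.dir v' u = T.dir v' v := by
  refine ⟨fun e => h (e ▸ rfl), ?_⟩
  obtain ⟨w, hw, ha⟩ := exists_adj_avoid hu
  have hwv' : T.dir v w ≠ T.dir v v' := ha.dir_eq ▸ h
  exact (ha.of_dir_ne hwv').dir_eq.symm.trans
    (T.dir_branch _ _ _ hw hv fun e => hwv' (e ▸ rfl)).symm

theorem dir_ne_of_dir_eq {v w u : Fin T.n} (hw : T.graph.Adj v w) (hv : u ≠ v) (hu : u ≠ w)
    (h : T.dir v u = T.dir v w) : T.dir w u ≠ T.dir w v := by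
  obtain ⟨a, ⟨hwa, -, hav⟩, ha⟩ := exists_last_exit (avoid_of_dir_eq hw hv h) hu
  have ha' : T.Avoid w a u := Relation.ReflTransGen.mono (fun _ _ h => ⟨h.1.1, h.2⟩) _ _ ha
  exact fun e => hav (T.dir_inj w a v hwa hw.symm (ha'.dir_eq.trans e))

theorem sig_dir_of_ne {v u : Fin T.n} (h : u ≠ v) :
    T.sig v (T.dir v u) = T.dir (T.inv v) (T.inv u) := by
  obtain ⟨w, hw, ha⟩ := exists_adj_avoid h
  rw [← (ha.map inv_injective T.inv_adj).dir_eq, ← ha.dir_eq, T.sig_dir _ _ hw]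

/-- The components beyond the node of `v` leading to `w`. -/
def branch (v w : Fin T.n) : Set (Fin T.n) := {u | u ≠ v ∧ T.dir v u = T.dir v w}

theorem branch_ncard_lt {v w u : Fin T.n} (hw : T.graph.Adj v w) (hu : T.graph.Adj w u)
    (huv : u ≠ v) : (branch w u).ncard < (branch v w).ncard := by
  refine Set.ncard_lt_ncard ⟨?_, fun h => ?_⟩ (Set.toFinite _)
  · rintro x ⟨hx, hd⟩
    exact dir_of_dir_ne hw.ne' hx (hd ▸ dir_ne_of_adj hu hw.symm huv)
  · exact (h (show w ∈ branch v w from ⟨hw.ne', rfl⟩)).1 rfl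

end RealTree

namespace Marking

open RealTree

variable {T : RealTree} {K L : Type} (μ : Marking T K L)

theorem seen_of_comp_eq {v : Fin T.n} {i : Mark K L} (h : μ.comp i = v) : μ.seen v i = μ.pos i :=
  if_pos h

theorem seen_of_comp_ne {v : Fin T.n} {i : Mark K L} (h : μ.comp i ≠ v) :
    μ.seen v i = T.dir v (μ.comp i) := if_neg h

theorem seen_conj (v : Fin T.n) (i : Mark K L) :
    μ.seen (T.inv v) (Mark.conj i) = T.sig v (μ.seen v i) := by
  by_cases h : μ.comp i = v
  · rw [μ.seen_of_comp_eq h, μ.seen_of_comp_eq (by rw [μ.comp_conj, h]), μ.pos_conj, h]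
  · have : μ.comp (Mark.conj i) ≠ T.inv v := by
      rw [μ.comp_conj]
      exact inv_injective.ne h
    rw [μ.seen_of_comp_ne h, μ.seen_of_comp_ne this, sig_dir_of_ne h, μ.comp_conj]

theorem seen_conj_of_inv_eq {v : Fin T.n} (hv : T.inv v = v) (i : Mark K L) :
    μ.seen v (Mark.conj i) = T.sig v (μ.seen v i) := by
  have h := μ.seen_conj v i
  rwa [hv] at h

theorem seen_of_seen_ne {v v' : Fin T.n} {i : Mark K L} (hv : v ≠ v')
    (h : μ.seen v i ≠ T.dir v v') : μ.seen v' i = T.dir v' v := by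
  by_cases hc : μ.comp i = v
  · rw [μ.seen_of_comp_ne (hc ▸ hv), hc]
  · rw [μ.seen_of_comp_ne hc] at h
    obtain ⟨hne, hdir⟩ := dir_of_dir_ne hv hc h
    rw [μ.seen_of_comp_ne hne, hdir]

theorem comp_ne_of_seen_eq_dir {v w : Fin T.n} {i : Mark K L} (hw : T.graph.Adj v w)
    (h : μ.seen v i = T.dir v w) : μ.comp i ≠ v := by
  rintro rfl
  rw [μ.seen_of_comp_eq rfl] at h
  exact μ.pos_ne_node i w hw h

theorem seen_ne_of_seen_eq {v w : Fin T.n} {i : Mark K L} (hw : T.graph.Adj v w)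
    (h : μ.seen v i = T.dir v w) : μ.seen w i ≠ T.dir w v := by
  intro e
  have hv := μ.comp_ne_of_seen_eq_dir hw h
  have hw' := μ.comp_ne_of_seen_eq_dir hw.symm e
  rw [μ.seen_of_comp_ne hv] at h
  rw [μ.seen_of_comp_ne hw'] at e
  exact dir_ne_of_dir_eq hw hv hw' h e

theorem exists_adj_of_comp_ne {v : Fin T.n} {i : Mark K L} (h : μ.comp i ≠ v) :
    ∃ w, T.graph.Adj v w ∧ μ.seen v i = T.dir v w := by
  rw [μ.seen_of_comp_ne h]
  exact exists_adj_dir h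

theorem exists_adj_of_seen_eq {v : Fin T.n} {i j : Mark K L} (hij : i ≠ j)
    (h : μ.seen v i = μ.seen v j) : ∃ w, T.graph.Adj v w ∧ μ.seen v i = T.dir v w := by
  by_cases hi : μ.comp i = v
  · by_cases hj : μ.comp j = v
    · rw [μ.seen_of_comp_eq hi, μ.seen_of_comp_eq hj] at h
      exact absurd (μ.pos_inj i j (hi.trans hj.symm) h) hij
    · rw [h]
      exact μ.exists_adj_of_comp_ne hj
  · exact μ.exists_adj_of_comp_ne hi

theorem seen_ne_of_comp_eq {v : Fin T.n} {i j : Mark K L} (h : μ.comp i = v) (hij : i ≠ j) :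
    μ.seen v i ≠ μ.seen v j := by
  intro e
  obtain ⟨w, hw, hiw⟩ := μ.exists_adj_of_seen_eq hij e
  exact μ.comp_ne_of_seen_eq_dir hw hiw h

/-- The nodes and the marked points of the component `v`. -/
def special (v : Fin T.n) : Set P1 :=
  {z | ∃ w, T.graph.Adj v w ∧ T.dir v w = z} ∪ {z | ∃ i, μ.comp i = v ∧ μ.pos i = z}

theorem exists_three_special (v : Fin T.n) :
    ∃ a ∈ μ.special v, ∃ b ∈ μ.special v, ∃ c ∈ μ.special v, a ≠ b ∧ a ≠ c ∧ b ≠ c := by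
  have h : 2 < (μ.special v).ncard := μ.stable v
  exact (Set.two_lt_ncard (Set.finite_of_ncard_pos (by lia))).1 h

theorem exists_two_special_ne (v : Fin T.n) (z : P1) :
    ∃ a ∈ μ.special v, ∃ b ∈ μ.special v, a ≠ z ∧ b ≠ z ∧ a ≠ b := by
  obtain ⟨a, ha, b, hb, c, hc, hab, hac, hbc⟩ := μ.exists_three_special v
  grind

theorem exists_two_marks {v w : Fin T.n} (hw : T.graph.Adj v w) :
    ∃ i j, i ≠ j ∧ μ.seen v i = T.dir v w ∧ μ.seen v j = T.dir v w := by
  induction hN : (branch v w).ncard using Nat.strong_induction_on generalizing v w with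
  | _ N ih =>
  subst hN
  by_cases hu : ∃ u, T.graph.Adj w u ∧ u ≠ v
  · obtain ⟨u, hu, huv⟩ := hu
    obtain ⟨i, j, hij, hi, hj⟩ := ih _ (branch_ncard_lt hw hu huv) hu rfl
    have hd := dir_ne_of_adj hu hw.symm huv
    exact ⟨i, j, hij, μ.seen_of_seen_ne hw.ne' (hi ▸ hd), μ.seen_of_seen_ne hw.ne' (hj ▸ hd)⟩
  · push Not at hu
    have mark : ∀ z ∈ μ.special w, z ≠ T.dir w v → ∃ i, μ.comp i = w ∧ μ.pos i = z := by
      rintro z (⟨u, hu', rfl⟩ | h) hne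
      · exact absurd (by rw [hu u hu']) hne
      · exact h
    obtain ⟨a, ha, b, hb, hav, hbv, hab⟩ := μ.exists_two_special_ne w (T.dir w v)
    obtain ⟨i, hi, rfl⟩ := mark a ha hav
    obtain ⟨j, hj, rfl⟩ := mark b hb hbv
    refine ⟨i, j, ne_of_apply_ne μ.pos hab, ?_, ?_⟩
    · rw [μ.seen_of_comp_ne (hi ▸ hw.ne'), hi]
    · rw [μ.seen_of_comp_ne (hj ▸ hw.ne'), hj]

theorem comp_eq_of_seen_ne {v : Fin T.n} {i : Mark K L}
    (h : ∀ j, j ≠ i → μ.seen v j ≠ μ.seen v i) : μ.comp i = v := by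
  by_contra hc
  obtain ⟨w, hw, hi⟩ := μ.exists_adj_of_comp_ne hc
  obtain ⟨j, k, hjk, hj, hk⟩ := μ.exists_two_marks hw
  by_cases e : j = i
  · exact h k (fun e' => hjk (e.trans e'.symm)) (hk.trans hi.symm)
  · exact h j e (hj.trans hi.symm)

/-- The component `v` separates the marked points `i`, `j`, `k`; there is exactly one such
component. -/
def Separates (v : Fin T.n) (i j k : Mark K L) : Prop :=
  μ.seen v i ≠ μ.seen v j ∧ μ.seen v i ≠ μ.seen v k ∧ μ.seen v j ≠ μ.seen v k

theorem exists_separates_of_branch {i j k : Mark K L} (hjk : j ≠ k) {v w : Fin T.n}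
    (hw : T.graph.Adj v w) (hi : μ.seen v i ≠ T.dir v w) (hj : μ.seen v j = T.dir v w)
    (hk : μ.seen v k = T.dir v w) : ∃ v, μ.Separates v i j k := by
  induction hN : (branch v w).ncard using Nat.strong_induction_on generalizing v w with
  | _ N ih =>
  subst hN
  have hi' := μ.seen_of_seen_ne hw.ne hi
  have hj' := μ.seen_ne_of_seen_eq hw hj
  have hk' := μ.seen_ne_of_seen_eq hw hk
  by_cases e : μ.seen w j = μ.seen w k
  · obtain ⟨u, hu, hju⟩ := μ.exists_adj_of_seen_eq hjk e
    have huv : u ≠ v := by rintro rfl; exact hj' hju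
    refine ih _ (branch_ncard_lt hw hu huv) hu ?_ hju (e ▸ hju) rfl
    rw [hi']
    exact dir_ne_of_adj hw.symm hu huv.symm
  · exact ⟨w, hi' ▸ hj'.symm, hi' ▸ hk'.symm, e⟩

theorem exists_separates {i j k : Mark K L} (hij : i ≠ j) (hik : i ≠ k) (hjk : j ≠ k) :
    ∃ v, μ.Separates v i j k := by
  have hi : ∀ a, i ≠ a → μ.seen (μ.comp i) i ≠ μ.seen (μ.comp i) a := fun a ha =>
    μ.seen_ne_of_comp_eq rfl ha
  by_cases e : μ.seen (μ.comp i) j = μ.seen (μ.comp i) k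
  · obtain ⟨w, hw, hjw⟩ := μ.exists_adj_of_seen_eq hjk e
    exact μ.exists_separates_of_branch hjk hw (hjw ▸ hi j hij) hjw (e ▸ hjw)
  · exact ⟨_, hi j hij, hi k hik, e⟩

variable {μ}

theorem seen_eq_dir_or {v v' : Fin T.n} (hv : v ≠ v') (i : Mark K L) :
    μ.seen v i = T.dir v v' ∨ μ.seen v' i = T.dir v' v :=
  or_iff_not_imp_left.2 (μ.seen_of_seen_ne hv)

namespace Separates

theorem unique {v v' : Fin T.n} {i j k : Mark K L} (h : μ.Separates v i j k)
    (h' : μ.Separates v' i j k) : v = v' := by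
  by_contra hv
  have := seen_eq_dir_or (μ := μ) hv i
  have := seen_eq_dir_or (μ := μ) hv j
  have := seen_eq_dir_or (μ := μ) hv k
  grind [Separates]

theorem conj {v : Fin T.n} {i j k : Mark K L} (h : μ.Separates v i j k) :
    μ.Separates (T.inv v) (Mark.conj i) (Mark.conj j) (Mark.conj k) := by
  simp only [Separates, seen_conj]
  exact ⟨(sig_injective v).ne h.1, (sig_injective v).ne h.2.1, (sig_injective v).ne h.2.2⟩

theorem seen_eq_seen {v v' : Fin T.n} {q : Fin 4 → Mark K L} (hv : v ≠ v')
    (h : μ.Separates v' (q 0) (q 1) (q 2))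
    (h3 : ∀ i j k : Fin 4, i ≠ j → i ≠ k → j ≠ k → μ.seen v (q i) = μ.seen v (q j) →
      μ.seen v (q i) ≠ μ.seen v (q k)) :
    (μ.seen v (q 0) = μ.seen v (q 1) ∧ μ.seen v' (q 3) = μ.seen v' (q 2)) ∨
    (μ.seen v (q 0) = μ.seen v (q 2) ∧ μ.seen v' (q 3) = μ.seen v' (q 1)) ∨
    (μ.seen v (q 1) = μ.seen v (q 2) ∧ μ.seen v' (q 3) = μ.seen v' (q 0)) := by
  have hdir := fun k => seen_eq_dir_or (μ := μ) hv (q k)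
  have := h3 0 1 2 (by decide) (by decide) (by decide)
  have := h3 0 1 3 (by decide) (by decide) (by decide)
  have := h3 0 2 3 (by decide) (by decide) (by decide)
  have := h3 1 2 3 (by decide) (by decide) (by decide)
  have := hdir 0
  have := hdir 1
  have := hdir 2
  have := hdir 3
  grind [Separates]

theorem of_smul {v : Fin T.n} {i j k : Mark K L} {g : GL (Fin 2) ℂ}
    (h0 : g • μ.seen v i = ((0 : ℂ) : P1)) (h1 : g • μ.seen v j = ((1 : ℂ) : P1))
    (h2 : g • μ.seen v k = OnePoint.infty) : μ.Separates v i j k := by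
  refine ⟨?_, ?_, ?_⟩ <;> refine ne_of_apply_ne (g • ·) ?_ <;> simp [h0, h1, h2]

theorem exists_smul {v : Fin T.n} {i j k : Mark K L} (h : μ.Separates v i j k) :
    ∃ g : GL (Fin 2) ℂ, g • μ.seen v i = ((0 : ℂ) : P1) ∧ g • μ.seen v j = ((1 : ℂ) : P1) ∧
      g • μ.seen v k = OnePoint.infty := exists_gl_zero_one_infty h.1 h.2.1 h.2.2

end Separates

end Marking

/-! ### Isomorphisms and cross-ratios -/

section Iso

variable {K L : Type} {C D : Curve K L}

theorem dir_eq_smul_of_adj {f : Fin C.1.n ≃ Fin D.1.n} {g : Fin C.1.n → GL (Fin 2) ℂ}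
    (hadj : ∀ v w, C.1.graph.Adj v w ↔ D.1.graph.Adj (f v) (f w))
    (hdir : ∀ v w, C.1.graph.Adj v w → D.1.dir (f v) (f w) = g v • C.1.dir v w)
    {v u : Fin C.1.n} (h : u ≠ v) : D.1.dir (f v) (f u) = g v • C.1.dir v u := by
  obtain ⟨w, hw, ha⟩ := RealTree.exists_adj_avoid h
  rw [← (ha.map f.injective fun a b => (hadj a b).1).dir_eq, ← ha.dir_eq, hdir _ _ hw]

theorem Iso.exists_seen_eq_smul (h : Iso C D) :
    ∃ (f : Fin C.1.n ≃ Fin D.1.n) (g : Fin C.1.n → GL (Fin 2) ℂ),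
      ∀ v i, D.2.seen (f v) i = g v • C.2.seen v i := by
  obtain ⟨f, g, hadj, hdir, -, -, hcomp, hpos⟩ := h
  refine ⟨f, g, fun v i => ?_⟩
  by_cases hc : C.2.comp i = v
  · rw [C.2.seen_of_comp_eq hc, D.2.seen_of_comp_eq (by rw [hcomp, hc]), hpos, hc]
  · rw [C.2.seen_of_comp_ne hc, D.2.seen_of_comp_ne (by rw [hcomp]; exact f.injective.ne hc),
      hcomp, dir_eq_smul_of_adj hadj hdir hc]

theorem Iso.isCrossRatio (h : Iso C D) {q : Fin 4 ↪ Mark K L} {c : P1}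
    (hc : C.2.IsCrossRatio q c) : D.2.IsCrossRatio q c := by
  obtain ⟨f, g, hs⟩ := h.exists_seen_eq_smul
  obtain ⟨v, k, h0, h1, h2, h3⟩ := hc
  refine ⟨f v, k * (g v)⁻¹, ?_⟩
  simp only [hs, mul_smul, inv_smul_smul]
  exact ⟨h0, h1, h2, h3⟩

/-- The involutions agree because they are determined by their values at the special points. -/
theorem iso_of_marked (f : Fin C.1.n ≃ Fin D.1.n) (g : Fin C.1.n → GL (Fin 2) ℂ)
    (hadj : ∀ v w, C.1.graph.Adj v w ↔ D.1.graph.Adj (f v) (f w))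
    (hdir : ∀ v w, C.1.graph.Adj v w → D.1.dir (f v) (f w) = g v • C.1.dir v w)
    (hinv : ∀ v, D.1.inv (f v) = f (C.1.inv v))
    (hcomp : ∀ i, D.2.comp i = f (C.2.comp i))
    (hpos : ∀ i, D.2.pos i = g (C.2.comp i) • C.2.pos i) : Iso C D := by
  refine ⟨f, g, hadj, hdir, hinv, fun v => ?_, hcomp, hpos⟩
  have sig_special : ∀ z ∈ C.2.special v,
      D.1.sig (f v) (g v • z) = g (C.1.inv v) • C.1.sig v z := by
    rintro z (⟨w, hw, rfl⟩ | ⟨i, rfl, rfl⟩)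
    · rw [← hdir v w hw, D.1.sig_dir _ _ ((hadj _ _).1 hw), hinv, hinv, C.1.sig_dir _ _ hw,
        hdir _ _ (C.1.inv_adj _ _ hw)]
    · rw [← hpos, ← hcomp, ← D.2.pos_conj, ← C.2.pos_conj, hpos, C.2.comp_conj]
  obtain ⟨a, ha, b, hb, c, hc, hab, hac, hbc⟩ := C.2.exists_three_special v
  have antiD := (D.1.isAnti_sig (f v)).smul 1 (g v)
  have antiC := (C.1.isAnti_sig v).smul (g (C.1.inv v)) 1
  simp only [one_smul] at antiD antiC
  exact antiD.eq_of_three antiC hab hac hbc (sig_special a ha) (sig_special b hb) (sig_special c hc)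

end Iso

/-- No three of the points with homogeneous coordinates `p i` coincide. -/
def NoTripleCoincidence {F ι : Type*} [Field F] (p : ι → F × F) : Prop :=
  ∀ i j k, i ≠ j → i ≠ k → j ≠ k → det2 (p i) (p j) = 0 → det2 (p i) (p k) ≠ 0

theorem NoTripleCoincidence.comp {F ι κ : Type*} [Field F] {p : ι → F × F}
    (h : NoTripleCoincidence p) {q : κ → ι} (hq : Function.Injective q) :
    NoTripleCoincidence fun k => p (q k) :=
  fun _ _ _ hij hik hjk => h _ _ _ (hq.ne hij) (hq.ne hik) (hq.ne hjk)

theorem NoTripleCoincidence.cr_ne_zero {F : Type*} [Field F] {p : Fin 4 → F × F}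
    (h : NoTripleCoincidence p) : cr (p 0) (p 1) (p 2) (p 3) ≠ 0 := by
  intro e
  rw [cr, Prod.mk_eq_zero, mul_eq_zero, mul_eq_zero] at e
  obtain ⟨e₁ | e₁, e₂ | e₂⟩ := e
  · exact h 3 0 2 (by decide) (by decide) (by decide) e₁ e₂
  · exact h 0 1 3 (by decide) (by decide) (by decide) (det2_eq_zero_comm.1 e₂)
      (det2_eq_zero_comm.1 e₁)
  · exact h 2 1 3 (by decide) (by decide) (by decide) (det2_eq_zero_comm.1 e₁)
      (det2_eq_zero_comm.1 e₂)
  · exact h 1 2 0 (by decide) (by decide) (by decide) e₁ e₂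

theorem pt_cr_eq_infty {a b c d : ℂ × ℂ} (hab : det2 a b = 0) :
    pt (cr a b c d) = OnePoint.infty := by
  rw [show cr a b c d = (det2 d a * det2 b c, 0) by simp [cr, det2_eq_zero_comm.1 hab], pt_infty]

theorem pt_cr_eq_one {a b c d : ℂ × ℂ} (hac : det2 a c = 0) (had : det2 a d ≠ 0)
    (hcb : det2 c b ≠ 0) : pt (cr a b c d) = ((1 : ℂ) : P1) := by
  have hcr : det2 (1, 1) (cr a b c d) = -det2 a c * det2 d b := by simp only [det2, cr]; ring
  rw [← pt_self one_ne_zero, pt_eq_iff _ (by simp), det2_eq_zero_comm, hcr, hac]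
  · simp
  · simp [cr, det2_eq_zero_comm.not.1 had, det2_eq_zero_comm.not.1 hcb]

theorem pt_cr_eq_zero {a b c d : ℂ × ℂ} (hbc : det2 b c = 0) (hba : det2 b a ≠ 0)
    (hcd : det2 c d ≠ 0) : pt (cr a b c d) = ((0 : ℂ) : P1) := by
  rw [show cr a b c d = (0, det2 d c * det2 b a) by simp [cr, hbc],
    pt_zero (mul_ne_zero (det2_eq_zero_comm.not.1 hcd) hba)]

namespace Marking

variable {T : RealTree} {K L : Type} (μ : Marking T K L)

theorem IsCrossRatio.unique {q : Fin 4 ↪ Mark K L} {c c' : P1} (h : μ.IsCrossRatio q c)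
    (h' : μ.IsCrossRatio q c') : c = c' := by
  obtain ⟨v, g, h0, h1, h2, h3⟩ := h
  obtain ⟨v', g', h0', h1', h2', h3'⟩ := h'
  have hs := Separates.of_smul h0 h1 h2
  obtain rfl := hs.unique (Separates.of_smul h0' h1' h2')
  rw [← h3, ← h3']
  exact smul_eq_smul_of_three hs.1 hs.2.1 hs.2.2 (h0.trans h0'.symm) (h1.trans h1'.symm)
    (h2.trans h2'.symm) _

theorem exists_separates_embedding (q : Fin 4 ↪ Mark K L) :
    ∃ v, μ.Separates v (q 0) (q 1) (q 2) :=
  μ.exists_separates (q.injective.ne (by decide)) (q.injective.ne (by decide))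
    (q.injective.ne (by decide))

theorem exists_isCrossRatio (q : Fin 4 ↪ Mark K L) : ∃ c, μ.IsCrossRatio q c := by
  obtain ⟨v, hv⟩ := μ.exists_separates_embedding q
  obtain ⟨g, h0, h1, h2⟩ := hv.exists_smul
  exact ⟨_, v, g, h0, h1, h2, rfl⟩

theorem crossRatio_mk_iff {q : Fin 4 ↪ Mark K L} {c : P1} :
    (Moduli.mk T μ).crossRatio q = c ↔ μ.IsCrossRatio q c := by
  obtain ⟨c₀, hc₀⟩ := μ.exists_isCrossRatio q
  obtain ⟨T', μ', h, hc⟩ := Classical.epsilon_spec (p := fun c => ∃ (T' : RealTree)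
    (μ' : Marking T' K L), Moduli.mk T' μ' = Moduli.mk T μ ∧ μ'.IsCrossRatio q c)
    ⟨c₀, T, μ, rfl, hc₀⟩
  have hmem : μ.IsCrossRatio q ((Moduli.mk T μ).crossRatio q) :=
    Iso.isCrossRatio (Quotient.exact h) hc
  exact ⟨fun h => h ▸ hmem, fun h => IsCrossRatio.unique μ hmem h⟩

theorem crossRatio_eq_pt_of_det {q : Fin 4 ↪ Mark K L} {v : Fin T.n} {g : GL (Fin 2) ℂ}
    {p : Fin 4 → ℂ × ℂ} (hp : ∀ k, p k ≠ 0) (hg : ∀ k, g • μ.seen v (q k) = pt (p k))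
    (h01 : det2 (p 1) (p 0) ≠ 0) (h02 : det2 (p 0) (p 2) ≠ 0) (h12 : det2 (p 1) (p 2) ≠ 0) :
    (Moduli.mk T μ).crossRatio q = pt (cr (p 0) (p 1) (p 2) (p 3)) := by
  rw [crossRatio_mk_iff]
  obtain ⟨k, hk⟩ := exists_gl_cr h01 h12 h02
  refine ⟨v, k * g, ?_, ?_, ?_, ?_⟩ <;> rw [mul_smul, hg, hk _ (hp _)]
  · rw [show cr (p 0) (p 1) (p 2) (p 0) = (0, det2 (p 0) (p 2) * det2 (p 1) (p 0)) by
      simp [cr, det2, mul_comm]]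
    exact pt_zero (mul_ne_zero h02 h01)
  · rw [show cr (p 0) (p 1) (p 2) (p 1) = (det2 (p 1) (p 0) * det2 (p 1) (p 2),
      det2 (p 1) (p 0) * det2 (p 1) (p 2)) by simp [cr, mul_comm]]
    exact pt_self (mul_ne_zero h01 h12)
  · rw [show cr (p 0) (p 1) (p 2) (p 2) = (det2 (p 2) (p 0) * det2 (p 1) (p 2), 0) by
      simp [cr, det2, mul_comm]]
    exact pt_infty _

theorem crossRatio_eq_pt {q : Fin 4 ↪ Mark K L} {v : Fin T.n} {g : GL (Fin 2) ℂ}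
    {p : Fin 4 → ℂ × ℂ} (h3 : NoTripleCoincidence p) (hp : ∀ k, p k ≠ 0)
    (hg : ∀ k, g • μ.seen v (q k) = pt (p k)) :
    (Moduli.mk T μ).crossRatio q = pt (cr (p 0) (p 1) (p 2) (p 3)) := by
  have hseen : ∀ k l, μ.seen v (q k) = μ.seen v (q l) ↔ det2 (p k) (p l) = 0 := by
    intro k l
    rw [← pt_eq_iff (hp k) (hp l), ← hg, ← hg, smul_left_cancel_iff]
  obtain ⟨v', hv'⟩ := μ.exists_separates_embedding q
  obtain rfl | hv := eq_or_ne v v'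
  · exact μ.crossRatio_eq_pt_of_det hp hg (fun e => hv'.1 ((hseen _ _).2 e).symm)
      (fun e => hv'.2.1 ((hseen _ _).2 e)) (fun e => hv'.2.2 ((hseen _ _).2 e))
  rw [crossRatio_mk_iff]
  obtain ⟨g', h0, h1, h2⟩ := hv'.exists_smul
  refine ⟨v', g', h0, h1, h2, ?_⟩
  rcases hv'.seen_eq_seen hv fun i j k hij hik hjk e e' =>
      h3 i j k hij hik hjk ((hseen i j).1 e) ((hseen i k).1 e') with ⟨e, e'⟩ | ⟨e, e'⟩ | ⟨e, e'⟩ <;>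
    rw [hseen] at e <;> rw [e']
  · rw [h2, pt_cr_eq_infty e]
  · rw [h1, pt_cr_eq_one e (h3 0 2 3 (by decide) (by decide) (by decide) e)
      (h3 2 0 1 (by decide) (by decide) (by decide) (det2_eq_zero_comm.1 e))]
  · rw [h0, pt_cr_eq_zero e (h3 1 2 0 (by decide) (by decide) (by decide) e)
      (h3 2 1 3 (by decide) (by decide) (by decide) (det2_eq_zero_comm.1 e))]

end Marking

theorem Moduli.exists_mk {K L : Type} (m : Moduli K L) :
    ∃ (T : RealTree) (μ : Marking T K L), Moduli.mk T μ = m := by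
  obtain ⟨⟨T, μ⟩, h⟩ := Quotient.exists_rep m
  exact ⟨T, μ, h⟩

/-! ### A chart of the moduli space with one real point and two conjugate pairs

The coordinate is the position `w` of `z_2⁺` when `z_1⁺`, `z_1⁻`, `x_1` are at `0`, `1`, `∞`.
In this normalization, the involution is `z ↦ 1 - conj z`. -/

section Normalized

variable {T : RealTree} {K L : Type} {μ : Marking T K L} {v : Fin T.n} {i : K} {j : L}
  {g : GL (Fin 2) ℂ}

theorem inv_eq_of_normalized (h0 : g • μ.seen v (Sum.inr (j, true)) = ((0 : ℂ) : P1))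
    (h1 : g • μ.seen v (Sum.inr (j, false)) = ((1 : ℂ) : P1))
    (h2 : g • μ.seen v (Sum.inl i) = OnePoint.infty) : T.inv v = v := by
  have hs := Marking.Separates.of_smul h0 h1 h2
  have hc := hs.conj
  exact Marking.Separates.unique (i := Sum.inr (j, true)) (j := Sum.inr (j, false))
    (k := Sum.inl i) ⟨hc.1.symm, hc.2.2, hc.2.1⟩ hs

theorem seen_conj_of_normalized (h0 : g • μ.seen v (Sum.inr (j, true)) = ((0 : ℂ) : P1))
    (h1 : g • μ.seen v (Sum.inr (j, false)) = ((1 : ℂ) : P1))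
    (h2 : g • μ.seen v (Sum.inl i) = OnePoint.infty) {k : Mark K L} {w : ℂ}
    (hw : g • μ.seen v k = (w : P1)) :
    g • μ.seen v (Mark.conj k) = ((1 - starRingEnd ℂ w : ℂ) : P1) := by
  have seen_conj := μ.seen_conj_of_inv_eq (inv_eq_of_normalized h0 h1 h2)
  obtain ⟨r, r_infty, r_coe⟩ := exists_anti_one_sub
  have sig_eq : ∀ z, g • T.sig v (g⁻¹ • z) = r • P1.conj z := by
    refine ((T.isAnti_sig v).smul g g⁻¹).eq_of_three ⟨r, fun _ => rfl⟩ (a := ((0 : ℂ) : P1))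
      (b := ((1 : ℂ) : P1)) (c := OnePoint.infty) (by simp) (OnePoint.coe_ne_infty _)
      (OnePoint.coe_ne_infty _) ?_ ?_ ?_
    · rw [← h0, inv_smul_smul, ← seen_conj, h0, r_coe]
      simpa [Mark.conj] using h1
    · rw [← h1, inv_smul_smul, ← seen_conj, h1, r_coe]
      simpa [Mark.conj] using h0
    · rw [← h2, inv_smul_smul, ← seen_conj, h2, r_infty]
      simpa [Mark.conj] using h2
  rw [seen_conj, ← inv_smul_smul g (μ.seen v k), sig_eq, hw, r_coe]

end Normalized

/-- The marked points `z_1⁺`, `z_1⁻`, `x_1`, `z_2⁺` if `b = true`, and `z_1⁺`, `z_1⁻`, `x_1`,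
`z_2⁻` if `b = false`. -/
def chartMarks (b : Bool) : Fin 4 ↪ Mark (Fin 1) (Fin 2) :=
  ⟨![Sum.inr (0, true), Sum.inr (0, false), Sum.inl 0, Sum.inr (1, b)], by
    revert b; decide⟩

@[simp] theorem chartMarks_zero (b : Bool) : chartMarks b 0 = Sum.inr (0, true) := rfl
@[simp] theorem chartMarks_one (b : Bool) : chartMarks b 1 = Sum.inr (0, false) := rfl
@[simp] theorem chartMarks_two (b : Bool) : chartMarks b 2 = Sum.inl 0 := rfl
@[simp] theorem chartMarks_three (b : Bool) : chartMarks b 3 = Sum.inr (1, b) := rfl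

section Position

variable {K : Type}

/-- Homogeneous coordinates of the marked points in the normalized position with coordinate `w`. -/
def position (w : ℂ) : Mark K (Fin 2) → ℂ × ℂ
  | Sum.inl _ => (1, 0)
  | Sum.inr (j, b) =>
    (if j = 0 then (if b then 0 else 1) else (if b then w else 1 - starRingEnd ℂ w), 1)

theorem position_ne_zero (w : ℂ) (i : Mark K (Fin 2)) : position w i ≠ 0 := by
  rcases i with _ | ⟨j, b⟩ <;> simp [position]

theorem contDiff_position (i : Mark K (Fin 2)) : ContDiff ℝ ∞ fun w => position w i := by
  rcases i with _ | ⟨j, b⟩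
  · exact contDiff_const
  refine ContDiff.prodMk ?_ contDiff_const
  split_ifs
  · exact contDiff_const
  · exact contDiff_const
  · exact contDiff_id
  · exact contDiff_const.sub Complex.conjCLE.contDiff

theorem noTripleCoincidence_position [Subsingleton K] (w : ℂ) :
    NoTripleCoincidence (position w : Mark K (Fin 2) → ℂ × ℂ) := by
  intro i j k hij hik hjk h
  rcases i with i | ⟨i, b⟩ <;> rcases j with j | ⟨j, c⟩ <;> rcases k with k | ⟨k, d⟩
  · exact absurd (congrArg Sum.inl (Subsingleton.elim i j)) hij
  · exact absurd (congrArg Sum.inl (Subsingleton.elim i j)) hij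
  · exact absurd (congrArg Sum.inl (Subsingleton.elim i k)) hik
  · simp [det2, position] at h
  · exact absurd (congrArg Sum.inl (Subsingleton.elim j k)) hjk
  · simp [det2, position] at h
  · simp [det2, position]
  · intro h'
    have conj_one : w = 1 → starRingEnd ℂ w = 1 := by rintro rfl; simp
    have conj_zero : w = 0 → starRingEnd ℂ w = 0 := by rintro rfl; simp
    simp only [det2, position, mul_one, one_mul, sub_eq_zero] at h h'
    fin_cases i <;> fin_cases j <;> fin_cases k <;> grind

/-- The cross-ratios in the normalized position with coordinate `w`. -/
def chartCr (w : ℂ) (q : Fin 4 ↪ Mark K (Fin 2)) : ℂ × ℂ :=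
  cr (position w (q 0)) (position w (q 1)) (position w (q 2)) (position w (q 3))

theorem chartCr_ne_zero [Subsingleton K] (w : ℂ) (q : Fin 4 ↪ Mark K (Fin 2)) :
    chartCr w q ≠ 0 :=
  ((noTripleCoincidence_position w).comp q.injective).cr_ne_zero

theorem contDiff_chartCr (q : Fin 4 ↪ Mark K (Fin 2)) : ContDiff ℝ ∞ fun w => chartCr w q := by
  have contDiff_det2 (i j : Mark K (Fin 2)) :
      ContDiff ℝ ∞ fun w => det2 (position w i) (position w j) :=
    ((contDiff_position i).fst.mul (contDiff_position j).snd).sub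
      ((contDiff_position i).snd.mul (contDiff_position j).fst)
  exact ((contDiff_det2 _ _).mul (contDiff_det2 _ _)).prodMk
    ((contDiff_det2 _ _).mul (contDiff_det2 _ _))

theorem chartCr_chartMarks (w : ℂ) (b : Bool) :
    pt (chartCr w (chartMarks b)) = ((if b then w else 1 - starRingEnd ℂ w : ℂ) : P1) := by
  have : chartCr w (chartMarks b) =
      (-1 : ℂ) • ((if b then w else 1 - starRingEnd ℂ w : ℂ), (1 : ℂ)) := by
    cases b <;> simp [chartCr, cr, position, det2]
  rw [this, pt_smul_eq (by simp), pt_coe]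

theorem crossRatio_of_position [Subsingleton K] {T : RealTree}
    (μ : Marking T K (Fin 2)) {v : Fin T.n} {g : GL (Fin 2) ℂ} {w : ℂ}
    (h : ∀ i, g • μ.seen v i = pt (position w i)) (q : Fin 4 ↪ Mark K (Fin 2)) :
    (Moduli.mk T μ).crossRatio q = pt (chartCr w q) :=
  μ.crossRatio_eq_pt (p := fun k => position w (q k))
    ((noTripleCoincidence_position w).comp q.injective) (fun _ => position_ne_zero _ _)
    fun _ => h _

end Position

theorem exists_position {T : RealTree} (μ : Marking T (Fin 1) (Fin 2)) {w : ℂ}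
    (h : (Moduli.mk T μ).crossRatio (chartMarks true) = (w : P1)) :
    ∃ (v : Fin T.n) (g : GL (Fin 2) ℂ), T.inv v = v ∧
      ∀ i, g • μ.seen v i = pt (position w i) := by
  obtain ⟨v, g, h0, h1, h2, h3⟩ := μ.crossRatio_mk_iff.1 h
  simp only [chartMarks_zero, chartMarks_one, chartMarks_two, chartMarks_three] at h0 h1 h2 h3
  refine ⟨v, g, inv_eq_of_normalized h0 h1 h2, ?_⟩
  rintro (i | ⟨j, b⟩)
  · rw [Subsingleton.elim i 0, h2]
    exact (pt_infty _).symm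
  · fin_cases j <;> cases b
    · simpa [position, pt] using h1
    · simpa [position, pt] using h0
    · simpa [position, pt, Mark.conj] using seen_conj_of_normalized h0 h1 h2 h3
    · simpa [position, pt] using h3

/-- The curve `m` lies in the domain of the chart and has coordinate `w`. -/
def HasCoord (m : Moduli (Fin 1) (Fin 2)) (w : ℂ) : Prop :=
  m.crossRatio (chartMarks true) = (w : P1)

/-- The embedding in terms of the coordinate. -/
def chart (w : ℂ) : Ambient (Fin 1) (Fin 2) := fun q => roundSphere (chartCr w q)

theorem HasCoord.crossRatio {m : Moduli (Fin 1) (Fin 2)} {w : ℂ} (h : HasCoord m w)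
    (q : Fin 4 ↪ Mark (Fin 1) (Fin 2)) : m.crossRatio q = pt (chartCr w q) := by
  obtain ⟨T, μ, rfl⟩ := m.exists_mk
  obtain ⟨v, g, -, hg⟩ := exists_position μ h
  exact crossRatio_of_position μ hg q

theorem HasCoord.crossRatio_false {m : Moduli (Fin 1) (Fin 2)} {w : ℂ} (h : HasCoord m w) :
    m.crossRatio (chartMarks false) = ((1 - starRingEnd ℂ w : ℂ) : P1) := by
  rw [h.crossRatio, chartCr_chartMarks]
  rfl

theorem HasCoord.emb_eq {m : Moduli (Fin 1) (Fin 2)} {w : ℂ} (h : HasCoord m w) :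
    emb m = chart w := by
  ext1 q
  rw [emb, h.crossRatio q, sphere_pt (chartCr_ne_zero w q), chart]

theorem contDiff_chart : ContDiff ℝ ∞ chart :=
  contDiff_pi.2 fun q =>
    contDiffOn_roundSphere.comp_contDiff (contDiff_chartCr q) fun w => chartCr_ne_zero w q

/-- The derivative of the chart. -/
def dchart (w : ℂ) : ℂ →L[ℝ] Ambient (Fin 1) (Fin 2) := fderiv ℝ chart w

theorem hasFDerivAt_chart (w : ℂ) : HasFDerivAt chart (dchart w) w :=
  ((contDiff_chart.differentiable (by simp)) w).hasFDerivAt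

theorem continuous_dchart : Continuous dchart := contDiff_chart.continuous_fderiv (by simp)

/-- The coordinate as a function on the ambient space: the stereographic projection of the
cross-ratio of `chartMarks true`. -/
def coord (e : Ambient (Fin 1) (Fin 2)) : ℂ :=
  (e (chartMarks true)).1 / ((1 - (e (chartMarks true)).2 : ℝ) : ℂ)

theorem chart_chartMarks (w : ℂ) : chart w (chartMarks true) = sphere (w : P1) := by
  rw [chart, ← sphere_pt (chartCr_ne_zero w _), chartCr_chartMarks]
  rfl

theorem coord_chart (w : ℂ) : coord (chart w) = w := by
  rw [coord, chart_chartMarks, stereographic_sphere]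

theorem chart_injective : Function.Injective chart :=
  Function.LeftInverse.injective coord_chart

theorem chart_snd_ne_one (w : ℂ) : (chart w (chartMarks true)).2 ≠ 1 := by
  rw [chart_chartMarks, Ne, sphere_snd_eq_one_iff]
  exact OnePoint.coe_ne_infty _

theorem hasCoord_coord {m : Moduli (Fin 1) (Fin 2)} (h : (emb m (chartMarks true)).2 ≠ 1) :
    HasCoord m (coord (emb m)) := by
  have : m.crossRatio (chartMarks true) ≠ OnePoint.infty := by
    rwa [Ne, ← sphere_snd_eq_one_iff]
  obtain ⟨w, hw⟩ := OnePoint.ne_infty_iff_exists.1 this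
  have hc : HasCoord m w := hw.symm
  rwa [hc.emb_eq, coord_chart]

theorem differentiableAt_coord (w : ℂ) : DifferentiableAt ℝ coord (chart w) := by
  have hmark : DifferentiableAt ℝ (fun e : Ambient (Fin 1) (Fin 2) => e (chartMarks true))
      (chart w) := differentiableAt_apply _ _
  refine DifferentiableAt.mul hmark.fst (DifferentiableAt.inv ?_ ?_)
  · exact Complex.ofRealCLM.differentiableAt.comp _
      ((differentiableAt_const (1 : ℝ)).sub hmark.snd)
  · exact_mod_cast sub_ne_zero.2 (chart_snd_ne_one w).symm

theorem fderiv_coord_dchart (w z : ℂ) : fderiv ℝ coord (chart w) (dchart w z) = z := by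
  have h := (differentiableAt_coord w).hasFDerivAt.comp w (hasFDerivAt_chart w)
  rw [show coord ∘ chart = id from funext coord_chart] at h
  exact congrArg (fun L : ℂ →L[ℝ] ℂ => L z) (h.unique (hasFDerivAt_id w))

theorem dchart_injective (w : ℂ) : Function.Injective (dchart w) :=
  Function.LeftInverse.injective (fderiv_coord_dchart w)

/-! ### Tangent spaces -/

section TangentSpace

variable {K L : Type}

theorem tangentSpace_mono {A A' : Set (Moduli K L)} (h : A ⊆ A') (p : Moduli K L) :
    tangentSpace A p ≤ tangentSpace A' p :=
  Submodule.span_mono (tangentConeAt_mono (Set.image_mono h))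

theorem mem_tangentSpace_of_curve [Finite K] [Finite L] {A : Set (Moduli K L)}
    {γ : ℝ → Moduli K L} {s : Set ℝ} {t : ℝ} {y : Ambient K L}
    (hγ : HasDerivWithinAt (fun r => emb (γ r)) y s t)
    (hs : AccPt t (Filter.principal s)) (hA : ∀ r ∈ s, γ r ∈ A) : y ∈ tangentSpace A (γ t) := by
  classical
  cases nonempty_fintype K
  cases nonempty_fintype L
  have one_mem : (1 : ℝ) ∈ tangentConeAt ℝ s t := by
    rw [tangentConeAt_eq_univ hs]; trivial
  have image_subset : (fun r => emb (γ r)) '' s ⊆ emb '' A := by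
    rintro _ ⟨r, hr, rfl⟩
    exact ⟨_, hA r hr, rfl⟩
  have hy := tangentConeAt_mono image_subset (hγ.hasFDerivWithinAt.mapsTo_tangent_cone one_mem)
  refine Submodule.subset_span ?_
  simpa using hy

theorem fderiv_eq_of_mem_tangentSpace {E : Type*} [NormedAddCommGroup E] [NormedSpace ℝ E]
    {A : Set (Moduli K L)} {p : Moduli K L} {f g : Ambient K L → E} {f' g' : Ambient K L →L[ℝ] E}
    (hf : HasFDerivAt f f' (emb p)) (hg : HasFDerivAt g g' (emb p))
    (h : f =ᶠ[nhdsWithin (emb p) (emb '' A)] g) (hp : f (emb p) = g (emb p)) {y : Ambient K L}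
    (hy : y ∈ tangentSpace A p) : f' y = g' y := by
  have hle : tangentSpace A p ≤ LinearMap.eqLocus (f' : Ambient K L →ₗ[ℝ] E) g' :=
    Submodule.span_le.2 <|
      hf.hasFDerivWithinAt.unique_on (hg.hasFDerivWithinAt.congr_of_eventuallyEq h hp)
  exact hle hy

end TangentSpace

theorem tangentSpace_le_range {A : Set (Moduli (Fin 1) (Fin 2))} {p : Moduli (Fin 1) (Fin 2)}
    {w : ℂ} (hp : HasCoord p w) :
    tangentSpace A p ≤ LinearMap.range (dchart w : ℂ →ₗ[ℝ] Ambient (Fin 1) (Fin 2)) := by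
  intro y hy
  have chart_coord : HasFDerivAt (chart ∘ coord) ((dchart w).comp (fderiv ℝ coord (chart w)))
      (emb p) := by
    rw [hp.emb_eq]
    refine HasFDerivAt.comp _ ?_ (differentiableAt_coord w).hasFDerivAt
    rw [coord_chart]
    exact hasFDerivAt_chart w
  have hopen : IsOpen {e : Ambient (Fin 1) (Fin 2) | (e (chartMarks true)).2 ≠ 1} :=
    isOpen_ne_fun (continuous_snd.comp (continuous_apply _)) continuous_const
  have hmem : (emb p (chartMarks true)).2 ≠ 1 := by
    rw [hp.emb_eq]
    exact chart_snd_ne_one w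
  refine ⟨_, fderiv_eq_of_mem_tangentSpace chart_coord (hasFDerivAt_id _) ?_ ?_ hy⟩
  · filter_upwards [self_mem_nhdsWithin, mem_nhdsWithin_of_mem_nhds (hopen.mem_nhds hmem)]
    rintro _ ⟨m, -, rfl⟩ hm
    exact (hasCoord_coord hm).emb_eq.symm
  · exact (hasCoord_coord hmem).emb_eq.symm

theorem im_eq_zero_of_mem_tangentSpace {A : Set (Moduli (Fin 1) (Fin 2))}
    {p : Moduli (Fin 1) (Fin 2)} {w : ℂ} (hp : HasCoord p w) (hw : w.im = 0)
    (hA : ∀ m ∈ A, ∃ t : ℝ, HasCoord m t) {z : ℂ} (hz : dchart w z ∈ tangentSpace A p) :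
    z.im = 0 := by
  have im_coord : HasFDerivAt (fun e => (coord e).im)
      (Complex.imCLM.comp (fderiv ℝ coord (chart w))) (emb p) := by
    rw [hp.emb_eq]
    exact Complex.imCLM.hasFDerivAt.comp _ (differentiableAt_coord w).hasFDerivAt
  have h := fderiv_eq_of_mem_tangentSpace im_coord (hasFDerivAt_const (0 : ℝ) _) ?_ ?_ hz
  · simpa [fderiv_coord_dchart] using h
  · filter_upwards [self_mem_nhdsWithin]
    rintro _ ⟨m, hm, rfl⟩
    obtain ⟨t, ht⟩ := hA m hm
    simp only [ht.emb_eq, coord_chart, Complex.ofReal_im]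
  · simp only [hp.emb_eq, coord_chart, hw]

/-! ### Rotations, gluings and smoothings in the chart -/

theorem hasCoord_iff_of_crossRatio_eq_pt {m : Moduli (Fin 1) (Fin 2)} {p : ℂ × ℂ} {w : ℂ}
    (h : m.crossRatio (chartMarks true) = pt p) : HasCoord m w ↔ p.2 ≠ 0 ∧ p.1 / p.2 = w := by
  rw [HasCoord, h, pt]
  split_ifs with hp
  · simp [hp, OnePoint.infty_ne_coe]
  · simp [hp]

theorem hasDerivAt_emb_of_crossRatio {m : ℝ → Moduli (Fin 1) (Fin 2)} {N D : ℝ → ℂ} {N' D' w : ℂ}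
    (hm : ∀ᶠ θ in nhds 0, (m θ).crossRatio (chartMarks true) = pt (N θ, D θ))
    (hN : HasDerivAt N N' 0) (hD : HasDerivAt D D' 0) (hw : HasCoord (m 0) w) :
    HasDerivAt (fun θ => emb (m θ)) (dchart w ((N' * D 0 - N 0 * D') / D 0 ^ 2)) 0 := by
  obtain ⟨hD0 : D 0 ≠ 0, rfl⟩ := (hasCoord_iff_of_crossRatio_eq_pt hm.self_of_nhds).1 hw
  have hc : HasDerivAt (chart ∘ fun θ => N θ / D θ)
      (dchart (N 0 / D 0) ((N' * D 0 - N 0 * D') / D 0 ^ 2)) 0 :=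
    (hasFDerivAt_chart _).comp_hasDerivAt (0 : ℝ) (hN.div hD hD0)
  refine hc.congr_of_eventuallyEq ?_
  filter_upwards [hm, hD.continuousAt.eventually_ne hD0] with θ h1 h2
  exact ((hasCoord_iff_of_crossRatio_eq_pt h1).2 ⟨h2, rfl⟩).emb_eq

theorem hasDerivAt_exp_mul_I :
    HasDerivAt (fun θ : ℝ => Complex.exp (θ * Complex.I)) Complex.I 0 := by
  have h := ((hasDerivAt_id (0 : ℝ)).ofReal_comp.mul_const Complex.I).cexp
  simpa using h

namespace IsRotation

variable {K L : Type} {o : L} {i : K} {m : ℝ → Moduli K L}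

theorem exists_seen (hm : IsRotation o i m) {j : Mark K L} (hi : j ≠ Sum.inl i)
    (hz : j ≠ Sum.inr (o, true)) (hz' : j ≠ Sum.inr (o, false)) :
    ∃ (T : RealTree) (μ : ℝ → Marking T K L) (v : Fin T.n) (g : GL (Fin 2) ℂ) (a : ℂ), a ≠ 0 ∧
      ∀ᶠ θ : ℝ in nhds 0, m θ = Moduli.mk T (μ θ) ∧
        g • (μ θ).seen v (Sum.inr (o, true)) = ((0 : ℂ) : P1) ∧
        g • (μ θ).seen v (Sum.inr (o, false)) = OnePoint.infty ∧
        g • (μ θ).seen v (Sum.inl i) = ((Complex.exp (θ * Complex.I) : ℂ) : P1) ∧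
        g • (μ θ).seen v j = (a : P1) := by
  obtain ⟨T, μ, v, g, h⟩ := hm
  have hseen : ∀ᶠ θ : ℝ in nhds 0, m θ = Moduli.mk T (μ θ) ∧
      g • (μ θ).seen v (Sum.inr (o, true)) = ((0 : ℂ) : P1) ∧
      g • (μ θ).seen v (Sum.inr (o, false)) = OnePoint.infty ∧
      g • (μ θ).seen v (Sum.inl i) = ((Complex.exp (θ * Complex.I) : ℂ) : P1) ∧
      (μ θ).seen v j = (μ 0).seen v j ∧
      g • (μ θ).seen v j ≠ ((0 : ℂ) : P1) ∧ g • (μ θ).seen v j ≠ OnePoint.infty := by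
    filter_upwards [h] with θ ⟨e, hc, hp, hx, hy, h0, h1, h2⟩
    have hv : T.inv v = v := by simpa [Mark.conj, hx] using ((μ θ).comp_conj (Sum.inl i)).symm
    have hy' : (μ θ).comp (Sum.inr (o, false)) = v := by
      simpa [Mark.conj, hy, hv] using (μ θ).comp_conj (Sum.inr (o, true))
    rw [← (μ θ).seen_of_comp_eq hy] at h0
    rw [← (μ θ).seen_of_comp_eq hy'] at h1
    rw [← (μ θ).seen_of_comp_eq hx] at h2
    refine ⟨e, h0, h1, h2, by simp only [Marking.seen, hc, hp j hi], ?_, ?_⟩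
    · rw [← h0]
      exact (MulAction.injective g).ne ((μ θ).seen_ne_of_comp_eq hy hz.symm).symm
    · rw [← h1]
      exact (MulAction.injective g).ne ((μ θ).seen_ne_of_comp_eq hy' hz'.symm).symm
  obtain ⟨a, ha⟩ := OnePoint.ne_infty_iff_exists.1 hseen.self_of_nhds.2.2.2.2.2.2
  refine ⟨T, μ, v, g, a, ?_, ?_⟩
  · rintro rfl
    exact hseen.self_of_nhds.2.2.2.2.2.1 ha.symm
  · filter_upwards [hseen] with θ ⟨e, h0, h1, h2, hj, _⟩
    exact ⟨e, h0, h1, h2, by rw [hj, ha]⟩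

theorem exists_crossRatio (hm : IsRotation o i m) {q : Fin 4 ↪ Mark K L}
    (h0 : q 0 = Sum.inr (o, true)) (h1 : q 1 = Sum.inr (o, false)) (h2 : q 2 = Sum.inl i) :
    ∃ a : ℂ, ∀ᶠ θ : ℝ in nhds 0,
      (m θ).crossRatio q = pt (a, a - Complex.exp (θ * Complex.I)) := by
  obtain ⟨T, μ, v, g, a, -, h⟩ := hm.exists_seen (j := q 3) (by simp [← h2])
    (by simp [← h0]) (by simp [← h1])
  refine ⟨a, ?_⟩
  filter_upwards [h] with θ ⟨e, e0, e1, e2, e3⟩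
  rw [e, (μ θ).crossRatio_eq_pt_of_det (v := v) (g := g)
    (p := ![(0, 1), (1, 0), (Complex.exp (θ * Complex.I), 1), (a, 1)])]
  · simp [cr, det2]
  · simp [Fin.forall_fin_succ]
  · simp [Fin.forall_fin_succ, h0, h1, h2, e0, e1, e2, e3, pt]
  all_goals simp [det2]

theorem exists_crossRatio_swap (hm : IsRotation o i m) {q : Fin 4 ↪ Mark K L}
    (h0 : q 0 = Sum.inr (o, true)) (h1 : q 1 = Sum.inr (o, false)) (h3 : q 3 = Sum.inl i) :
    ∃ a : ℂ, ∀ᶠ θ : ℝ in nhds 0, (m θ).crossRatio q =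
      pt (Complex.exp (θ * Complex.I), Complex.exp (θ * Complex.I) - a) := by
  obtain ⟨T, μ, v, g, a, ha, h⟩ := hm.exists_seen (j := q 2) (by simp [← h3])
    (by simp [← h0]) (by simp [← h1])
  refine ⟨a, ?_⟩
  filter_upwards [h] with θ ⟨e, e0, e1, e3, e2⟩
  rw [e, (μ θ).crossRatio_eq_pt_of_det (v := v) (g := g)
    (p := ![(0, 1), (1, 0), (a, 1), (Complex.exp (θ * Complex.I), 1)])]
  · simp [cr, det2]
  · simp [Fin.forall_fin_succ]
  · simp [Fin.forall_fin_succ, h0, h1, h3, e0, e1, e2, e3, pt]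
  all_goals simp [det2, ha]

end IsRotation

theorem IsRotation.hasDerivAt_emb {m : ℝ → Moduli (Fin 1) (Fin 2)} {w : ℂ}
    (hm : IsRotation 0 0 m) (hw : HasCoord (m 0) w) :
    HasDerivAt (fun θ => emb (m θ)) (dchart w (Complex.I * (w * (w - 1)))) 0 := by
  obtain ⟨a, ha⟩ := hm.exists_crossRatio (q := chartMarks true) rfl rfl rfl
  obtain ⟨hne, rfl⟩ := (hasCoord_iff_of_crossRatio_eq_pt ha.self_of_nhds).1 hw
  convert hasDerivAt_emb_of_crossRatio ha (hasDerivAt_const _ a)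
    ((hasDerivAt_const (0 : ℝ) a).sub hasDerivAt_exp_mul_I) hw using 2
  simp only [Complex.ofReal_zero, zero_mul, Complex.exp_zero] at hne ⊢
  field_simp
  ring

section Gluing

theorem RealTree.dir_map {T₁ T : RealTree} {f : Fin T₁.n → Fin T.n}
    (hf : Function.Injective f) (hadj : ∀ v w, T₁.graph.Adj v w → T.graph.Adj (f v) (f w))
    (hdir : ∀ v w, T₁.graph.Adj v w → T.dir (f v) (f w) = T₁.dir v w) {v u : Fin T₁.n}
    (h : u ≠ v) : T.dir (f v) (f u) = T₁.dir v u := by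
  obtain ⟨w, hw, ha⟩ := RealTree.exists_adj_avoid h
  have : T.Avoid (f v) (f w) (f u) :=
    Relation.ReflTransGen.lift f (fun a b hab =>
      ⟨hadj _ _ hab.1, hf.ne hab.2.1, hf.ne hab.2.2⟩) _ _ ha
  rw [← this.dir_eq, ← ha.dir_eq, hdir _ _ hw]

theorem Marking.seen_map {T₁ T : RealTree} {K₁ L₁ K L : Type} {μ₁ : Marking T₁ K₁ L₁}
    {μ : Marking T K L} {f : Fin T₁.n → Fin T.n} (hf : Function.Injective f)
    (hadj : ∀ v w, T₁.graph.Adj v w → T.graph.Adj (f v) (f w))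
    (hdir : ∀ v w, T₁.graph.Adj v w → T.dir (f v) (f w) = T₁.dir v w) {i : Mark K L}
    {i₁ : Mark K₁ L₁} (hi : μ.comp i = f (μ₁.comp i₁) ∧ μ.pos i = μ₁.pos i₁) (v : Fin T₁.n) :
    μ.seen (f v) i = μ₁.seen v i₁ := by
  obtain ⟨hcomp, hpos⟩ := hi
  by_cases hv : μ₁.comp i₁ = v
  · rw [μ₁.seen_of_comp_eq hv, μ.seen_of_comp_eq (by rw [hcomp, hv]), hpos]
  · rw [μ₁.seen_of_comp_ne hv, μ.seen_of_comp_ne (hcomp ▸ hf.ne hv), hcomp,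
      RealTree.dir_map hf hadj hdir hv]

variable {K L : Type} {A : Set K} {B : Set L}

open Classical in
variable (A B) in
/-- Replacing the marked points of the second component by the node: the label on the first
component of a glued curve of the point seen in the direction of a marked point. -/
def Mark.collapse : Mark K L → Mark (Option A) B
  | Sum.inl i => Sum.inl (if h : i ∈ A then some ⟨i, h⟩ else none)
  | Sum.inr (j, b) => if h : j ∈ B then Sum.inr (⟨j, h⟩, b) else Sum.inl none

theorem IsGluing.exists_seen {T₁ T₂ T : RealTree} {μ₁ : Marking T₁ (Option A) B}
    {μ₂ : Marking T₂ (Option ↥(Aᶜ)) ↥(Bᶜ)} {μ : Marking T K L} (h : IsGluing μ₁ μ₂ μ) :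
    ∃ f : Fin T₁.n → Fin T.n, ∀ v i, μ.seen (f v) i = μ₁.seen v (Mark.collapse A B i) := by
  obtain ⟨e, adj₁, adj₂, adj₁₂, dir₁, -, dir_node, -, -, -, -, -, real₁, pair₁, real₂, pair₂⟩ := h
  have left_injective : Function.Injective fun v => e (Sum.inl v) :=
    e.injective.comp Sum.inl_injective
  have right_ne_left : ∀ u v, e (Sum.inr u) ≠ e (Sum.inl v) := fun u v => by simp
  have dir_right : ∀ v u, T.dir (e (Sum.inl v)) (e (Sum.inr u)) = μ₁.seen v (Sum.inl none) := by
    intro v u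
    have ha : T.Avoid (e (Sum.inl v)) (e (Sum.inr (μ₂.comp (Sum.inl none)))) (e (Sum.inr u)) :=
      Relation.ReflTransGen.lift (fun x => e (Sum.inr x)) (fun a b hab =>
        ⟨(adj₂ _ _).2 hab, right_ne_left _ _, right_ne_left _ _⟩) _ _ (T₂.reflTransGen_adj _ u)
    rw [← ha.dir_eq]
    by_cases hv : μ₁.comp (Sum.inl none) = v
    · rw [μ₁.seen_of_comp_eq hv, ← dir_node, hv]
    · rw [μ₁.seen_of_comp_ne hv,
        ← RealTree.dir_map left_injective (fun v w => (adj₁ v w).2) dir₁ hv]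
      exact (T.dir_branch _ _ _ ((adj₁₂ _ _).2 ⟨rfl, rfl⟩) (left_injective.ne hv)
        (right_ne_left _ _)).symm
  have seen_right : ∀ v i u, μ.comp i = e (Sum.inr u) →
      μ.seen (e (Sum.inl v)) i = μ₁.seen v (Sum.inl none) := by
    intro v i u hi
    rw [μ.seen_of_comp_ne (hi ▸ right_ne_left _ _), hi, dir_right]
  have seen_left {i i₁} := Marking.seen_map (i := i) (i₁ := i₁) (μ := μ) (μ₁ := μ₁)
    left_injective (fun v w => (adj₁ v w).2) dir₁
  refine ⟨fun v => e (Sum.inl v), fun v i => ?_⟩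
  rcases i with i | ⟨j, b⟩ <;> simp only [Mark.collapse] <;> split_ifs with hmem
  · exact seen_left (real₁ ⟨i, hmem⟩) v
  · exact seen_right _ _ _ (real₂ ⟨i, hmem⟩).1
  · exact seen_left (pair₁ ⟨j, hmem⟩ b) v
  · exact seen_right _ _ _ (pair₂ ⟨j, hmem⟩ b).1

theorem Glue.crossRatio {m₁ : Moduli (Option A) B} {m₂ : Moduli (Option ↥(Aᶜ)) ↥(Bᶜ)}
    {m : Moduli K L} (h : Glue A B m₁ m₂ m) {q : Fin 4 ↪ Mark K L}
    {q₁ : Fin 4 ↪ Mark (Option A) B} (hq : ∀ k, Mark.collapse A B (q k) = q₁ k) :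
    m.crossRatio q = m₁.crossRatio q₁ := by
  obtain ⟨T₁, μ₁, T₂, μ₂, T, μ, rfl, -, rfl, hg⟩ := h
  obtain ⟨f, hf⟩ := hg.exists_seen
  obtain ⟨v, g, h0, h1, h2, h3⟩ := (μ₁.crossRatio_mk_iff (q := q₁)).1 rfl
  rw [Marking.crossRatio_mk_iff]
  exact ⟨f v, g, by rw [hf, hq, h0], by rw [hf, hq, h1], by rw [hf, hq, h2], by rw [hf, hq, h3]⟩

end Gluing

/-- The marked points `z_1⁺`, `z_1⁻`, `x_1` and the node on the first component of a curve in the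
second stratum. -/
def nodeMarks : Fin 4 ↪ Mark (Option (Set.univ : Set (Fin 1))) ({0} : Set (Fin 2)) :=
  ⟨![Sum.inr (⟨0, rfl⟩, true), Sum.inr (⟨0, rfl⟩, false), Sum.inl (some ⟨0, trivial⟩),
    Sum.inl none], by
      intro i j h
      fin_cases i <;> fin_cases j <;> simp at h ⊢⟩

theorem collapse_chartMarks (b : Bool) (k : Fin 4) :
    Mark.collapse Set.univ {0} (chartMarks b k) = nodeMarks k := by
  fin_cases k <;> simp [chartMarks, Mark.collapse] <;> rfl

theorem hasDerivAt_emb_of_rotation_node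
    {m₁ : ℝ → Moduli (Option (Set.univ : Set (Fin 1))) ({0} : Set (Fin 2))}
    {m₂ : Moduli (Option ↥((Set.univ : Set (Fin 1))ᶜ)) ↥(({0} : Set (Fin 2))ᶜ)}
    {m : ℝ → Moduli (Fin 1) (Fin 2)} {o : ({0} : Set (Fin 2))} {w : ℂ} (hm₁ : IsRotation o none m₁)
    (hg : ∀ᶠ θ in nhds (0 : ℝ), Glue Set.univ {0} (m₁ θ) m₂ (m θ)) (hw : HasCoord (m 0) w) :
    HasDerivAt (fun θ => emb (m θ)) (dchart w (-Complex.I * (w * (w - 1)))) 0 := by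
  obtain rfl : o = ⟨0, rfl⟩ := Subsingleton.elim _ _
  obtain ⟨a, ha⟩ := hm₁.exists_crossRatio_swap (q := nodeMarks) rfl rfl rfl
  have hcr : ∀ᶠ θ : ℝ in nhds 0, (m θ).crossRatio (chartMarks true) =
      pt (Complex.exp (θ * Complex.I), Complex.exp (θ * Complex.I) - a) := by
    filter_upwards [ha, hg] with θ h hθ
    rw [hθ.crossRatio (collapse_chartMarks true), h]
  obtain ⟨hne, rfl⟩ := (hasCoord_iff_of_crossRatio_eq_pt hcr.self_of_nhds).1 hw
  convert hasDerivAt_emb_of_crossRatio hcr hasDerivAt_exp_mul_I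
    (hasDerivAt_exp_mul_I.sub (hasDerivAt_const (0 : ℝ) a)) hw using 2
  simp only [Complex.ofReal_zero, zero_mul, Complex.exp_zero] at hne ⊢
  field_simp
  ring

/-- The coordinate of the curve `IsSmoothing b ζ`, for `ζ ≠ 1`. -/
def smoothingCoord (b : Bool) (ζ : ℂ) : ℂ :=
  if b then ζ / (ζ - 1) else (1 - starRingEnd ℂ ζ)⁻¹

theorem IsSmoothing.hasCoord {b : Bool} {ζ : ℂ} {m : Moduli (Fin 1) (Fin 2)}
    (h : IsSmoothing b ζ m) (h0 : ζ ≠ 0) (h1 : ζ ≠ 1) : HasCoord m (smoothingCoord b ζ) := by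
  obtain ⟨T, μ, rfl, hn, hx, hz, hz', hy, hy'⟩ := h
  have seen_eq_pos : ∀ i, μ.seen (μ.comp (Sum.inl 0)) i = μ.pos i := fun i =>
    μ.seen_of_comp_eq ((Fin.cast_injective hn) (Subsingleton.elim _ _))
  have crossRatio_eq : ∀ ξ : ℂ, μ.pos (Sum.inr (1, true)) = (ξ : P1) →
      (Moduli.mk T μ).crossRatio (chartMarks true) = pt (ξ, ξ - 1) := by
    intro ξ hξ
    rw [μ.crossRatio_eq_pt_of_det (v := μ.comp (Sum.inl 0)) (g := 1)
      (p := ![(0, 1), (1, 0), (1, 1), (ξ, 1)])]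
    · simp [cr, det2]
    · simp [Fin.forall_fin_succ]
    · simp [Fin.forall_fin_succ, seen_eq_pos, hx, hz, hz', hξ, pt]
    all_goals simp [det2]
  cases b
  · have hc0 : starRingEnd ℂ ζ ≠ 0 := by simpa using h0
    have hc1 : 1 - starRingEnd ℂ ζ ≠ 0 := by
      rw [sub_ne_zero, Ne, eq_comm, map_eq_one_iff _ (starRingEnd ℂ).injective]
      exact h1
    have e : (starRingEnd ℂ ζ)⁻¹ - 1 = (1 - starRingEnd ℂ ζ) / starRingEnd ℂ ζ := by field_simp
    refine (hasCoord_iff_of_crossRatio_eq_pt (crossRatio_eq _ hy')).2 ⟨?_, ?_⟩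
    · exact e ▸ div_ne_zero hc1 hc0
    · simp only [smoothingCoord, Bool.false_eq_true, if_false, e]
      field_simp
  · exact (hasCoord_iff_of_crossRatio_eq_pt (crossRatio_eq _ hy)).2
      ⟨sub_ne_zero.2 h1, by simp [smoothingCoord]⟩

/-! ### Explicit curves -/

/-- The reflection in the unit circle. -/
def reflect (z : P1) : P1 := (exists_anti_div (one_ne_zero (α := ℂ))).choose • P1.conj z

theorem reflect_pt {p : ℂ × ℂ} (hp : p ≠ 0) :
    reflect (pt p) = pt (starRingEnd ℂ p.2, starRingEnd ℂ p.1) := by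
  rw [reflect, (exists_anti_div (one_ne_zero (α := ℂ))).choose_spec p hp, one_mul]

theorem reflect_coe (a : ℂ) : reflect a = pt (1, starRingEnd ℂ a) := by
  rw [← pt_coe, reflect_pt (by simp), map_one]

@[simp] theorem reflect_zero : reflect ((0 : ℂ) : P1) = OnePoint.infty := by
  rw [reflect_coe, map_zero, pt_infty]

@[simp] theorem reflect_infty : reflect OnePoint.infty = ((0 : ℂ) : P1) := by
  rw [← pt_infty 1, reflect_pt (by simp), map_zero, map_one, pt_coe]

theorem reflect_involutive : Function.Involutive reflect := by
  intro z
  obtain ⟨p, hp, rfl⟩ := exists_pt z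
  have hp' : (starRingEnd ℂ p.2, starRingEnd ℂ p.1) ≠ 0 := by
    simpa [Prod.ext_iff, and_comm] using hp
  rw [reflect_pt hp, reflect_pt hp', Complex.conj_conj, Complex.conj_conj]

theorem coe_eq_reflect_iff {a b : ℂ} : (a : P1) = reflect b ↔ a * starRingEnd ℂ b = 1 := by
  rw [reflect_coe, ← pt_coe, pt_eq_iff (by simp) (by simp), det2, mul_one, sub_eq_zero]

theorem reflect_coe_of_norm_eq_one {a : ℂ} (h : ‖a‖ = 1) : reflect a = a := by
  refine (coe_eq_reflect_iff.2 ?_).symm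
  rw [Complex.mul_conj, Complex.normSq_eq_norm_sq, h, one_pow, Complex.ofReal_one]

/-- The real points `x i` on the unit circle, and the pairs formed by `z j` and its reflection. -/
def circlePt {K L : Type} (x : K → ℂ) (z : L → ℂ) : Mark K L → P1
  | Sum.inl i => x i
  | Sum.inr (j, true) => z j
  | Sum.inr (j, false) => reflect (z j)

theorem circlePt_conj {K L : Type} {x : K → ℂ} {z : L → ℂ} (hx : ∀ i, ‖x i‖ = 1) (i : Mark K L) :
    circlePt x z (Mark.conj i) = reflect (circlePt x z i) := by
  rcases i with i | ⟨j, _ | _⟩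
  · exact (reflect_coe_of_norm_eq_one (hx i)).symm
  · exact (reflect_involutive _).symm
  · rfl

/-- The real points `x i` and the pairs determined by the points `z j` are the marked points of a
smooth stable curve: the Riemann sphere with the reflection in the unit circle. -/
structure CircleData {K L : Type} (x : K → ℂ) (z : L → ℂ) : Prop where
  norm_x : ∀ i, ‖x i‖ = 1
  inj_x : Function.Injective x
  inj_z : Function.Injective z
  mul_conj_ne : ∀ j k, z j * starRingEnd ℂ (z k) ≠ 1
  card : 3 ≤ Nat.card (Mark K L)

theorem CircleData.circlePt_injective {K L : Type} {x : K → ℂ} {z : L → ℂ} (h : CircleData x z) :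
    Function.Injective (circlePt x z) := by
  have z_ne_reflect (j k) : (z j : P1) ≠ reflect (z k) :=
    mt coe_eq_reflect_iff.1 (h.mul_conj_ne j k)
  have x_eq_reflect (i) : (x i : P1) = reflect (x i) :=
    (reflect_coe_of_norm_eq_one (h.norm_x i)).symm
  have x_ne_z (i j) : (x i : P1) ≠ z j := fun e => z_ne_reflect j j (e ▸ x_eq_reflect i)
  have x_ne_reflect (i j) : (x i : P1) ≠ reflect (z j) := fun e =>
    x_ne_z i j (reflect_involutive.injective ((x_eq_reflect i).symm.trans e))
  rintro (i | ⟨i, _ | _⟩) (j | ⟨j, _ | _⟩) e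
  · rw [h.inj_x (OnePoint.coe_injective e)]
  · exact absurd e (x_ne_reflect i j)
  · exact absurd e (x_ne_z i j)
  · exact absurd e.symm (x_ne_reflect j i)
  · rw [h.inj_z (OnePoint.coe_injective (reflect_involutive.injective e))]
  · exact absurd e.symm (z_ne_reflect j i)
  · exact absurd e.symm (x_ne_z j i)
  · exact absurd e (z_ne_reflect i j)
  · rw [h.inj_z (OnePoint.coe_injective e)]

/-- The sphere with the reflection in the unit circle. -/
def sphereTree : RealTree where
  n := 1
  graph := SimpleGraph.starGraph 0
  isTree := SimpleGraph.isTree_starGraph 0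
  dir _ _ := OnePoint.infty
  dir_branch _ _ _ _ _ _ := rfl
  dir_inj _ _ _ _ _ _ := Subsingleton.elim _ _
  inv v := v
  sig _ := reflect
  inv_inv _ := rfl
  inv_adj _ _ h := h
  sig_antiholomorphic _ := ⟨_, fun _ => rfl⟩
  sig_sig _ := reflect_involutive
  sig_dir v w h := absurd (Subsingleton.elim v w) h.ne
  fixed := Or.inl ⟨0, (1 : ℂ), rfl, reflect_coe_of_norm_eq_one norm_one⟩

theorem sphereTree_not_adj (v w : Fin sphereTree.n) : ¬ sphereTree.graph.Adj v w :=
  fun h => h.ne (Subsingleton.elim (α := Fin 1) v w)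

/-- The smooth curve given by `x` and `z`. -/
def circleMarking {K L : Type} {x : K → ℂ} {z : L → ℂ} (h : CircleData x z) :
    Marking sphereTree K L where
  comp _ := (0 : Fin 1)
  pos := circlePt x z
  pos_inj _ _ _ e := h.circlePt_injective e
  pos_ne_node _ _ hw := absurd hw (sphereTree_not_adj _ _)
  stable v := by
    have card_range : 3 ≤ (Set.range (circlePt x z)).ncard := by
      rw [← Set.image_univ, Set.ncard_image_of_injective _ h.circlePt_injective, Set.ncard_univ]
      exact h.card
    refine card_range.trans (le_of_eq (congrArg Set.ncard (Set.Subset.antisymm ?_ ?_)))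
    · rintro _ ⟨i, rfl⟩
      exact Or.inr ⟨i, Subsingleton.elim (α := Fin 1) _ _, rfl⟩
    · rintro p (⟨w, hw, -⟩ | ⟨i, -, rfl⟩)
      · exact absurd hw (sphereTree_not_adj _ _)
      · exact ⟨i, rfl⟩
  comp_conj _ := rfl
  pos_conj := circlePt_conj h.norm_x

theorem three_le_ncard_special {ι κ α : Type*} [Finite ι] [Finite κ] {P : ι → Prop} {d : ι → α}
    {Q : κ → Prop} {p : κ → α} {a b c : α} (hab : a ≠ b) (hac : a ≠ c) (hbc : b ≠ c)
    (ha : a ∈ {z | ∃ w, P w ∧ d w = z} ∪ {z | ∃ i, Q i ∧ p i = z})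
    (hb : b ∈ {z | ∃ w, P w ∧ d w = z} ∪ {z | ∃ i, Q i ∧ p i = z})
    (hc : c ∈ {z | ∃ w, P w ∧ d w = z} ∪ {z | ∃ i, Q i ∧ p i = z}) :
    3 ≤ ({z | ∃ w, P w ∧ d w = z} ∪ {z | ∃ i, Q i ∧ p i = z}).ncard :=
  (Set.two_lt_ncard_iff ((Set.toFinite (d '' {w | P w})).union (Set.toFinite (p '' {i | Q i})))).2
    ⟨a, b, c, ha, hb, hc, hab, hac, hbc⟩

/-- Two real spheres, joined at the point `a` of the first one and `1` of the second one. -/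
def twoTree {a : ℂ} (ha : ‖a‖ = 1) : RealTree where
  n := 2
  graph := SimpleGraph.starGraph 0
  isTree := SimpleGraph.isTree_starGraph 0
  dir v _ := ((![a, 1] v : ℂ) : P1)
  dir_branch _ _ _ _ _ _ := rfl
  dir_inj v u w hu hw _ := by
    have := hu.ne
    have := hw.ne
    omega
  inv v := v
  sig _ := reflect
  inv_inv _ := rfl
  inv_adj _ _ h := h
  sig_antiholomorphic _ := ⟨_, fun _ => rfl⟩
  sig_sig _ := reflect_involutive
  sig_dir v w h := reflect_coe_of_norm_eq_one (by fin_cases v <;> simp [ha])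
  fixed := Or.inl ⟨0, (1 : ℂ), rfl, reflect_coe_of_norm_eq_one norm_one⟩

/-- The components of the marked points of `twoMarking`. -/
def twoComp : Mark (Fin 1) (Fin 2) → Fin 2
  | Sum.inl _ => 0
  | Sum.inr (j, _) => j

/-- The real point at `ξ` and the first pair at `0`, `∞` on the first sphere, the second pair at
`0`, `∞` on the second sphere. -/
def twoMarking {a ξ : ℂ} (ha : ‖a‖ = 1) (hξ : ‖ξ‖ = 1) (h : a ≠ ξ) :
    Marking (twoTree ha) (Fin 1) (Fin 2) where
  comp := twoComp
  pos := circlePt (fun _ => ξ) (fun _ => 0)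
  pos_inj := by
    have ξ_ne : ξ ≠ 0 := ne_zero_of_norm_ne_zero (by simp [hξ])
    rintro (i | ⟨i, _ | _⟩) (j | ⟨j, _ | _⟩) hc hp
    · rw [Subsingleton.elim i j]
    all_goals first
      | simp [circlePt, ξ_ne, ξ_ne.symm] at hp; done
      | rw [show i = j from hc]
  pos_ne_node := by
    have a_ne : a ≠ 0 := ne_zero_of_norm_ne_zero (by simp [ha])
    rintro (i | ⟨i, _ | _⟩) w hw e
    · simp [twoTree, twoComp, circlePt, h.symm] at e
    · fin_cases i <;> simp [twoTree, twoComp, circlePt] at e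
    · fin_cases i <;> simp [twoTree, twoComp, circlePt, a_ne.symm] at e
  stable v := by
    have a_ne : a ≠ 0 := ne_zero_of_norm_ne_zero (by simp [ha])
    change Fin 2 at v
    have hadj : (twoTree ha).graph.Adj v (v + 1 : Fin 2) := by
      simp only [twoTree, SimpleGraph.starGraph_adj]
      omega
    refine three_le_ncard_special (a := (twoTree ha).dir v (v + 1 : Fin 2)) (b := ((0 : ℂ) : P1))
      (c := OnePoint.infty) ?_ (OnePoint.coe_ne_infty _) (OnePoint.coe_ne_infty _)
      (Or.inl ⟨_, hadj, rfl⟩) (Or.inr ⟨Sum.inr (v, true), rfl, rfl⟩)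
      (Or.inr ⟨Sum.inr (v, false), rfl, reflect_zero⟩)
    fin_cases v <;> simp [twoTree, a_ne]
  comp_conj := by rintro (i | ⟨j, b⟩) <;> rfl
  pos_conj := circlePt_conj fun _ => hξ

/-- A real sphere joined at `0` and `∞` to two conjugate spheres. -/
def threeTree : RealTree where
  n := 3
  graph := SimpleGraph.starGraph 1
  isTree := SimpleGraph.isTree_starGraph 1
  dir v w := if v = 1 ∧ w = 0 then ((0 : ℂ) : P1) else OnePoint.infty
  dir_branch v u w h hu hw := by
    simp only [SimpleGraph.starGraph_adj] at h
    split_ifs <;> first | rfl | omega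
  dir_inj v u w hu hw e := by
    simp only [SimpleGraph.starGraph_adj] at hu hw
    split_ifs at e <;> first | omega | simp at e
  inv := Fin.rev
  sig v := if v = 1 then reflect else P1.conj
  inv_inv := Fin.rev_rev
  inv_adj v w h := by
    simp only [SimpleGraph.starGraph_adj] at h ⊢
    revert v w
    decide
  sig_antiholomorphic v := by
    split_ifs
    · exact ⟨_, fun _ => rfl⟩
    · exact ⟨1, fun z => (one_smul _ _).symm⟩
  sig_sig v z := by
    fin_cases v
    · simp
    · simpa [Fin.rev] using reflect_involutive z
    · simp
  sig_dir v w h := by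
    simp only [SimpleGraph.starGraph_adj] at h
    fin_cases v <;> fin_cases w <;> simp [Fin.rev] at h ⊢
  fixed := Or.inl ⟨1, (1 : ℂ), rfl, by simpa using reflect_coe_of_norm_eq_one norm_one⟩

/-- Whether the point with index `j` and sign `c` lies on the same component as `z_1⁺`, when the
point of the second pair with sign `b` does. -/
def side (b : Bool) (j : Fin 2) (c : Bool) : Bool := if j = 0 then c else c == b

/-- The components of the marked points of `threeMarking`. -/
def threeComp (b : Bool) : Mark (Fin 1) (Fin 2) → Fin 3
  | Sum.inl _ => 1
  | Sum.inr (j, c) => if side b j c then 0 else 2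

theorem threeComp_inr_ne_one (b : Bool) (j : Fin 2) (c : Bool) :
    threeComp b (Sum.inr (j, c)) ≠ 1 := by
  revert b j c; decide

theorem threeComp_inr_injective (b : Bool) (j : Fin 2) :
    Function.Injective fun c => threeComp b (Sum.inr (j, c)) := by
  revert b j
  decide

/-- The marking with the real point on the real component, and `z_1⁺` and the point of the second
pair with sign `b` on another one. The points of the `j`-th pair are at `j`, for `j = 0, 1`. -/
def threeMarking (b : Bool) : Marking threeTree (Fin 1) (Fin 2) where
  comp := threeComp b
  pos
    | Sum.inl _ => (1 : ℂ)
    | Sum.inr (j, _) => ((j : ℕ) : ℂ)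
  pos_inj := by
    rintro (i | ⟨i, c⟩) (j | ⟨j, d⟩) hc hp
    · rw [Subsingleton.elim i j]
    · exact absurd hc.symm (threeComp_inr_ne_one _ _ _)
    · exact absurd hc (threeComp_inr_ne_one _ _ _)
    · obtain rfl : i = j := Fin.val_injective (Nat.cast_injective (OnePoint.coe_injective hp))
      rw [threeComp_inr_injective b i hc]
  pos_ne_node := by
    rintro (i | ⟨i, c⟩) w -
    · simp only [threeTree]
      split_ifs <;> simp
    · simp [threeTree, threeComp_inr_ne_one]
  stable v := by
    refine three_le_ncard_special (a := ((0 : ℂ) : P1)) (b := ((1 : ℂ) : P1)) (c := OnePoint.infty)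
      (by simp) (by simp) (by simp) ?_ ?_ ?_ <;> change Fin 3 at v <;> fin_cases v
    · exact Or.inr ⟨Sum.inr (0, true), rfl, by simp⟩
    · exact Or.inl ⟨(0 : Fin 3), by simp [threeTree], by simp [threeTree]⟩
    · exact Or.inr ⟨Sum.inr (0, false), rfl, by simp⟩
    · exact Or.inr ⟨Sum.inr (1, b), by cases b <;> rfl, by simp⟩
    · exact Or.inr ⟨Sum.inl 0, rfl, rfl⟩
    · exact Or.inr ⟨Sum.inr (1, !b), by cases b <;> rfl, by simp⟩
    · exact Or.inl ⟨(1 : Fin 3), by simp [threeTree], by simp [threeTree]⟩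
    · exact Or.inl ⟨(2 : Fin 3), by simp [threeTree], by simp [threeTree]⟩
    · exact Or.inl ⟨(1 : Fin 3), by simp [threeTree], by simp [threeTree]⟩
  comp_conj := by
    rintro (i | ⟨j, c⟩)
    · rfl
    · change threeComp b (Sum.inr (j, !c)) = Fin.rev (threeComp b (Sum.inr (j, c)))
      revert j b c; decide
  pos_conj := by
    rintro (_ | ⟨j, c⟩)
    · exact (reflect_coe_of_norm_eq_one norm_one).symm
    · simp [threeTree, threeComp_inr_ne_one, Mark.conj]

/-- Two conjugate spheres. -/
def conjTree : RealTree where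
  n := 2
  graph := SimpleGraph.starGraph 0
  isTree := SimpleGraph.isTree_starGraph 0
  dir _ _ := OnePoint.infty
  dir_branch _ _ _ _ _ _ := rfl
  dir_inj v u w hu hw _ := by
    have := hu.ne
    have := hw.ne
    omega
  inv := Fin.rev
  sig _ := P1.conj
  inv_inv := Fin.rev_rev
  inv_adj v w h := by
    simp only [SimpleGraph.starGraph_adj] at h ⊢
    revert v w
    decide
  sig_antiholomorphic _ := ⟨1, fun z => (one_smul _ _).symm⟩
  sig_sig _ := P1.conj_conj
  sig_dir _ _ _ := P1.conj_infty
  fixed := Or.inr ⟨0, 1, by simp, rfl⟩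

/-- The components of the marked points of `conjMarking`. -/
def conjComp {K : Type} [IsEmpty K] (b : Bool) : Mark K (Fin 2) → Fin 2
  | Sum.inl i => isEmptyElim i
  | Sum.inr (j, c) => if side b j c then 0 else 1

/-- The marking with `z_1⁺` and the point of the second pair with sign `b` on one sphere and their
conjugates on the other one. The points of the `j`-th pair are at `j`, for `j = 0, 1`. -/
def conjMarking (K : Type) [IsEmpty K] (b : Bool) : Marking conjTree K (Fin 2) where
  comp := conjComp b
  pos
    | Sum.inl i => isEmptyElim i
    | Sum.inr (j, _) => ((j : ℕ) : ℂ)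
  pos_inj := by
    rintro (i | ⟨i, c⟩) (j | ⟨j, d⟩) hc hp
    · exact isEmptyElim i
    · exact isEmptyElim i
    · exact isEmptyElim j
    · obtain rfl : i = j := Fin.val_injective (Nat.cast_injective (OnePoint.coe_injective hp))
      obtain rfl : c = d := by
        change (if side b i c then (0 : Fin 2) else 1) = if side b i d then 0 else 1 at hc
        clear hp
        revert b i c d; decide
      rfl
  pos_ne_node := by
    rintro (i | ⟨i, c⟩) w -
    · exact isEmptyElim i
    · exact OnePoint.coe_ne_infty _
  stable v := by
    refine three_le_ncard_special (a := ((0 : ℂ) : P1)) (b := ((1 : ℂ) : P1)) (c := OnePoint.infty)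
      (by simp) (by simp) (by simp) ?_ ?_
      (Or.inl ⟨Fin.rev v, by revert v; simp [conjTree, Fin.forall_fin_two], rfl⟩) <;>
      change Fin 2 at v <;> fin_cases v
    · exact Or.inr ⟨Sum.inr (0, true), rfl, by simp⟩
    · exact Or.inr ⟨Sum.inr (0, false), rfl, by simp⟩
    · exact Or.inr ⟨Sum.inr (1, b), by cases b <;> rfl, by simp⟩
    · exact Or.inr ⟨Sum.inr (1, !b), by cases b <;> rfl, by simp⟩
  comp_conj := by
    rintro (i | ⟨j, c⟩)
    · exact isEmptyElim i
    · change (if side b j (!c) then (0 : Fin 2) else 1) = Fin.rev (if side b j c then 0 else 1)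
      revert j b c; decide
  pos_conj := by
    rintro (i | ⟨j, c⟩)
    · exact isEmptyElim i
    · simp [conjTree, Mark.conj]

/-! ### Coordinates of the explicit curves -/

theorem isP_three (b : Bool) : IsP b (Moduli.mk threeTree (threeMarking b)) :=
  ⟨threeTree, threeMarking b, rfl, rfl, by
    change threeComp b (Sum.inr (0, true)) = threeComp b (Sum.inr (1, b))
    revert b; decide⟩

theorem threeMarking_seen_inr (b : Bool) (j : Fin 2) (c : Bool) :
    (threeMarking b).seen (1 : Fin 3) (Sum.inr (j, c)) =
      if side b j c then ((0 : ℂ) : P1) else OnePoint.infty := by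
  refine ((threeMarking b).seen_of_comp_ne (v := (1 : Fin 3)) (i := Sum.inr (j, c))
    (threeComp_inr_ne_one b j c)).trans ?_
  cases h : side b j c <;> simp [threeTree, threeMarking, threeComp, h]

theorem hasCoord_three (b : Bool) :
    HasCoord (Moduli.mk threeTree (threeMarking b)) (if b then 0 else 1) := by
  have seen_inl : (threeMarking b).seen (1 : Fin 3) (Sum.inl 0) = ((1 : ℂ) : P1) :=
    Marking.seen_of_comp_eq _ rfl
  rw [HasCoord, (threeMarking b).crossRatio_eq_pt_of_det (v := (1 : Fin 3)) (g := 1)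
    (p := ![(0, 1), (1, 0), (1, 1), if b then (0, 1) else (1, 0)])]
  · cases b <;> simp [cr, det2, pt]
  · cases b <;> simp [Fin.forall_fin_succ]
  · cases b <;>
      simp [Fin.forall_fin_succ, chartMarks, threeMarking_seen_inr, seen_inl, side, pt]
  all_goals simp [det2]

theorem circleData_smooth {ξ ζ : ℂ} (hξ : ‖ξ‖ = 1) (h0 : ζ ≠ 0) (h1 : ‖ζ‖ ≠ 1) {K : Type}
    [Finite K] [Subsingleton K] : CircleData (fun _ : K => ξ) (![0, ζ] : Fin 2 → ℂ) where
  norm_x _ := hξ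
  inj_x := Function.injective_of_subsingleton _
  inj_z := by
    intro i j
    fin_cases i <;> fin_cases j <;> simp [h0, h0.symm]
  mul_conj_ne := by
    have norm_sq_ne : ζ * starRingEnd ℂ ζ ≠ 1 := fun e => h1 <| by
      have : ‖ζ‖ ^ 2 = 1 := by simpa [pow_two] using congrArg norm e
      exact (pow_eq_one_iff_of_nonneg (norm_nonneg _) two_ne_zero).1 this
    intro i j
    fin_cases i <;> fin_cases j <;> simp [norm_sq_ne]
  card := by
    have : Nat.card (Mark K (Fin 2)) = Nat.card K + 4 := by
      rw [Nat.card_sum, Nat.card_prod]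
      simp
    lia

theorem isSmoothing_smooth {ζ : ℂ} (h0 : ζ ≠ 0) (h1 : ‖ζ‖ ≠ 1) :
    IsSmoothing true ζ (Moduli.mk sphereTree
      (circleMarking (circleData_smooth (K := Fin 1) (norm_one (α := ℂ)) h0 h1))) := by
  refine ⟨_, _, rfl, rfl, rfl, rfl, reflect_zero, rfl, ?_⟩
  simp [circleMarking, circlePt, reflect_coe, pt, h0]

theorem exists_isSmoothing (b : Bool) {ζ : ℂ} (h0 : ζ ≠ 0) (h1 : ‖ζ‖ ≠ 1) :
    ∃ m, IsSmoothing b ζ m := by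
  cases b
  · have h0' : (starRingEnd ℂ ζ)⁻¹ ≠ 0 := by simpa using h0
    have h1' : ‖(starRingEnd ℂ ζ)⁻¹‖ ≠ 1 := by simpa using h1
    obtain ⟨T, μ, -, hn, hx, hz, hz', hy, hy'⟩ := isSmoothing_smooth h0' h1'
    exact ⟨_, T, μ, rfl, hn, hx, hz, hz', by simpa using hy', hy⟩
  · exact ⟨_, isSmoothing_smooth h0 h1⟩

theorem exists_rotation_smooth {ζ : ℂ} (h0 : ζ ≠ 0) (h1 : ‖ζ‖ ≠ 1) :
    ∃ m, IsRotation 0 0 m ∧ HasCoord (m 0) (ζ / (ζ - 1)) := by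
  have hζ1 : ζ ≠ 1 := by
    rintro rfl
    simp at h1
  let μ (θ : ℝ) := circleMarking
    (circleData_smooth (K := Fin 1) (Complex.norm_exp_ofReal_mul_I θ) h0 h1)
  refine ⟨fun θ => Moduli.mk sphereTree (μ θ), ⟨sphereTree, μ, (0 : Fin 1), 1,
    Filter.Eventually.of_forall fun θ => ⟨rfl, rfl, ?_, rfl, rfl, ?_, ?_, ?_⟩⟩, ?_⟩
  · rintro (j | j) hj
    · exact absurd (congrArg Sum.inl (Subsingleton.elim j 0)) hj
    · rcases j with ⟨j, _ | _⟩ <;> rfl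
  · simp [μ, circleMarking, circlePt]
  · simp [μ, circleMarking, circlePt]
  · simp [μ, circleMarking, circlePt]
  · change HasCoord _ (smoothingCoord true ζ)
    convert (isSmoothing_smooth h0 h1).hasCoord h0 hζ1 using 4
    simp

/-- The curve with two real components given by `twoMarking`. -/
def twoCurve {a ξ : ℂ} (ha : ‖a‖ = 1) (hξ : ‖ξ‖ = 1) (h : a ≠ ξ) : Moduli (Fin 1) (Fin 2) :=
  Moduli.mk (twoTree ha) (twoMarking ha hξ h)

theorem hasCoord_two {a ξ : ℂ} (ha : ‖a‖ = 1) (hξ : ‖ξ‖ = 1) (h : a ≠ ξ) :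
    HasCoord (twoCurve ha hξ h) (a / (a - ξ)) := by
  have hξ0 : ξ ≠ 0 := ne_zero_of_norm_ne_zero (by simp [hξ])
  rw [HasCoord, twoCurve, (twoMarking ha hξ h).crossRatio_eq_pt_of_det (v := (0 : Fin 2)) (g := 1)
    (p := ![(0, 1), (1, 0), (ξ, 1), (a, 1)])]
  · simp [cr, det2, pt, sub_ne_zero.2 h]
  · simp [Fin.forall_fin_succ]
  · simp [Fin.forall_fin_succ, chartMarks, Marking.seen, twoMarking, twoComp, twoTree, circlePt, pt]
  all_goals simp [det2, hξ0]

theorem twoCurve_mem_stratum {a ξ : ℂ} (ha : ‖a‖ = 1) (hξ : ‖ξ‖ = 1) (h : a ≠ ξ) :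
    twoCurve ha hξ h ∈ stratum Set.univ {0} :=
  ⟨_, _, rfl, rfl, fun _ => rfl, (0 : Fin 2), fun _ => ⟨fun _ => trivial, fun _ => rfl⟩,
    fun _ _ => Iff.rfl⟩

theorem exists_unit_rotation :
    ∃ a : ℝ → ℂ, (∀ θ, ‖a θ‖ = 1) ∧ (∀ θ, a θ ≠ -1) ∧ a 0 = 1 ∧
      ∀ᶠ θ in nhds 0, a θ = Complex.exp (θ * Complex.I) := by
  classical
  refine ⟨fun θ => if Complex.exp (θ * Complex.I) = -1 then 1 else Complex.exp (θ * Complex.I),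
    fun θ => ?_, fun θ => ?_, by norm_num, ?_⟩
  · dsimp only
    split_ifs
    exacts [norm_one, Complex.norm_exp_ofReal_mul_I θ]
  · dsimp only
    split_ifs with h
    exacts [by norm_num, h]
  · filter_upwards [hasDerivAt_exp_mul_I.continuousAt.eventually_ne
      (show Complex.exp ((0 : ℝ) * Complex.I) ≠ -1 by norm_num)] with θ hθ
    exact if_neg hθ

theorem norm_neg_one_eq_one : ‖(-1 : ℂ)‖ = 1 := by simp

theorem exists_rotation_two : ∃ m, IsRotation 0 0 m ∧ HasCoord (m 0) (1 / 2) := by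
  obtain ⟨ξ, norm_ξ, ξ_ne, ξ_zero, ξ_eq⟩ := exists_unit_rotation
  let μ (θ : ℝ) := twoMarking norm_neg_one_eq_one (norm_ξ θ) (ξ_ne θ).symm
  refine ⟨fun θ => Moduli.mk _ (μ θ), ⟨_, μ, (0 : Fin 2), 1, ?_⟩, ?_⟩
  · filter_upwards [ξ_eq] with θ hθ
    refine ⟨rfl, rfl, ?_, rfl, rfl, ?_, ?_, ?_⟩
    · rintro (j | j) hj
      · exact absurd (congrArg Sum.inl (Subsingleton.elim j 0)) hj
      · rcases j with ⟨j, _ | _⟩ <;> rfl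
    · simp [μ, twoMarking, circlePt]
    · simp [μ, twoMarking, circlePt]
    · simp [μ, twoMarking, circlePt, hθ]
  · have coord_eq : (-1 : ℂ) / (-1 - ξ 0) = 1 / 2 := by norm_num [ξ_zero]
    exact coord_eq ▸ hasCoord_two norm_neg_one_eq_one (norm_ξ 0) (ξ_ne 0).symm

/-! ### Gluing of the explicit curves -/

theorem circleData_first {a ξ : ℂ} (ha : ‖a‖ = 1) (hξ : ‖ξ‖ = 1) (h : a ≠ ξ) :
    CircleData (fun i : Option (Set.univ : Set (Fin 1)) => i.elim a fun _ => ξ)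
      (fun _ : ({0} : Set (Fin 2)) => 0) where
  norm_x := by rintro (_ | i) <;> simp [ha, hξ]
  inj_x := by
    rintro (_ | i) (_ | j) e
    · rfl
    · exact absurd e h
    · exact absurd e.symm h
    · rw [Subsingleton.elim i j]
  inj_z := Function.injective_of_subsingleton _
  mul_conj_ne := by simp
  card := by
    rw [Nat.card_sum, Nat.card_prod]
    simp

instance : Unique (Option ↥((Set.univ : Set (Fin 1))ᶜ)) where
  default := none
  uniq
    | none => rfl
    | some i => absurd trivial i.2

instance : Unique ↥(({0} : Set (Fin 2))ᶜ) where
  default := ⟨1, one_ne_zero⟩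
  uniq i := Subtype.ext (by have : i.1 ≠ 0 := i.2; change i.1 = 1; omega)

theorem circleData_unique {K L : Type} [Unique K] [Unique L] :
    CircleData (fun _ : K => (1 : ℂ)) (fun _ : L => 0) where
  norm_x _ := norm_one
  inj_x := Function.injective_of_subsingleton _
  inj_z := Function.injective_of_subsingleton _
  mul_conj_ne := by simp
  card := by
    rw [Nat.card_sum, Nat.card_prod]
    simp

theorem glue_two {a ξ : ℂ} (ha : ‖a‖ = 1) (hξ : ‖ξ‖ = 1) (h : a ≠ ξ) :
    Glue Set.univ {0} (Moduli.mk sphereTree (circleMarking (circleData_first ha hξ h)))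
      (Moduli.mk sphereTree (circleMarking circleData_unique)) (twoCurve ha hξ h) := by
  refine ⟨_, _, _, _, _, _, rfl, rfl, rfl, (finSumFinEquiv : Fin 1 ⊕ Fin 1 ≃ Fin 2), ?_, ?_, ?_,
    fun v w h => absurd h (sphereTree_not_adj v w), fun v w h => absurd h (sphereTree_not_adj v w),
    rfl, rfl, fun _ => rfl, fun _ => rfl, fun _ => rfl, fun _ => rfl, fun _ => ⟨rfl, rfl⟩, ?_,
    fun i => absurd trivial i.2, ?_⟩
  · intro v w
    rw [Subsingleton.elim (α := Fin 1) v w]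
    exact ⟨fun h => absurd rfl h.ne, fun h => absurd rfl h.ne⟩
  · intro v w
    rw [Subsingleton.elim (α := Fin 1) v w]
    exact ⟨fun h => absurd rfl h.ne, fun h => absurd rfl h.ne⟩
  · intro v w
    rw [Subsingleton.elim (α := Fin 1) v (0 : Fin 1), Subsingleton.elim (α := Fin 1) w (0 : Fin 1)]
    refine ⟨fun _ => ⟨rfl, rfl⟩, fun _ => ?_⟩
    change (SimpleGraph.starGraph (0 : Fin 2)).Adj 0 1
    simp
  · rintro ⟨j, rfl⟩ (_ | _) <;> exact ⟨rfl, rfl⟩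
  · intro j b
    rw [Unique.eq_default j]
    cases b <;> exact ⟨rfl, rfl⟩

theorem exists_rotation_node :
    ∃ (m₁ : ℝ → Moduli (Option (Set.univ : Set (Fin 1))) ({0} : Set (Fin 2)))
    (m : ℝ → Moduli (Fin 1) (Fin 2)), IsRotation ⟨0, rfl⟩ none m₁ ∧
    (∀ θ, Glue Set.univ {0} (m₁ θ) (Moduli.mk sphereTree (circleMarking circleData_unique)) (m θ)) ∧
    (∀ θ, m θ ∈ stratum Set.univ {0}) ∧ HasCoord (m 0) (1 / 2) := by
  obtain ⟨a, norm_a, a_ne, a_zero, a_eq⟩ := exists_unit_rotation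
  let μ (θ : ℝ) := circleMarking (circleData_first (norm_a θ) norm_neg_one_eq_one (a_ne θ))
  refine ⟨fun θ => Moduli.mk _ (μ θ), fun θ => twoCurve (norm_a θ) norm_neg_one_eq_one (a_ne θ),
    ⟨_, μ, (0 : Fin 1), 1, ?_⟩, fun θ => glue_two _ _ _, fun θ => twoCurve_mem_stratum _ _ _, ?_⟩
  · filter_upwards [a_eq] with θ hθ
    refine ⟨rfl, rfl, ?_, rfl, rfl, ?_, ?_, ?_⟩
    · rintro ((_ | j) | ⟨j, _ | _⟩) hj
      · exact absurd rfl hj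
      all_goals rfl
    · simp [μ, circleMarking, circlePt]
    · simp [μ, circleMarking, circlePt]
    · simp [μ, circleMarking, circlePt, hθ]
  · convert hasCoord_two (norm_a 0) norm_neg_one_eq_one (a_ne 0) using 1
    norm_num [a_zero]

/-! ### Curves are determined by their cross-ratios -/

theorem RealTree.adj_iff_dir_eq {T : RealTree} {v w : Fin T.n} :
    T.graph.Adj v w ↔ v ≠ w ∧ ∀ u, v ≠ u → w ≠ u → T.dir u v = T.dir u w := by
  refine ⟨fun h => ⟨h.ne, fun u hv hw => T.dir_branch u v w h hv hw⟩, fun ⟨hvw, h⟩ => ?_⟩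
  obtain ⟨u, hu, hd⟩ := RealTree.exists_adj_dir hvw.symm
  by_cases huw : w = u
  · exact huw ▸ hu
  · exact absurd (h u hu.ne huw).symm (RealTree.dir_ne_of_dir_eq hu hvw.symm huw hd)

namespace Marking

section

variable {T : RealTree} {K L : Type} (μ : Marking T K L)

theorem exists_seen_eq_of_mem_special {v : Fin T.n} {z : P1} (hz : z ∈ μ.special v) :
    ∃ i, μ.seen v i = z := by
  obtain ⟨w, hw, rfl⟩ | ⟨i, hi, rfl⟩ := hz
  · obtain ⟨i, -, -, hi, -⟩ := μ.exists_two_marks hw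
    exact ⟨i, hi⟩
  · exact ⟨i, μ.seen_of_comp_eq hi⟩

theorem exists_separated (v : Fin T.n) : ∃ i j k, μ.Separates v i j k := by
  obtain ⟨a, ha, b, hb, c, hc, hab, hac, hbc⟩ := μ.exists_three_special v
  obtain ⟨i, rfl⟩ := μ.exists_seen_eq_of_mem_special ha
  obtain ⟨j, rfl⟩ := μ.exists_seen_eq_of_mem_special hb
  obtain ⟨k, rfl⟩ := μ.exists_seen_eq_of_mem_special hc
  exact ⟨i, j, k, hab, hac, hbc⟩

theorem exists_seen_eq_dir_of_ne {v w : Fin T.n} (h : v ≠ w) :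
    ∃ i j, μ.seen v i = T.dir v w ∧ μ.seen v j = T.dir v w ∧ μ.seen w i ≠ μ.seen w j := by
  obtain ⟨a, ha, b, hb, ha', hb', hab⟩ := μ.exists_two_special_ne w (T.dir w v)
  obtain ⟨i, rfl⟩ := μ.exists_seen_eq_of_mem_special ha
  obtain ⟨j, rfl⟩ := μ.exists_seen_eq_of_mem_special hb
  exact ⟨i, j, μ.seen_of_seen_ne h.symm ha', μ.seen_of_seen_ne h.symm hb', hab⟩

end

variable {T T' : RealTree} {K L : Type} {μ : Marking T K L} {μ' : Marking T' K L}

theorem Separates.congr {v : Fin T.n} {v' : Fin T'.n} {g : GL (Fin 2) ℂ}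
    (h : ∀ i, μ'.seen v' i = g • μ.seen v i) {i j k : Mark K L} :
    μ'.Separates v' i j k ↔ μ.Separates v i j k := by
  simp only [Separates, h, ne_eq, smul_left_cancel_iff]

section

variable {f : Fin T.n → Fin T'.n} {g : Fin T.n → GL (Fin 2) ℂ}

theorem dir_eq_smul_of_seen (hf : Function.Injective f)
    (h : ∀ v i, μ'.seen (f v) i = g v • μ.seen v i) {v w : Fin T.n} (hvw : v ≠ w) :
    T'.dir (f v) (f w) = g v • T.dir v w := by
  obtain ⟨i, j, hi, hj, hij⟩ := μ.exists_seen_eq_dir_of_ne hvw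
  have hij' : μ'.seen (f w) i ≠ μ'.seen (f w) j := by
    rwa [h, h, ne_eq, smul_left_cancel_iff]
  by_cases hi' : μ'.seen (f w) i = T'.dir (f w) (f v)
  · rw [← hj, ← h, μ'.seen_of_seen_ne (hf.ne hvw.symm) (hi' ▸ hij'.symm)]
  · rw [← hi, ← h, μ'.seen_of_seen_ne (hf.ne hvw.symm) hi']

theorem iso_of_seen (hf : Function.Bijective f)
    (h : ∀ v i, μ'.seen (f v) i = g v • μ.seen v i) : Iso ⟨T, μ⟩ ⟨T', μ'⟩ := by
  have dir_eq {v w : Fin T.n} (hvw : v ≠ w) := dir_eq_smul_of_seen hf.injective h hvw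
  have comp_eq (i) : μ'.comp i = f (μ.comp i) := μ'.comp_eq_of_seen_ne fun j hj => by
    rw [h, h, ne_eq, smul_left_cancel_iff]
    exact (μ.seen_ne_of_comp_eq rfl hj.symm).symm
  refine iso_of_marked (Equiv.ofBijective f hf) g (fun v w => ?_) (fun v w hvw => dir_eq hvw.ne)
    (fun v => ?_) comp_eq fun i => ?_
  · simp only [RealTree.adj_iff_dir_eq, Equiv.ofBijective_apply, hf.surjective.forall,
      hf.injective.ne_iff]
    refine and_congr_right fun _ => forall₃_congr fun u hv hw => ?_
    rw [dir_eq hv.symm, dir_eq hw.symm, smul_left_cancel_iff]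
  · obtain ⟨i, j, k, hs⟩ := μ.exists_separated v
    exact ((Separates.congr (h v)).2 hs).conj.unique ((Separates.congr (h _)).2 hs.conj)
  · have := h (μ.comp i) i
    rwa [μ.seen_of_comp_eq rfl, μ'.seen_of_comp_eq (comp_eq i)] at this

end

theorem exists_seen_eq_smul
    (h : ∀ q, (Moduli.mk T μ).crossRatio q = (Moduli.mk T' μ').crossRatio q) (v : Fin T.n) :
    ∃ (v' : Fin T'.n) (g : GL (Fin 2) ℂ), ∀ i, μ'.seen v' i = g • μ.seen v i := by
  obtain ⟨i, j, k, hs⟩ := μ.exists_separated v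
  have hij : i ≠ j := fun e => hs.1 (e ▸ rfl)
  have hik : i ≠ k := fun e => hs.2.1 (e ▸ rfl)
  have hjk : j ≠ k := fun e => hs.2.2 (e ▸ rfl)
  obtain ⟨v', hs'⟩ := μ'.exists_separates hij hik hjk
  obtain ⟨g, g0, g1, g2⟩ := hs.exists_smul
  obtain ⟨g', g0', g1', g2'⟩ := hs'.exists_smul
  refine ⟨v', g'⁻¹ * g, fun l => ?_⟩
  rw [mul_smul, eq_inv_smul_iff]
  by_cases hi : l = i
  · rw [hi, g0, g0']
  by_cases hj : l = j
  · rw [hj, g1, g1']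
  by_cases hk : l = k
  · rw [hk, g2, g2']
  let q : Fin 4 ↪ Mark K L := ⟨![i, j, k, l], by
    intro a b
    fin_cases a <;> fin_cases b <;> simp [*, Ne.symm hij, Ne.symm hik, Ne.symm hjk, Ne.symm hi,
      Ne.symm hj, Ne.symm hk]⟩
  have hq : (Moduli.mk T μ).crossRatio q = g • μ.seen v l :=
    (μ.crossRatio_mk_iff).2 ⟨v, g, g0, g1, g2, rfl⟩
  have hq' : (Moduli.mk T' μ').crossRatio q = g' • μ'.seen v' l :=
    (μ'.crossRatio_mk_iff).2 ⟨v', g', g0', g1', g2', rfl⟩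
  rw [← hq', ← h, hq]

end Marking

theorem Moduli.crossRatio_injective {K L : Type} :
    Function.Injective (Moduli.crossRatio : Moduli K L → _) := by
  intro m m' h
  obtain ⟨T, μ, rfl⟩ := m.exists_mk
  obtain ⟨T', μ', rfl⟩ := m'.exists_mk
  choose f g hf using Marking.exists_seen_eq_smul (congrFun h)
  choose f' g' hf' using Marking.exists_seen_eq_smul (congrFun h.symm)
  refine Quotient.sound (Marking.iso_of_seen (f := f) (g := g)
    (Function.bijective_iff_has_inverse.2 ⟨f', fun v => ?_, fun v' => ?_⟩) hf)
  · obtain ⟨i, j, k, hs⟩ := μ.exists_separated v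
    exact ((Marking.Separates.congr (hf' _)).2 ((Marking.Separates.congr (hf v)).2 hs)).unique hs
  · obtain ⟨i, j, k, hs⟩ := μ'.exists_separated v'
    exact ((Marking.Separates.congr (hf _)).2 ((Marking.Separates.congr (hf' v')).2 hs)).unique hs

theorem HasCoord.eq {m m' : Moduli (Fin 1) (Fin 2)} {w : ℂ} (h : HasCoord m w)
    (h' : HasCoord m' w) : m = m' :=
  Moduli.crossRatio_injective (funext fun q => (h.crossRatio q).trans (h'.crossRatio q).symm)

instance {K L : Type} [Unique K] [Unique L] : Subsingleton (Moduli K L) := by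
  have : IsEmpty (Fin 4 ↪ Mark K L) := ⟨fun q => by
    have := Nat.card_le_card_of_injective q q.injective
    simp at this⟩
  exact ⟨fun _ _ => Moduli.crossRatio_injective (Subsingleton.elim _ _)⟩

/-! ### Curves without real marked points -/

theorem RealTree.exists_fixed {T : RealTree} {v : Fin T.n} (hv : T.inv v = v) :
    ∃ z, T.sig v z = z := by
  obtain ⟨u, z, hu, hz⟩ | ⟨a, b, hab, h⟩ := T.fixed
  · by_cases huv : u = v
    · exact huv ▸ ⟨z, hz⟩
    · exact ⟨T.dir v u, by rw [RealTree.sig_dir_of_ne huv, hv, hu]⟩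
  · have ha : a ≠ v := by
      rintro rfl
      exact hab.ne (hv.symm.trans h)
    have hb : b ≠ v := by
      rintro rfl
      exact ha (by rw [← T.inv_inv a, h, hv])
    exact ⟨T.dir v a, by rw [RealTree.sig_dir_of_ne ha, hv, h, T.dir_branch _ _ _ hab ha hb]⟩

namespace Marking

variable {K : Type} {T : RealTree} {μ : Marking T K (Fin 2)} {v : Fin T.n}

theorem exists_seen_ne_dir_inv (hs : μ.Separates v (Sum.inr (0, true)) (Sum.inr (1, true))
    (Sum.inr (0, false))) (hv : T.inv v ≠ v) (j : Fin 2) :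
    ∃ b, μ.seen v (Sum.inr (j, b)) ≠ T.dir v (T.inv v) := by
  obtain ⟨h01, h00, h10⟩ := hs
  fin_cases j
  · by_contra! h
    exact h00 ((h true).trans (h false).symm)
  · refine ⟨true, fun h => ?_⟩
    have h_sig : T.sig v (T.dir v (T.inv v)) = T.dir (T.inv v) v := by
      rw [RealTree.sig_dir_of_ne hv, T.inv_inv]
    have h_conj := μ.seen_conj v (Sum.inr (0, false))
    rw [Mark.conj, Bool.not_false, μ.seen_of_seen_ne hv.symm fun e => h01 (e.trans h.symm),
      ← h_sig] at h_conj
    exact h10 (h.trans (RealTree.sig_injective v h_conj))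

theorem inv_ne_of_separates [IsEmpty K] (hs : μ.Separates v (Sum.inr (0, true)) (Sum.inr (1, true))
    (Sum.inr (0, false))) (hv : T.inv v ≠ v) (u : Fin T.n) : T.inv u ≠ u := by
  intro hu
  have huv : u ≠ v := by
    rintro rfl
    exact hv hu
  have dir_eq : T.dir v u = T.dir v (T.inv v) := by
    by_contra h
    refine h (RealTree.sig_injective v ?_)
    rw [RealTree.sig_dir_of_ne huv, RealTree.sig_dir_of_ne hv, T.inv_inv, hu]
    exact (RealTree.dir_of_dir_ne hv.symm huv h).2
  -- Seen from `u`, at most two points of the sphere are occupied, so `u` is not stable.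
  have seen_u (i) : μ.seen u i = T.dir u v ∨ μ.seen u i = T.sig u (T.dir u v) := by
    obtain i | ⟨j, c⟩ := i
    · exact isEmptyElim i
    obtain ⟨b, hb⟩ := exists_seen_ne_dir_inv hs hv j
    have hu_b := μ.seen_of_seen_ne huv.symm (dir_eq ▸ hb)
    obtain rfl | rfl : c = b ∨ c = !b := by cases b <;> cases c <;> simp
    · exact .inl hu_b
    · exact .inr (hu_b ▸ μ.seen_conj_of_inv_eq hu (Sum.inr (j, b)))
  obtain ⟨i, j, k, hij, hik, hjk⟩ := μ.exists_separated u
  have := seen_u i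
  have := seen_u j
  have := seen_u k
  grind

end Marking

theorem IsAnti.injective {s : P1 → P1} (h : IsAnti s) : Function.Injective s := by
  obtain ⟨g, hg⟩ := h
  intro x y hxy
  rw [hg, hg] at hxy
  exact P1.conj_injective (MulAction.injective g hxy)

theorem IsAnti.exists_apply_one_eq_sq {s : P1 → P1} (h : IsAnti s)
    (h0 : s ((0 : ℂ) : P1) = OnePoint.infty) (hinf : s OnePoint.infty = ((0 : ℂ) : P1)) {z : P1}
    (hz : s z = z) : ∃ β : ℝ, 0 < β ∧ s ((1 : ℂ) : P1) = ((β ^ 2 : ℂ) : P1) := by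
  obtain ⟨c, rfl⟩ : ∃ c : ℂ, (c : P1) = z := OnePoint.ne_infty_iff_exists.1 (by
    rintro rfl
    exact OnePoint.infty_ne_coe _ (hz.symm.trans hinf))
  have hc : c ≠ 0 := by
    rintro rfl
    exact OnePoint.coe_ne_infty _ (hz.symm.trans h0)
  obtain ⟨r, hr⟩ : ∃ r : ℂ, (r : P1) = s ((1 : ℂ) : P1) := OnePoint.ne_infty_iff_exists.1 (by
    rw [← h0]
    exact h.injective.ne (by simp))
  have hr0 : r ≠ 0 := by
    rintro rfl
    exact OnePoint.coe_ne_infty _ (h.injective (hr.symm.trans hinf.symm))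
  obtain ⟨k, hk⟩ := exists_anti_div hr0
  have s_eq : ∀ z, s z = k • P1.conj z := by
    refine h.eq_of_three (t := fun z => k • P1.conj z) ⟨k, fun _ => rfl⟩
      (a := ((0 : ℂ) : P1)) (b := ((1 : ℂ) : P1)) (c := OnePoint.infty)
      (by simp) (OnePoint.coe_ne_infty _) (OnePoint.coe_ne_infty _) ?_ ?_ ?_
    · rw [h0, ← pt_coe, hk _ (by simp)]
      simp [pt]
    · rw [← hr, ← pt_coe, ← pt_coe, hk _ (by simp)]
      simp [pt]
    · rw [hinf, ← pt_infty 1, hk _ (by simp)]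
      simp [pt]
  refine ⟨‖c‖, norm_pos_iff.2 hc, ?_⟩
  rw [s_eq, ← pt_coe, hk _ (by simp), pt_eq_iff (by simp [hc]) (by simp)] at hz
  rw [← hr, ← Complex.mul_conj']
  simp only [det2, map_one, mul_one] at hz
  rw [sub_eq_zero.1 hz, mul_comm]

theorem Marking.exists_normalized_of_notMem_boundary {K : Type} [IsEmpty K] {T : RealTree}
    (μ : Marking T K (Fin 2)) (h : Moduli.mk T μ ∉ boundary K (Fin 2)) :
    ∃ (v : Fin T.n) (g : GL (Fin 2) ℂ) (β : ℝ), 0 < β ∧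
      g • μ.seen v (Sum.inr (0, true)) = ((0 : ℂ) : P1) ∧
      g • μ.seen v (Sum.inr (1, true)) = ((1 : ℂ) : P1) ∧
      g • μ.seen v (Sum.inr (0, false)) = OnePoint.infty ∧
      g • μ.seen v (Sum.inr (1, false)) = ((β ^ 2 : ℂ) : P1) := by
  obtain ⟨v, hs⟩ := μ.exists_separates (i := Sum.inr (0, true)) (j := Sum.inr (1, true))
    (k := Sum.inr (0, false)) (by simp) (by simp) (by simp)
  have hv : T.inv v = v := by
    by_contra hv
    exact h ⟨T, μ, rfl, Marking.inv_ne_of_separates hs hv⟩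
  obtain ⟨g, g0, g1, g2⟩ := hs.exists_smul
  have sig_seen (i) : g • T.sig v (g⁻¹ • g • μ.seen v i) = g • μ.seen v (Mark.conj i) := by
    rw [inv_smul_smul, μ.seen_conj_of_inv_eq hv]
  have s0 := sig_seen (Sum.inr (0, true))
  have s1 := sig_seen (Sum.inr (1, true))
  have s2 := sig_seen (Sum.inr (0, false))
  simp only [Mark.conj, Bool.not_true, Bool.not_false, g0, g1, g2] at s0 s1 s2
  obtain ⟨z, hz⟩ := RealTree.exists_fixed hv
  obtain ⟨β, hβ, hβ'⟩ := ((RealTree.isAnti_sig v).smul g g⁻¹).exists_apply_one_eq_sq s0 s2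
    (z := g • z) (by rw [inv_smul_smul, hz])
  exact ⟨v, g, β, hβ, g0, g1, g2, s1.symm.trans hβ'⟩

theorem Marking.exists_position_of_notMem_boundary {K : Type} [IsEmpty K] {T : RealTree}
    (μ : Marking T K (Fin 2)) (h : Moduli.mk T μ ∉ boundary K (Fin 2)) :
    ∃ t ∈ Set.Ioo (0 : ℝ) 1, ∃ (v : Fin T.n) (g : GL (Fin 2) ℂ),
      ∀ i, g • μ.seen v i = pt (position t i) := by
  obtain ⟨v, g, β, hβ, g0, g1, g2, g3⟩ := μ.exists_normalized_of_notMem_boundary h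
  have hβ0 : (β : ℂ) ≠ 0 := by exact_mod_cast hβ.ne'
  have hβ1 : (1 + β : ℂ) ≠ 0 := by exact_mod_cast (by positivity : (1 + β : ℝ) ≠ 0)
  -- The Möbius transformation `z ↦ z / (z + β)` turns `z ↦ β² / conj z` into `z ↦ 1 - conj z`.
  obtain ⟨k, hk⟩ := exists_gl_of_det_ne_zero (a := 1) (b := 0) (c := 1) (d := (β : ℂ))
    (by simpa using hβ.ne')
  refine ⟨1 / (1 + β), ⟨by positivity, (div_lt_one (by positivity)).2 (by linarith)⟩, v, k * g, ?_⟩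
  rintro (i | ⟨j, c⟩)
  · exact isEmptyElim i
  have pos_inr := position_ne_zero ((1 / (1 + β) : ℝ) : ℂ) (Sum.inr (j, c) : Mark K (Fin 2))
  rw [mul_smul]
  fin_cases j <;> cases c
  · change k • g • μ.seen v (Sum.inr (0, false)) = _
    rw [g2, ← pt_infty 1, hk _ (by simp), pt_eq_iff (by simp) pos_inr]
    simp [position, det2]
  · change k • g • μ.seen v (Sum.inr (0, true)) = _
    rw [g0, ← pt_coe, hk _ (by simp), pt_eq_iff (by simp [hβ0]) pos_inr]
    simp [position, det2]
  · change k • g • μ.seen v (Sum.inr (1, false)) = _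
    rw [g3, ← pt_coe, hk _ (by simp), pt_eq_iff (by simp [hβ0]) pos_inr]
    simp only [position, det2, Complex.conj_ofReal, Fin.mk_one, one_ne_zero, if_false,
      Bool.false_eq_true]
    push_cast
    field_simp
    ring
  · change k • g • μ.seen v (Sum.inr (1, true)) = _
    rw [g1, ← pt_coe, hk _ (by simp), pt_eq_iff (by simp) pos_inr]
    simp only [position, det2, Fin.mk_one, one_ne_zero, if_true, if_false]
    push_cast
    field_simp
    ring

/-! ### The forgetful morphism -/

instance : IsEmpty {j : Fin 1 // j ≠ 0} := ⟨fun j => j.2 (Subsingleton.elim _ _)⟩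

theorem chartCr_lift (w : ℂ) (q : Fin 4 ↪ Mark {j : Fin 1 // j ≠ 0} (Fin 2)) :
    chartCr w (q.trans (Mark.lift 0)) = chartCr w q := by
  have position_lift (i : Mark {j : Fin 1 // j ≠ 0} (Fin 2)) :
      position w (Mark.lift 0 i) = position w i := by
    rcases i with i | i <;> rfl
  simp only [chartCr, Function.Embedding.trans_apply, position_lift]

theorem isForget_of_position {m : Moduli (Fin 1) (Fin 2)} {w : ℂ} (hm : HasCoord m w)
    {T : RealTree} (μ : Marking T {j : Fin 1 // j ≠ 0} (Fin 2)) {v : Fin T.n} {g : GL (Fin 2) ℂ}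
    (h : ∀ i, g • μ.seen v i = pt (position w i)) : IsForget 0 m (Moduli.mk T μ) := fun q => by
  rw [crossRatio_of_position μ h, hm.crossRatio, chartCr_lift]

/-- The marked points `z_1⁺`, `z_2⁺`, `z_1⁻`, `z_2⁻`. -/
def pairMarks (K : Type) : Fin 4 ↪ Mark K (Fin 2) :=
  ⟨![Sum.inr (0, true), Sum.inr (1, true), Sum.inr (0, false), Sum.inr (1, false)], by
    intro i j h
    fin_cases i <;> fin_cases j <;> simp at h ⊢⟩

theorem chartCr_pairMarks (K : Type) (t : ℝ) :
    chartCr t (pairMarks K) = (-(1 - (t : ℂ)) ^ 2, -(t : ℂ) ^ 2) := by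
  change cr (position (K := K) t (Sum.inr (0, true))) (position (K := K) t (Sum.inr (1, true)))
    (position (K := K) t (Sum.inr (0, false))) (position (K := K) t (Sum.inr (1, false))) = _
  simp only [position, Complex.conj_ofReal, if_true, if_false, Bool.false_eq_true, one_ne_zero]
  ext <;> simp only [cr, det2] <;> ring

theorem coord_unique_of_isForget {m m' : Moduli (Fin 1) (Fin 2)}
    {y : Moduli {j : Fin 1 // j ≠ 0} (Fin 2)} {t t' : ℝ} (hm : HasCoord m t)
    (hm' : HasCoord m' t') (ht : t ∈ Set.Icc (0 : ℝ) 1) (ht' : t' ∈ Set.Icc (0 : ℝ) 1)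
    (h : IsForget 0 m y) (h' : IsForget 0 m' y) : t = t' := by
  have cr_eq := (h (pairMarks _)).symm.trans (h' (pairMarks _))
  rw [hm.crossRatio, hm'.crossRatio, chartCr_lift, chartCr_lift,
    pt_eq_iff (chartCr_ne_zero _ _) (chartCr_ne_zero _ _), chartCr_pairMarks,
    chartCr_pairMarks] at cr_eq
  simp only [det2] at cr_eq
  have sq_eq : ((1 - t) * t') ^ 2 = (t * (1 - t')) ^ 2 := by
    have : -(1 - t) ^ 2 * -t' ^ 2 - -t ^ 2 * -(1 - t') ^ 2 = 0 := by exact_mod_cast cr_eq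
    linear_combination this
  have := (pow_left_inj₀ (mul_nonneg (sub_nonneg.2 ht.2) ht'.1)
    (mul_nonneg ht.1 (sub_nonneg.2 ht'.2)) two_ne_zero).1 sq_eq
  linarith

theorem exists_pt_cr_eq {F : Type*} [Field F] [DecidableEq F] {k l : Fin 4} (hkl : k ≠ l) :
    ∃ z : OnePoint F, ∀ p : Fin 4 → F × F, NoTripleCoincidence p → det2 (p k) (p l) = 0 →
      pt (cr (p 0) (p 1) (p 2) (p 3)) = z := by
  wlog hlt : k < l generalizing k l
  · obtain ⟨z, hz⟩ := this hkl.symm ((not_lt.1 hlt).lt_of_ne hkl.symm)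
    exact ⟨z, fun p hp h => hz p hp (det2_eq_zero_comm.1 h)⟩
  have sub_eq (p : Fin 4 → F × F) : (cr (p 0) (p 1) (p 2) (p 3)).2 -
      (cr (p 0) (p 1) (p 2) (p 3)).1 = det2 (p 0) (p 2) * det2 (p 1) (p 3) := by
    simp only [cr, det2]
    ring
  have infty_of (p : Fin 4 → F × F) (hp : NoTripleCoincidence p)
      (h : det2 (p 0) (p 1) = 0 ∨ det2 (p 2) (p 3) = 0) :
      pt (cr (p 0) (p 1) (p 2) (p 3)) = pt (1, 0) := by
    rw [pt_eq_iff hp.cr_ne_zero (by simp)]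
    have : (cr (p 0) (p 1) (p 2) (p 3)).2 = 0 := by
      obtain h | h := h <;> simp [cr, det2_eq_zero_comm.1 h]
    simp [det2, this]
  have zero_of (p : Fin 4 → F × F) (hp : NoTripleCoincidence p)
      (h : det2 (p 0) (p 3) = 0 ∨ det2 (p 1) (p 2) = 0) :
      pt (cr (p 0) (p 1) (p 2) (p 3)) = pt (0, 1) := by
    rw [pt_eq_iff hp.cr_ne_zero (by simp)]
    have : (cr (p 0) (p 1) (p 2) (p 3)).1 = 0 := by
      obtain h | h := h <;> simp [cr, h, det2_eq_zero_comm.1 h]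
    simp [det2, this]
  have one_of (p : Fin 4 → F × F) (hp : NoTripleCoincidence p)
      (h : det2 (p 0) (p 2) = 0 ∨ det2 (p 1) (p 3) = 0) :
      pt (cr (p 0) (p 1) (p 2) (p 3)) = pt (1, 1) := by
    rw [pt_eq_iff hp.cr_ne_zero (by simp)]
    have : (cr (p 0) (p 1) (p 2) (p 3)).2 = (cr (p 0) (p 1) (p 2) (p 3)).1 :=
      sub_eq_zero.1 ((sub_eq p).trans (mul_eq_zero.2 h))
    simp [det2, this]
  fin_cases k <;> fin_cases l <;> first
    | exact absurd hlt (by decide)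
    | exact ⟨_, fun p hp h => infty_of p hp (by first | exact .inl h | exact .inr h)⟩
    | exact ⟨_, fun p hp h => zero_of p hp (by first | exact .inl h | exact .inr h)⟩
    | exact ⟨_, fun p hp h => one_of p hp (by first | exact .inl h | exact .inr h)⟩

theorem conj_mem_boundary (K : Type) [IsEmpty K] (b : Bool) :
    Moduli.mk conjTree (conjMarking K b) ∈ boundary K (Fin 2) :=
  ⟨_, _, rfl, by change ∀ v : Fin 2, Fin.rev v ≠ v; decide⟩

/-- Homogeneous coordinates of the marked points of `conjMarking` as seen from the component of
`z_1⁺`. -/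
def conjPosition {K : Type} (b : Bool) : Mark K (Fin 2) → ℂ × ℂ
  | Sum.inl _ => (1, 0)
  | Sum.inr (j, c) => if side b j c then (((j : ℕ) : ℂ), 1) else (1, 0)

section

variable {K : Type} (b : Bool)

theorem conjPosition_ne_zero (i : Mark K (Fin 2)) : conjPosition b i ≠ 0 := by
  rcases i with _ | ⟨j, c⟩
  · simp [conjPosition]
  · cases h : side b j c <;> simp [conjPosition, h]

variable [IsEmpty K]

theorem noTripleCoincidence_conjPosition :
    NoTripleCoincidence (conjPosition b : Mark K (Fin 2) → ℂ × ℂ) := by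
  rintro (i | ⟨i, c⟩) (j | ⟨j, d⟩) (k | ⟨k, e⟩) hij hik hjk h
  case inr.inr.inr =>
    simp only [conjPosition] at h ⊢
    fin_cases i <;> fin_cases j <;> fin_cases k <;> cases b <;> cases c <;> cases d <;> cases e <;>
      simp [side, det2] at hij hik hjk h ⊢
  all_goals first | exact isEmptyElim i | exact isEmptyElim j | exact isEmptyElim k

theorem conjMarking_seen (i : Mark K (Fin 2)) :
    (conjMarking K b).seen (0 : Fin 2) i = pt (conjPosition b i) := by
  obtain i | ⟨j, c⟩ := i
  · exact isEmptyElim i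
  cases h : side b j c
  · refine ((conjMarking K b).seen_of_comp_ne (v := (0 : Fin 2)) (i := Sum.inr (j, c)) ?_).trans ?_
    · change (if side b j c then (0 : Fin 2) else 1) ≠ 0
      simp [h]
    · simp [conjPosition, h, conjTree, pt]
  · refine ((conjMarking K b).seen_of_comp_eq (v := (0 : Fin 2)) (i := Sum.inr (j, c))
      (if_pos h)).trans ?_
    simp [conjPosition, h, conjMarking, pt]

end

theorem isForget_three (b : Bool) : IsForget 0 (Moduli.mk threeTree (threeMarking b))
    (Moduli.mk conjTree (conjMarking {j : Fin 1 // j ≠ 0} b)) := by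
  intro q
  rw [(hasCoord_three b).crossRatio, chartCr_lift]
  have q_surjective : Function.Surjective q := by
    refine (Function.Injective.bijective_of_nat_card_le q.injective ?_).2
    rw [Nat.card_sum, Nat.card_prod]
    simp
  -- In both positions `z_1⁻` coincides with the point of the second pair with sign `!b`, and this
  -- determines the cross-ratio.
  obtain ⟨k, hk⟩ := q_surjective (Sum.inr (0, false))
  obtain ⟨l, hl⟩ := q_surjective (Sum.inr (1, !b))
  obtain ⟨z, hz⟩ := exists_pt_cr_eq (F := ℂ) (k := k) (l := l) (by
    rintro rfl
    simp [hk] at hl)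
  have no_triple := (noTripleCoincidence_conjPosition b).comp q.injective
  rw [Marking.crossRatio_eq_pt (conjMarking {j : Fin 1 // j ≠ 0} b) (v := (0 : Fin 2)) (g := 1)
    (p := fun k => conjPosition b (q k)) no_triple (fun k => conjPosition_ne_zero b _)
    (fun k => (one_smul _ _).trans (conjMarking_seen b _)), hz _ no_triple, chartCr,
    hz (fun k => position _ (q k)) ((noTripleCoincidence_position _).comp q.injective)]
  · cases b <;> simp [hk, hl, position, det2]
  · cases b <;> simp [hk, hl, conjPosition, side, det2]

/-! ### The path of curves with real coordinate -/

theorem div_sub_one_div_sub_one {F : Type*} [Field F] {w : F} (hw : w ≠ 1) :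
    w / (w - 1) / (w / (w - 1) - 1) = w := by
  have sub_ne : w - 1 ≠ 0 := sub_ne_zero.2 hw
  have : w / (w - 1) - 1 = 1 / (w - 1) := by
    field_simp
    ring
  rw [this]
  field_simp

theorem exists_hasCoord (w : ℂ) : ∃ m, HasCoord m w := by
  by_cases w0 : w = 0
  · exact ⟨_, w0 ▸ hasCoord_three true⟩
  by_cases w1 : w = 1
  · exact ⟨_, w1 ▸ hasCoord_three false⟩
  have ζ0 : w / (w - 1) ≠ 0 := div_ne_zero w0 (sub_ne_zero.2 w1)
  have ζ1 : w / (w - 1) ≠ 1 := by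
    rw [Ne, div_eq_one_iff_eq (sub_ne_zero.2 w1)]
    exact fun h => by simpa using sub_eq_zero.2 h
  by_cases h : ‖w / (w - 1)‖ = 1
  · exact ⟨_, div_sub_one_div_sub_one w1 ▸ hasCoord_two h norm_one ζ1⟩
  · have := (isSmoothing_smooth ζ0 h).hasCoord ζ0 ζ1
    rw [smoothingCoord, if_pos rfl, div_sub_one_div_sub_one w1] at this
    exact ⟨_, this⟩

/-- The curve with coordinate `w`: the inverse of the coordinate on its domain. -/
def curve (w : ℂ) : Moduli (Fin 1) (Fin 2) := (exists_hasCoord w).choose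

theorem hasCoord_curve (w : ℂ) : HasCoord (curve w) w := (exists_hasCoord w).choose_spec

theorem HasCoord.eq_curve {m : Moduli (Fin 1) (Fin 2)} {w : ℂ} (h : HasCoord m w) :
    m = curve w :=
  h.eq (hasCoord_curve w)

theorem curve_zero : curve 0 = Moduli.mk threeTree (threeMarking true) :=
  (hasCoord_three true).eq_curve.symm

theorem curve_one : curve 1 = Moduli.mk threeTree (threeMarking false) :=
  (hasCoord_three false).eq_curve.symm

theorem emb_curve (w : ℂ) : emb (curve w) = chart w := (hasCoord_curve w).emb_eq

theorem coord_emb_curve (w : ℂ) : coord (emb (curve w)) = w := by rw [emb_curve, coord_chart]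

theorem hasDerivAt_emb_curve {f : ℝ → ℂ} {z : ℂ} {t : ℝ} (hf : HasDerivAt f z t) :
    HasDerivAt (fun t => emb (curve (f t))) (dchart (f t) z) t := by
  simp only [emb_curve]
  exact (hasFDerivAt_chart (f t)).comp_hasDerivAt t hf

theorem mem_tangentSpace_univ (w z : ℂ) : dchart w z ∈ tangentSpace Set.univ (curve w) := by
  have line : HasDerivAt (fun r : ℝ => w + r * z) z 0 := by
    simpa using ((hasDerivAt_id (0 : ℝ)).ofReal_comp.mul_const z).const_add w
  simpa using mem_tangentSpace_of_curve (hasDerivAt_emb_curve line).hasDerivWithinAt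
    (uniqueDiffWithinAt_univ (𝕜 := ℝ)).accPt fun r _ => Set.mem_univ (curve (w + r * z))

theorem exists_rotation_curve {t : ℝ} (ht : t ∈ Set.Ioo (0 : ℝ) 1) :
    ∃ m, IsRotation 0 0 m ∧ m 0 = curve t := by
  by_cases half : t = 1 / 2
  · obtain ⟨m, rotation, coord_m⟩ := exists_rotation_two
    exact ⟨m, rotation, by simpa [half] using coord_m.eq_curve⟩
  have t1 : (t : ℂ) ≠ 1 := by exact_mod_cast ht.2.ne
  have t0 : (t : ℂ) / (t - 1) ≠ 0 :=
    div_ne_zero (by exact_mod_cast ht.1.ne') (sub_ne_zero.2 t1)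
  have norm_ne : ‖(t : ℂ) / (t - 1)‖ ≠ 1 := by
    have : ‖(t : ℂ) / (t - 1)‖ = t / (1 - t) := by
      rw [norm_div, norm_sub_rev, ← Complex.ofReal_one, ← Complex.ofReal_sub, Complex.norm_real,
        Complex.norm_real, Real.norm_of_nonneg ht.1.le, Real.norm_of_nonneg (sub_pos.2 ht.2).le]
    rw [this, Ne, div_eq_one_iff_eq (sub_pos.2 ht.2).ne']
    exact fun h => half (by linarith)
  obtain ⟨m, rotation, coord_m⟩ := exists_rotation_smooth t0 norm_ne
  rw [div_sub_one_div_sub_one t1] at coord_m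
  exact ⟨m, rotation, coord_m.eq_curve⟩

theorem hasDerivAt_emb_curve_ofReal (t : ℝ) :
    HasDerivAt (fun t : ℝ => emb (curve t)) (dchart t 1) t :=
  hasDerivAt_emb_curve (hasDerivAt_id t).ofReal_comp

theorem derivWithin_emb_curve {t : ℝ} (ht : t ∈ Set.Icc (0 : ℝ) 1) :
    derivWithin (fun t : ℝ => emb (curve t)) (Set.Icc 0 1) t = dchart t 1 :=
  (hasDerivAt_emb_curve_ofReal t).hasDerivWithinAt.derivWithin (uniqueDiffOn_Icc_zero_one t ht)

/-- The path from `P⁺` to `P⁻` along which the coordinate goes from `0` to `1`. -/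
def realPath : EmbeddedPath (Fin 1) (Fin 2) where
  path t := curve t
  smooth := by
    simp only [emb_curve]
    exact (contDiff_chart.comp Complex.ofRealCLM.contDiff).contDiffOn
  injOn := by
    simp only [emb_curve]
    exact (chart_injective.comp Complex.ofReal_injective).injOn
  immersion t ht := by
    rw [derivWithin_emb_curve ht]
    exact fun h => one_ne_zero (dchart_injective t (h.trans (map_zero _).symm))

theorem realPath_bd : realPath.bd = {curve 0, curve 1} := by
  simp [EmbeddedPath.bd, realPath]

theorem curve_mem_carrier {t : ℝ} (ht : t ∈ Set.Icc (0 : ℝ) 1) : curve t ∈ realPath.carrier :=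
  ⟨t, ht, rfl⟩

theorem ends_realPath : ends realPath.carrier = ∅ := by
  have closed : IsClosed (emb '' realPath.carrier) := by
    have : emb '' realPath.carrier = (fun t : ℝ => chart t) '' Set.Icc 0 1 := by
      simp only [EmbeddedPath.carrier, Set.image_image, realPath, emb_curve]
    rw [this]
    exact (isCompact_Icc.image
      (contDiff_chart.continuous.comp Complex.continuous_ofReal)).isClosed
  simp only [ends, closed.closure_eq, Set.sdiff_self, Set.mem_empty_iff_false, Set.ofPred_false]

theorem mem_tangentSpace_carrier {t : ℝ} (ht : t ∈ Set.Icc (0 : ℝ) 1) :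
    dchart t 1 ∈ tangentSpace realPath.carrier (curve t) :=
  mem_tangentSpace_of_curve (γ := fun t : ℝ => curve t)
    (hasDerivAt_emb_curve_ofReal t).hasDerivWithinAt (uniqueDiffOn_Icc_zero_one t ht).accPt
    fun _ => curve_mem_carrier

theorem notMem_tangentSpace_carrier (t : ℝ) {z : ℂ} (hz : z.im ≠ 0) :
    dchart t z ∉ tangentSpace realPath.carrier (curve t) := by
  refine fun h => hz (im_eq_zero_of_mem_tangentSpace (hasCoord_curve t) (Complex.ofReal_im t) ?_ h)
  rintro _ ⟨s, -, rfl⟩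
  exact ⟨s, hasCoord_curve s⟩

/-- The co-orientation of the path by the direction `-𝕚` of the coordinate. -/
def realCoOrientation : CoOrientation realPath.carrier where
  normal p := dchart (coord (emb p)) (-Complex.I)
  continuousOn := by
    rintro _ ⟨t, -, rfl⟩
    refine ContinuousAt.continuousWithinAt ?_
    have continuousAt_coord : ContinuousAt (fun p => coord (emb p)) (curve t) := by
      refine ContinuousAt.comp (g := coord) ?_ continuous_induced_dom.continuousAt
      rw [emb_curve]
      exact (differentiableAt_coord t).continuousAt
    exact (continuous_dchart.continuousAt.comp continuousAt_coord).clm_apply continuousAt_const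
  mem_tangent := by
    rintro _ ⟨t, -, rfl⟩
    change dchart (coord (emb (curve t))) _ ∈ _
    rw [coord_emb_curve]
    exact mem_tangentSpace_univ t _
  notMem_tangent := by
    rintro _ ⟨t, -, rfl⟩
    change dchart (coord (emb (curve t))) _ ∉ _
    rw [coord_emb_curve]
    exact notMem_tangentSpace_carrier t (by simp)

theorem normal_curve (w : ℂ) : realCoOrientation.normal (curve w) = dchart w (-Complex.I) := by
  change dchart (coord (emb (curve w))) (-Complex.I) = _
  rw [coord_emb_curve]

/-! ### Strata -/

theorem continuous_emb_apply {K L : Type} (q : Fin 4 ↪ Mark K L) :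
    Continuous fun m : Moduli K L => emb m q :=
  (continuous_apply q).comp (continuous_induced_dom (f := emb))

section

variable {K L : Type} {T : RealTree} {μ : Marking T K L}

theorem Marking.seen_eq_of_comp_ne (hn : T.n = 2) {v : Fin T.n} {i j : Mark K L}
    (hi : μ.comp i ≠ v) (hj : μ.comp j ≠ v) : μ.seen v i = μ.seen v j := by
  have : μ.comp i = μ.comp j := by omega
  rw [μ.seen_of_comp_ne hi, μ.seen_of_comp_ne hj, this]

theorem Marking.separates_of_comp_eq {v : Fin T.n} {i j k : Mark K L} (hij : i ≠ j) (hik : i ≠ k)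
    (hjk : j ≠ k) (hi : μ.comp i = v) (hj : μ.comp j = v) : μ.Separates v i j k :=
  ⟨μ.seen_ne_of_comp_eq hi hij, μ.seen_ne_of_comp_eq hi hik, μ.seen_ne_of_comp_eq hj hjk⟩

theorem Marking.exists_comp_eq_of_crossRatio {q : Fin 4 ↪ Mark K L} (hq : Function.Surjective q)
    {w : ℂ} (w0 : w ≠ 0) (w1 : w ≠ 1) (h : (Moduli.mk T μ).crossRatio q = (w : P1)) :
    ∃ v, ∀ i, μ.comp i = v := by
  obtain ⟨v, g, h0, h1, h2, h3⟩ := μ.crossRatio_mk_iff.1 h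
  have seen_injective : Function.Injective fun k => μ.seen v (q k) := by
    intro i j e
    have smul_eq : g • μ.seen v (q i) = g • μ.seen v (q j) := congrArg _ e
    fin_cases i <;> fin_cases j <;>
      simp only [Fin.zero_eta, Fin.mk_one, Fin.reduceFinMk, h0, h1, h2, h3] at smul_eq ⊢ <;>
      simp [w0, w0.symm, w1, w1.symm] at smul_eq
  refine ⟨v, hq.forall.2 fun k => μ.comp_eq_of_seen_ne (hq.forall.2 fun l hl e => hl ?_)⟩
  exact congrArg q (seen_injective e)

end

theorem snd_eq_one_of_mem_closure_stratum {m : Moduli (Fin 1) (Fin 2)}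
    (h : m ∈ closure (stratum ∅ {0})) : (emb m (chartMarks true)).2 = 1 := by
  refine closure_minimal ?_ (isClosed_eq (continuous_snd.comp (continuous_emb_apply _))
    continuous_const) h
  rintro _ ⟨T, μ, rfl, hn, -, v, hA, hB⟩
  have comp_z (b) : μ.comp (Sum.inr (0, b)) = v := (hB 0 b).2 rfl
  have comp_x : μ.comp (Sum.inl 0) ≠ v := fun e => (hA 0).1 e
  have comp_y : μ.comp (Sum.inr (1, true)) ≠ v := fun e => by simpa using (hB 1 true).1 e
  obtain ⟨g, h0, h1, h2⟩ := (Marking.separates_of_comp_eq (k := Sum.inl 0) (by simp) (by simp)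
    (by simp) (comp_z true) (comp_z false)).exists_smul
  refine (sphere_snd_eq_one_iff _).2 (μ.crossRatio_mk_iff.2 ⟨v, g, h0, h1, h2, ?_⟩)
  rw [chartMarks_three, Marking.seen_eq_of_comp_ne hn comp_y comp_x, h2]

theorem emb_eq_of_mem_closure_stratum {m : Moduli (Fin 1) (Fin 2)}
    (h : m ∈ closure (stratum Set.univ {0})) :
    emb m (chartMarks true) = emb m (chartMarks false) := by
  refine closure_minimal ?_ (isClosed_eq (continuous_emb_apply _) (continuous_emb_apply _)) h
  rintro _ ⟨T, μ, rfl, hn, -, v, -, hB⟩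
  have comp_z (b) : μ.comp (Sum.inr (0, b)) = v := (hB 0 b).2 rfl
  have comp_y (b) : μ.comp (Sum.inr (1, b)) ≠ v := fun e => by simpa using (hB 1 b).1 e
  obtain ⟨g, h0, h1, h2⟩ := (Marking.separates_of_comp_eq (k := Sum.inl 0) (by simp) (by simp)
    (by simp) (comp_z true) (comp_z false)).exists_smul
  have crossRatio_eq (b) : (Moduli.mk T μ).crossRatio (chartMarks b) =
      g • μ.seen v (Sum.inr (1, b)) :=
    μ.crossRatio_mk_iff.2 ⟨v, g, h0, h1, h2, rfl⟩
  simp only [Set.mem_ofPred_eq, emb, crossRatio_eq,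
    Marking.seen_eq_of_comp_ne hn (comp_y true) (comp_y false)]

theorem disjoint_carrier_closure_stratum :
    Disjoint realPath.carrier (closure (stratum ∅ {0})) := by
  rw [Set.disjoint_left]
  rintro _ ⟨t, -, rfl⟩ h
  have := snd_eq_one_of_mem_closure_stratum h
  rw [show emb (realPath.path t) = chart t from emb_curve t] at this
  exact chart_snd_ne_one t this

theorem eq_half_of_mem_closure_stratum {t : ℝ}
    (h : curve t ∈ closure (stratum Set.univ {0})) : t = 1 / 2 := by
  have crossRatio_eq : (curve t).crossRatio (chartMarks true) =
      (curve t).crossRatio (chartMarks false) :=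
    sphere_injective (emb_eq_of_mem_closure_stratum h)
  rw [(hasCoord_curve t).crossRatio_false, show _ = _ from hasCoord_curve t,
    Complex.conj_ofReal] at crossRatio_eq
  have : t = 1 - t := by exact_mod_cast OnePoint.coe_injective crossRatio_eq
  linarith

theorem hasDerivAt_emb_of_rotation_half
    {m₁ : ℝ → Moduli (Option (Set.univ : Set (Fin 1))) ({0} : Set (Fin 2))}
    {m₂ : Moduli (Option ↥((Set.univ : Set (Fin 1))ᶜ)) ↥(({0} : Set (Fin 2))ᶜ)}
    {m : ℝ → Moduli (Fin 1) (Fin 2)} {o : ({0} : Set (Fin 2))} (hm₁ : IsRotation o none m₁)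
    (hg : ∀ᶠ θ in nhds (0 : ℝ), Glue Set.univ {0} (m₁ θ) m₂ (m θ)) (h0 : m 0 = curve (1 / 2)) :
    HasDerivAt (fun θ => emb (m θ)) (dchart (1 / 2) (Complex.I / 4)) 0 := by
  convert hasDerivAt_emb_of_rotation_node hm₁ hg (h0 ▸ hasCoord_curve (1 / 2)) using 2
  ring

theorem ofReal_half : ((1 / 2 : ℝ) : ℂ) = 1 / 2 := by simp

theorem half_mem_Icc : (1 / 2 : ℝ) ∈ Set.Icc (0 : ℝ) 1 := by constructor <;> norm_num

theorem curve_half_mem_carrier : curve (1 / 2) ∈ realPath.carrier :=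
  ofReal_half ▸ curve_mem_carrier half_mem_Icc

theorem curve_half_mem_stratum : curve (1 / 2) ∈ stratum Set.univ {0} := by
  obtain ⟨-, m, -, -, mem, coord_m⟩ := exists_rotation_node
  exact coord_m.eq_curve ▸ mem 0

theorem carrier_inter_closure_stratum :
    realPath.carrier ∩ closure (stratum Set.univ {0}) = {curve (1 / 2)} := by
  refine Set.Subset.antisymm ?_
    (Set.singleton_subset_iff.2 ⟨curve_half_mem_carrier, subset_closure curve_half_mem_stratum⟩)
  rintro _ ⟨⟨t, -, rfl⟩, h⟩
  rw [Set.mem_singleton_iff, ← ofReal_half, ← eq_half_of_mem_closure_stratum h]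
  rfl

theorem bd_inter_closure_stratum :
    realPath.bd ∩ closure (stratum Set.univ {0}) = ∅ := by
  rw [Set.eq_empty_iff_forall_notMem]
  rintro u ⟨rfl | rfl, h⟩ <;>
  · have := eq_half_of_mem_closure_stratum h
    norm_num at this

theorem eq_of_isStratumType {A : Set (Fin 1)} {B : Set (Fin 2)} (h : IsStratumType 0 A B) :
    (A = ∅ ∨ A = Set.univ) ∧ B = {0} := by
  obtain ⟨zero_mem, -, card⟩ := h
  have one_notMem : (1 : Fin 2) ∉ B := by
    intro one_mem
    have compl_B : Bᶜ = ∅ := by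
      ext j
      fin_cases j <;> simp [zero_mem, one_mem]
    have card_A : Aᶜ.ncard ≤ 1 := Set.ncard_le_one_of_subsingleton _
    rw [compl_B, Set.ncard_empty] at card
    omega
  refine ⟨Subsingleton.set_cases (p := fun A => A = ∅ ∨ A = Set.univ) (.inl rfl) (.inr rfl) A, ?_⟩
  ext j
  fin_cases j <;> simp [zero_mem, one_notMem]

/-! ### Regularity -/

theorem mem_star_of_crossRatio_nodeMarks
    {m : Moduli (Option (Set.univ : Set (Fin 1))) ({0} : Set (Fin 2))} {w : ℂ} (w0 : w ≠ 0)
    (w1 : w ≠ 1) (h : m.crossRatio nodeMarks = (w : P1)) (o : ({0} : Set (Fin 2))) :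
    m ∈ star o none := by
  have surjective : Function.Surjective nodeMarks := by
    rintro ((_ | i) | ⟨j, _ | _⟩)
    · exact ⟨3, rfl⟩
    · exact ⟨2, by rw [Subsingleton.elim i ⟨0, trivial⟩]; rfl⟩
    · exact ⟨1, by rw [Subsingleton.elim j ⟨0, rfl⟩]; rfl⟩
    · exact ⟨0, by rw [Subsingleton.elim j ⟨0, rfl⟩]; rfl⟩
  obtain ⟨T, μ, rfl⟩ := m.exists_mk
  obtain ⟨v, hv⟩ := μ.exists_comp_eq_of_crossRatio surjective w0 w1 h
  exact ⟨T, μ, rfl, (hv _).trans (hv _).symm⟩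

theorem regularForget_realPath : RegularForget 0 0 realPath.carrier realPath.bd := by
  refine ⟨?_, by simp [ends_realPath], ?_⟩
  · rintro _ ⟨⟨t, ht, rfl⟩, hb⟩
    have t0 : t ≠ 0 := by
      rintro rfl
      exact hb (Or.inl rfl)
    have t1 : t ≠ 1 := by
      rintro rfl
      exact hb (Or.inr rfl)
    obtain ⟨m, ⟨T, μ, v, g, h⟩, hm⟩ :=
      exists_rotation_curve ⟨lt_of_le_of_ne ht.1 t0.symm, lt_of_le_of_ne ht.2 t1⟩
    obtain ⟨m_eq, -, -, comp_x, comp_z, -⟩ := h.self_of_nhds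
    exact ⟨T, μ 0, m_eq.symm.trans hm, comp_x.trans comp_z.symm⟩
  · rw [realPath_bd, curve_zero, curve_one]
    rintro _ (rfl | rfl)
    · exact ⟨_, isForget_three true, Or.inl (conj_mem_boundary _ true)⟩
    · exact ⟨_, isForget_three false, Or.inl (conj_mem_boundary _ false)⟩

theorem regularStratum_empty : RegularStratum 0 ∅ {0} realPath.carrier realPath.bd := by
  have carrier_inter : realPath.carrier ∩ closure (stratum ∅ {0}) = ∅ :=
    disjoint_carrier_closure_stratum.inter_eq
  have bd_inter : realPath.bd ∩ closure (stratum ∅ {0}) = ∅ := by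
    refine Set.eq_empty_of_subset_empty ((Set.inter_subset_inter_left _ ?_).trans carrier_inter.le)
    rintro _ (rfl | rfl)
    · exact ⟨0, by simp, rfl⟩
    · exact ⟨1, by simp, rfl⟩
  refine ⟨by simp [carrier_inter], by simp [bd_inter], ⟨∅, by simp, by simp [carrier_inter]⟩,
    fun h => absurd ⟨rfl, rfl⟩ h⟩

theorem tangentSpace_sup_closure_stratum :
    tangentSpace realPath.carrier (curve (1 / 2)) ⊔
      tangentSpace (closure (stratum Set.univ {0})) (curve (1 / 2)) =
      tangentSpace Set.univ (curve (1 / 2)) := by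
  refine le_antisymm (sup_le (tangentSpace_mono (Set.subset_univ _) _)
    (tangentSpace_mono (Set.subset_univ _) _)) ?_
  refine (tangentSpace_le_range (hasCoord_curve _)).trans ?_
  rintro _ ⟨z, rfl⟩
  have tangent_path : dchart (1 / 2) 1 ∈ tangentSpace realPath.carrier (curve (1 / 2)) :=
    ofReal_half ▸ mem_tangentSpace_carrier half_mem_Icc
  have tangent_stratum : dchart (1 / 2) (Complex.I / 4) ∈
      tangentSpace (closure (stratum Set.univ {0})) (curve (1 / 2)) := by
    obtain ⟨_, m, rotation, glue, mem, coord_m⟩ := exists_rotation_node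
    have deriv := hasDerivAt_emb_of_rotation_half rotation (.of_forall glue) coord_m.eq_curve
    rw [← coord_m.eq_curve]
    exact mem_tangentSpace_of_curve (s := Set.univ) deriv.hasDerivWithinAt
      (uniqueDiffWithinAt_univ (𝕜 := ℝ)).accPt fun r _ => subset_closure (mem r)
  have z_eq : z = z.re • (1 : ℂ) + (4 * z.im) • (Complex.I / 4) := by
    apply Complex.ext <;> simp
    ring
  change dchart (1 / 2) z ∈ _
  rw [z_eq, map_add, map_smul, map_smul]
  exact Submodule.add_mem_sup (Submodule.smul_mem _ _ tangent_path)
    (Submodule.smul_mem _ _ tangent_stratum)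

theorem carrier_inter_closure_stratum_eq_glue :
    realPath.carrier ∩ closure (stratum Set.univ {0}) =
      {m | ∃ m₁ ∈ {m₁ | m₁.crossRatio nodeMarks = ((1 / 2 : ℂ) : P1)},
        ∃ m₂, Glue Set.univ {0} m₁ m₂ m} := by
  rw [carrier_inter_closure_stratum]
  refine Set.Subset.antisymm (Set.singleton_subset_iff.2 ?_) ?_
  · obtain ⟨m₁, m, -, glue, -, coord_m⟩ := exists_rotation_node
    have := glue 0
    rw [coord_m.eq_curve] at this
    exact ⟨m₁ 0, (this.crossRatio (collapse_chartMarks true)).symm.trans (hasCoord_curve _), _,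
      this⟩
  · rintro m ⟨m₁, h, m₂, glue⟩
    exact HasCoord.eq_curve ((glue.crossRatio (collapse_chartMarks true)).trans h)

theorem regularStratum_univ : RegularStratum 0 Set.univ {0} realPath.carrier realPath.bd := by
  refine ⟨?_, by simp [bd_inter_closure_stratum],
    ⟨_, fun h _ hm => mem_star_of_crossRatio_nodeMarks (by norm_num) (by norm_num) hm _,
      carrier_inter_closure_stratum_eq_glue⟩,
    fun _ => ⟨by simp [ends_realPath], by simp [bd_inter_closure_stratum]⟩⟩
  rw [carrier_inter_closure_stratum]
  rintro _ rfl
  exact tangentSpace_sup_closure_stratum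

theorem regular_realPath : Regular 0 realPath.carrier realPath.bd := by
  refine ⟨by simp [ends_realPath], fun i => ?_, fun A B h => ?_⟩
  · rw [Subsingleton.elim i 0]
    exact regularForget_realPath
  · obtain ⟨rfl | rfl, rfl⟩ := eq_of_isStratumType h
    exacts [regularStratum_empty, regularStratum_univ]

/-! ### Degrees -/

theorem mk_sphereTree_notMem_boundary {K L : Type} (μ : Marking sphereTree K L) :
    Moduli.mk sphereTree μ ∉ boundary K L := by
  rintro ⟨T, μ', h, hT⟩
  obtain ⟨f, g, -, -, hf, -⟩ : Iso _ _ := Quotient.exact h.symm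
  exact hT (f (0 : Fin 1)) (hf (0 : Fin 1))

theorem exists_notMem_boundary {K : Type} [Subsingleton K] : ∃ m, m ∉ boundary K (Fin 2) :=
  ⟨_, mk_sphereTree_notMem_boundary (circleMarking (circleData_smooth (ξ := 1) (ζ := 2)
    (by simp) (by simp) (by simp)))⟩

theorem dchart_smul_notMem_tangentSpace {t c : ℝ} (hc : c ≠ 0) :
    dchart t (c • -Complex.I) ∉ tangentSpace realPath.carrier (curve t) :=
  notMem_tangentSpace_carrier t (by simpa using hc)

theorem hasSign_curve {t c : ℝ} {s : ℤ} (h : 0 < c ∧ s = 1 ∨ c < 0 ∧ s = -1) :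
    HasSign realCoOrientation (curve t) (dchart t (c • -Complex.I)) s :=
  ⟨c, by rw [normal_curve, map_smul, sub_self]; exact zero_mem _, h⟩

theorem curve_injective : Function.Injective curve := fun w w' h => by
  rw [← coord_emb_curve w, h, coord_emb_curve]

theorem curve_notMem_bd {t : ℝ} (ht : t ∈ Set.Ioo (0 : ℝ) 1) : curve t ∉ realPath.bd := by
  rw [realPath_bd]
  rintro (h | h)
  · exact ht.1.ne' (Complex.ofReal_eq_zero.1 (curve_injective h))
  · exact ht.2.ne (Complex.ofReal_eq_one.1 (curve_injective h))

theorem hasDegree_realPath {Z : Type} {rel : Moduli (Fin 1) (Fin 2) → Z → Prop} {bdZ : Set Z}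
    {vert : Moduli (Fin 1) (Fin 2) → Ambient (Fin 1) (Fin 2) → Prop} {s : ℤ}
    (hZ : ∃ y, y ∉ bdZ)
    (h : ∀ y ∉ bdZ, ∃ t ∈ Set.Ioo (0 : ℝ) 1, (∀ u ∈ realPath.carrier, rel u y ↔ u = curve t) ∧
      ∃ c : ℝ, (0 < c ∧ s = 1 ∨ c < 0 ∧ s = -1) ∧
        ∀ w, vert (curve t) w ↔ w = dchart t (c • -Complex.I)) :
    HasDegree realCoOrientation realPath.bd rel bdZ vert s := by
  have bd_subset : realPath.bd ⊆ realPath.carrier := by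
    rintro _ (rfl | rfl)
    exacts [⟨0, by simp, rfl⟩, ⟨1, by simp, rfl⟩]
  refine ⟨?_, ?_⟩
  · obtain ⟨y, hy⟩ := hZ
    obtain ⟨t, ht, fiber, c, sign, vertical⟩ := h y hy
    refine ⟨y, hy, ?_, ?_⟩
    · rw [ends_realPath, Set.union_empty]
      intro u hu rel_u
      obtain rfl := (fiber u (bd_subset hu)).1 rel_u
      exact curve_notMem_bd ht hu
    · intro u hu rel_u w hw
      obtain rfl := (fiber u hu).1 rel_u
      rw [(vertical w).1 hw]
      exact dchart_smul_notMem_tangentSpace (sign.elim (fun h => h.1.ne') fun h => h.1.ne)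
  · rintro y ⟨hy, -, -⟩
    obtain ⟨t, ht, fiber, c, sign, vertical⟩ := h y hy
    have fiber_eq : {u ∈ realPath.carrier | rel u y} = {curve t} := by
      ext u
      refine ⟨fun h => (fiber u h.1).1 h.2, ?_⟩
      rintro rfl
      have := curve_mem_carrier (Set.Ioo_subset_Icc_self ht)
      exact ⟨this, (fiber _ this).2 rfl⟩
    rw [fiber_eq]
    refine ⟨Set.finite_singleton _, fun _ => s, fun u hu rel_u => ?_, finsum_mem_singleton⟩
    obtain rfl := (fiber u hu).1 rel_u
    exact ⟨_, (vertical _).2 rfl, hasSign_curve sign⟩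

theorem isVertical_curve_iff {t : ℝ} (ht : t ∈ Set.Ioo (0 : ℝ) 1)
    {w : Ambient (Fin 1) (Fin 2)} :
    IsVertical 0 0 (curve t) w ↔ w = dchart t ((t * (1 - t)) • -Complex.I) := by
  have vertical_eq : Complex.I * (t * (t - 1)) = (t * (1 - t)) • -Complex.I := by
    rw [Complex.real_smul]
    push_cast
    ring
  constructor
  · rintro ⟨m, rotation, m_zero, deriv⟩
    rw [← vertical_eq]
    exact deriv.unique (rotation.hasDerivAt_emb (m_zero ▸ hasCoord_curve t))
  · rintro rfl
    obtain ⟨m, rotation, m_zero⟩ := exists_rotation_curve ht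
    exact ⟨m, rotation, m_zero, vertical_eq ▸ rotation.hasDerivAt_emb (m_zero ▸ hasCoord_curve t)⟩

theorem isVerticalNode_curve_half_iff {w : Ambient (Fin 1) (Fin 2)} :
    IsVerticalNode 0 Set.univ {0} (curve (1 / 2)) w ↔
      w = dchart (1 / 2) ((-(1 / 4) : ℝ) • -Complex.I) := by
  have vertical_eq : Complex.I / 4 = (-(1 / 4) : ℝ) • -Complex.I := by
    rw [Complex.real_smul]
    push_cast
    ring
  rw [← vertical_eq]
  constructor
  · rintro ⟨_, m₁, m₂, m, rotation, glue, m_zero, deriv⟩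
    exact deriv.unique (hasDerivAt_emb_of_rotation_half rotation glue m_zero)
  · rintro rfl
    obtain ⟨m₁, m, rotation, glue, -, coord_m⟩ := exists_rotation_node
    exact ⟨rfl, m₁, _, m, rotation, .of_forall glue, coord_m.eq_curve,
      hasDerivAt_emb_of_rotation_half rotation (.of_forall glue) coord_m.eq_curve⟩

theorem exists_isForget_iff {y : Moduli {j : Fin 1 // j ≠ 0} (Fin 2)} (hy : y ∉ boundary _ _) :
    ∃ t ∈ Set.Ioo (0 : ℝ) 1, ∀ u ∈ realPath.carrier, IsForget 0 u y ↔ u = curve t := by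
  obtain ⟨T, μ, rfl⟩ := y.exists_mk
  obtain ⟨t, ht, v, g, h⟩ := μ.exists_position_of_notMem_boundary hy
  have forget := isForget_of_position (hasCoord_curve t) μ h
  refine ⟨t, ht, ?_⟩
  rintro _ ⟨s, hs, rfl⟩
  refine ⟨fun forget' => ?_, fun e => e ▸ forget⟩
  rw [← coord_unique_of_isForget (hasCoord_curve s) (hasCoord_curve t) hs
    (Set.Ioo_subset_Icc_self ht) forget' forget]
  rfl

theorem hasDegreeForget_realPath : HasDegreeForget 0 0 realCoOrientation realPath.bd 1 := by
  refine hasDegree_realPath exists_notMem_boundary fun y hy => ?_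
  obtain ⟨t, ht, fiber⟩ := exists_isForget_iff hy
  exact ⟨t, ht, fiber, t * (1 - t), .inl ⟨mul_pos ht.1 (sub_pos.2 ht.2), rfl⟩,
    fun w => isVertical_curve_iff ht⟩

instance : Unique {j : Option (Set.univ : Set (Fin 1)) // j ≠ none} where
  default := ⟨some ⟨0, trivial⟩, by simp⟩
  uniq := by
    rintro ⟨_ | i, h⟩
    · exact absurd rfl h
    · exact Subtype.ext (congrArg some (Subsingleton.elim _ _))

theorem isForgetNode_half (y : StratumTarget (Set.univ : Set (Fin 1)) ({0} : Set (Fin 2))) :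
    IsForgetNode Set.univ {0} (curve (1 / 2)) y := by
  obtain ⟨m₁, m, -, glue, -, coord_m⟩ := exists_rotation_node
  refine ⟨m₁ 0, ?_, fun q => ?_⟩
  · rw [← coord_m.eq_curve, Subsingleton.elim y.2]
    exact glue 0
  · have := Nat.card_le_card_of_injective q q.injective
    simp at this

theorem exists_notMem_targetBoundary :
    ∃ y, y ∉ targetBoundary (Set.univ : Set (Fin 1)) ({0} : Set (Fin 2)) :=
  ⟨(Moduli.mk sphereTree (circleMarking circleData_unique),
    Moduli.mk sphereTree (circleMarking circleData_unique)),
    not_or.2 ⟨mk_sphereTree_notMem_boundary _, mk_sphereTree_notMem_boundary _⟩⟩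

theorem hasDegreeStratum_realPath :
    HasDegreeStratum 0 Set.univ {0} realCoOrientation realPath.bd (-1) := by
  refine hasDegree_realPath exists_notMem_targetBoundary fun y _ =>
    ⟨1 / 2, by norm_num, fun u hu => ?_, -(1 / 4), .inr ⟨by norm_num, rfl⟩, fun w => ?_⟩
  · rw [ofReal_half, ← Set.mem_singleton_iff, ← carrier_inter_closure_stratum]
    refine ⟨fun h => ⟨hu, h.1⟩, fun h => ⟨h.2, ?_⟩⟩
    rw [carrier_inter_closure_stratum] at h
    rw [Set.mem_singleton_iff.1 h]
    exact isForgetNode_half y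
  · rw [ofReal_half]
    exact isVerticalNode_curve_half_iff

/-! ### Endpoints -/

theorem linearIndependent_apply_one_I {E : Type*} [AddCommGroup E] [Module ℝ E] {F : ℂ →ₗ[ℝ] E}
    (hF : Function.Injective F) : LinearIndependent ℝ ![F 1, F Complex.I] := by
  have := Complex.basisOneI.linearIndependent.map' F (LinearMap.ker_eq_bot.2 hF)
  rwa [Complex.coe_basisOneI, ← FinVec.map_eq] at this

theorem smoothingCoord_zero (b : Bool) : smoothingCoord b 0 = if b then 0 else 1 := by
  cases b <;> simp [smoothingCoord]

theorem isSmoothing_curve {b : Bool} {ζ : ℂ} (h0 : ζ ≠ 0) (h1 : ‖ζ‖ ≠ 1) :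
    IsSmoothing b ζ (curve (smoothingCoord b ζ)) := by
  obtain ⟨m, hm⟩ := exists_isSmoothing b h0 h1
  rwa [← (hm.hasCoord h0 (by rintro rfl; simp at h1)).eq_curve]

theorem isComplexFrame_curve {b : Bool} {F : ℂ →L[ℝ] ℂ}
    (hF : HasFDerivAt (smoothingCoord b) F 0) (hinj : Function.Injective F) :
    IsComplexFrame b (curve (smoothingCoord b 0)) (dchart (smoothingCoord b 0) (F 1))
      (dchart (smoothingCoord b 0) (F Complex.I)) := by
  have norm_ne : ∀ᶠ ζ : ℂ in nhds 0, ‖ζ‖ ≠ 1 :=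
    continuous_norm.continuousAt.eventually_ne (by simp)
  refine ⟨fun ζ => curve (smoothingCoord b ζ), (dchart _).comp F, rfl, ?_, ?_,
    linearIndependent_apply_one_I (F := ((dchart _).comp F).toLinearMap)
      ((dchart_injective _).comp hinj), rfl, rfl⟩
  · filter_upwards [self_mem_nhdsWithin, norm_ne.filter_mono nhdsWithin_le_nhds] with ζ h0 h1
    exact isSmoothing_curve h0 h1
  · simp only [emb_curve]
    exact (hasFDerivAt_chart _).comp 0 hF

theorem hasFDerivAt_smoothingCoord_true :
    HasFDerivAt (smoothingCoord true) (-ContinuousLinearMap.id ℝ ℂ) 0 := by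
  have deriv : HasDerivAt (fun ζ : ℂ => ζ / (ζ - 1)) (-1) 0 :=
    ((hasDerivAt_id (0 : ℂ)).div ((hasDerivAt_id (0 : ℂ)).sub_const 1) (by simp)).congr_deriv
      (by simp)
  have smoothingCoord_eq : smoothingCoord true = fun ζ : ℂ => ζ / (ζ - 1) := by
    funext ζ
    simp [smoothingCoord]
  rw [smoothingCoord_eq]
  exact (deriv.hasFDerivAt.restrictScalars ℝ).congr_fderiv (by ext; simp)

theorem hasFDerivAt_smoothingCoord_false :
    HasFDerivAt (smoothingCoord false) (Complex.conjCLE : ℂ →L[ℝ] ℂ) 0 := by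
  have deriv : HasDerivAt (fun ζ : ℂ => (1 - ζ)⁻¹) 1 (starRingEnd ℂ 0) :=
    (((hasDerivAt_id (starRingEnd ℂ (0 : ℂ))).const_sub 1).inv (by simp)).congr_deriv (by simp)
  have smoothingCoord_eq : smoothingCoord false = fun ζ : ℂ => (1 - starRingEnd ℂ ζ)⁻¹ := by
    funext ζ
    simp [smoothingCoord]
  rw [smoothingCoord_eq]
  exact ((deriv.hasFDerivAt.restrictScalars ℝ).comp (0 : ℂ)
    (Complex.conjCLE : ℂ →L[ℝ] ℂ).hasFDerivAt).congr_fderiv (by ext; simp)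

theorem boundaryAgrees_true : BoundaryAgrees realPath realCoOrientation true (curve 0) := by
  have frame := isComplexFrame_curve hasFDerivAt_smoothingCoord_true neg_injective
  simp only [smoothingCoord_zero, if_true] at frame
  refine ⟨-dchart 0 1, _, _, .inl ⟨by simp [realPath], ?_⟩, frame, 1, 0, 0, 1, by simp, ?_,
    by norm_num⟩
  · change _ = -derivWithin (fun t : ℝ => emb (curve t)) _ _
    rw [derivWithin_emb_curve (by simp), Complex.ofReal_zero]
  · simp [normal_curve]

theorem boundaryAgrees_false : BoundaryAgrees realPath realCoOrientation false (curve 1) := by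
  have frame := isComplexFrame_curve hasFDerivAt_smoothingCoord_false Complex.conjCLE.injective
  simp only [smoothingCoord_zero, Bool.false_eq_true, if_false] at frame
  refine ⟨dchart 1 1, _, _, .inr ⟨by simp [realPath], ?_⟩, frame, 1, 0, 0, 1, by simp, ?_,
    by norm_num⟩
  · change _ = derivWithin (fun t : ℝ => emb (curve t)) _ _
    rw [derivWithin_emb_curve (by simp), Complex.ofReal_one]
  · simp [normal_curve]

end RealDM

end

theorem lemma3p8 :
    ∃ (Y : EmbeddedPath (Fin 1) (Fin 2)) (ν : CoOrientation Y.carrier)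
      (Pp Pm : Moduli (Fin 1) (Fin 2)),
      IsP true Pp ∧ IsP false Pm ∧
      Regular 0 Y.carrier Y.bd ∧
      Disjoint Y.carrier (closure (stratum ∅ {0})) ∧
      Y.bd = {Pp, Pm} ∧ BoundaryAgrees Y ν true Pp ∧ BoundaryAgrees Y ν false Pm ∧
      HasDegreeForget 0 0 ν Y.bd 1 ∧
      HasDegreeStratum 0 Set.univ {0} ν Y.bd (-1) :=
  ⟨realPath, realCoOrientation, curve 0, curve 1, curve_zero ▸ isP_three true,
    curve_one ▸ isP_three false, regular_realPath, disjoint_carrier_closure_stratum, realPath_bd,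
    boundaryAgrees_true, boundaryAgrees_false, hasDegreeForget_realPath, hasDegreeStratum_realPath⟩
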